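/- Let $M$ be a smooth manifold of real dimension $4n$ with a hypercomplex Hermitian structure: a smooth action of the quaternions on $TM$, with standard triple $I,J,K=IJ=-JI$, such that every $L=aI+bJ+cK$ with $a^2+b^2+c^2=1$ is an integrable complex structure, and a Riemannian metric $s$ that is Hermitian for all these $L$. Assume that $M$ is HKT, i.e. the Bismut connections of $(s,I)$, $(s,J)$, $(s,K)$ coincide (the Bismut connection of $(s,L)$ is the connection on $TM$ that preserves $s$ and $L$ and whose torsion $s(T(u,v),w)$ is totally skew-symmetric). Put $\omega_L(v,w)=s(v,Lw)$ and $\Omega=\tfrac12(\omega_J+\sqrt{-1}\,\omega_K)$, a form of type $(2,0)$ on $(M,I)$, and let $L_\Omega(\eta)=\Omega\wedge\eta$. Let $\partial,\bar\partial$ be the Dolbeault operators of $(M,I)$, let $*$ be the conjugate-linear Hodge star operator of $s$ (so that $\alpha\wedge *\beta=\langle\alpha,\beta\rangle\,\mathrm{vol}$ for the Hermitian product $\langle\ ,\ \rangle$ on forms), and let $\partial^*=-*\partial*$, the formal Hermitian adjoint of $\partial$. Let $J$ act on complex-valued forms multiplicatively, as induced by its action on $TM$: $(J\alpha)(v_1,\dots,v_k)=\alpha(J^{-1}v_1,\dots,J^{-1}v_k)$.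 Let $\partial_J=J\circ\bar\partial\circ J^{-1}$; thus $\partial_J f=J(\bar\partial f)$ for functions, and $\partial_J$ satisfies the graded Leibniz rule. Finally let $$\delta_J^*=-[L_\Omega,\partial^*]=-(L_\Omega\,\partial^*-\partial^*L_\Omega).$$ Then there is a unique smooth $(0,1)$-form $\bar\theta$ on $(M,I)$ with $\bar\partial(\Omega^n)=\bar\theta\wedge\Omega^n$, and, with $\theta_J=J(\bar\theta)$, $$\delta_J^*\eta-\partial_J\eta=\theta_J\wedge\eta$$ for every smooth form $\eta\in\Lambda^{*,0}_I(M)$. -/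

import Mathlib

open scoped Manifold ContDiff

noncomputable section

namespace HKT

/-! ### Exterior algebra of a real vector space with complex coefficients -/

section Algebra

variable {V : Type*} [AddCommGroup V] [Module ℝ V] [TopologicalSpace V]

/-- Complex-valued exterior forms `Λ^* V^* ⊗ ℂ`: an element is the family of its components, the
one in degree `k` being an alternating `ℝ`-multilinear map `V^k → ℂ`. -/
abbrev Ext (V : Type*) [AddCommGroup V] [Module ℝ V] [TopologicalSpace V] : Type _ :=
  ∀ k : ℕ, V [⋀^Fin k]→L[ℝ] ℂ

/-- The (non-alternating) product `v ↦ α (v ∘ inl) * β (v ∘ inr)`. -/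
def mulForms {k l : ℕ} (α : V [⋀^Fin k]→L[ℝ] ℂ) (β : V [⋀^Fin l]→L[ℝ] ℂ) :
    ContinuousMultilinearMap ℝ (fun _ : Fin k ⊕ Fin l => V) ℂ where
  toMultilinearMap := (LinearMap.mul' ℝ ℂ).compMultilinearMap
    (MultilinearMap.domCoprod α.toMultilinearMap β.toMultilinearMap)
  cont := by
    have h : Continuous fun v : Fin k ⊕ Fin l → V =>
        α (fun i => v (Sum.inl i)) * β (fun i => v (Sum.inr i)) :=
      (α.coe_continuous.comp (by fun_prop)).mul (β.coe_continuous.comp (by fun_prop))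
    exact h

/-- The wedge product of a `k`-form and an `l`-form, as a form of degree `m = k + l`:
`(α ∧ β)(v) = 1/(k! l!) ∑_σ sgn(σ) α(v_σ(1), …, v_σ(k)) β(v_σ(k+1), …, v_σ(m))`. -/
def wedgeHom {k l m : ℕ} (h : k + l = m) (α : V [⋀^Fin k]→L[ℝ] ℂ) (β : V [⋀^Fin l]→L[ℝ] ℂ) :
    V [⋀^Fin m]→L[ℝ] ℂ :=
  ((k.factorial * l.factorial : ℕ) : ℂ)⁻¹ •
    ContinuousMultilinearMap.alternatization
      ((mulForms α β).domDomCongr (finSumFinEquiv.trans (finCongr h)))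

/-- The wedge product of inhomogeneous forms. -/
def wedge (α β : Ext V) : Ext V := fun m =>
  ∑ p : Finset.HasAntidiagonal.antidiagonal m, wedgeHom (Finset.HasAntidiagonal.mem_antidiagonal.mp p.2) (α p.1.1) (β p.1.2)

/-- The unit `1 ∈ Λ^0`. -/
def one : Ext V := fun k =>
  match k with
  | 0 => ContinuousAlternatingMap.constOfIsEmpty ℝ V (Fin 0) (1 : ℂ)
  | _ + 1 => 0

/-- Exterior powers `α^m = α ∧ ⋯ ∧ α`. -/
def wedgePow (α : Ext V) : ℕ → Ext V
  | 0 => one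
  | m + 1 => wedge α (wedgePow α m)

/-- The form of pure degree `k` given by `α`. -/
def ofDegree {k : ℕ} (α : V [⋀^Fin k]→L[ℝ] ℂ) : Ext V := fun l =>
  if h : k = l then h ▸ α else 0

/-- Pullback of forms by an endomorphism `A`: `v ↦ α (A v_1, …, A v_k)`. It is multiplicative. -/
def pull (A : V →L[ℝ] V) (α : Ext V) : Ext V := fun k => (α k).compContinuousLinearMap A

variable [IsTopologicalAddGroup V] [ContinuousSMul ℝ V]

/-- The action of the unit complex number `exp (i t)` on `V`, for a complex structure `L`. -/
def rot (L : V →L[ℝ] V) (t : ℝ) : V →L[ℝ] V :=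
  Real.cos t • ContinuousLinearMap.id ℝ V + Real.sin t • L

/-- `α` is of Hodge type `(p,q)` for the complex structure `L`: it has degree `p + q` and the
unit complex number `exp (i t)` acts on it by `exp (i (p - q) t)`. In particular a
`1`-form is of type `(1,0)` iff `α (L v) = i α v`, and of type `(0,1)` iff `α (L v) = - i α v`. -/
def IsOfType (L : V →L[ℝ] V) (p q : ℕ) {k : ℕ} (α : V [⋀^Fin k]→L[ℝ] ℂ) : Prop :=
  k = p + q ∧ ∀ t : ℝ, α.compContinuousLinearMap (rot L t) =
    Complex.exp (((p : ℂ) - q) * t * Complex.I) • α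

/-- The component of Hodge type `(p,q)` of a form of degree `k = p + q`: the isotypic projection
for the circle action, as an average over the `k + 1` angles `π j / (k + 1)`; these suffice since
the weights occurring are `k, k - 2, …, -k`. See `typeComp_of_isOfType`. -/
def typeComp (L : V →L[ℝ] V) (p q : ℕ) {k : ℕ} (α : V [⋀^Fin k]→L[ℝ] ℂ) : V [⋀^Fin k]→L[ℝ] ℂ :=
  if k = p + q then
    ((k : ℂ) + 1)⁻¹ • ∑ j ∈ Finset.range (k + 1),
      Complex.exp (-(((p : ℂ) - q) * ((Real.pi * j / (k + 1) : ℝ) : ℂ) * Complex.I)) •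
        α.compContinuousLinearMap (rot L (Real.pi * j / (k + 1)))
  else 0

/-- `typeComp L p q` is the identity on forms of type `(p,q)` and annihilates the forms of the same
degree of any other type. -/
theorem typeComp_of_isOfType (L : V →L[ℝ] V) {p q p' q' k : ℕ} (hk : k = p + q)
    {α : V [⋀^Fin k]→L[ℝ] ℂ} (hα : IsOfType L p' q' α) :
    typeComp L p q α = if p = p' then α else 0 := by
  obtain ⟨hk', hα⟩ := hα
  have hk0 : ((k : ℂ) + 1) ≠ 0 := by exact_mod_cast Nat.succ_ne_zero k
  set z : ℂ := Complex.exp (2 * Real.pi * Complex.I * (((p' : ℤ) - p : ℤ) / ((k + 1 : ℕ) : ℂ)))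
    with hz
  have hq : (q : ℂ) = k - p := by rw [hk]; push_cast; ring
  have hq' : (q' : ℂ) = k - p' := by rw [hk']; push_cast; ring
  have key : ∀ j : ℕ,
      Complex.exp (-(((p : ℂ) - q) * ((Real.pi * j / (k + 1) : ℝ) : ℂ) * Complex.I)) •
        α.compContinuousLinearMap (rot L (Real.pi * j / (k + 1))) = z ^ j • α := by
    intro j
    rw [hα, smul_smul, ← Complex.exp_add, hz, ← Complex.exp_nat_mul]
    congr 2
    rw [hq, hq']
    push_cast
    field_simp
    ring
  rw [typeComp, if_pos hk, Finset.sum_congr rfl fun j _ => key j, ← Finset.sum_smul, smul_smul]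
  split_ifs with h
  · have hz1 : z = 1 := by simp [hz, h]
    simp [hz1, hk0]
  · have hpow : z ^ (k + 1) = 1 := by
      rw [hz, ← Complex.exp_nat_mul]
      rw [Complex.exp_eq_one_iff]
      refine ⟨(p' : ℤ) - p, ?_⟩
      push_cast
      field_simp
    have hne : z ≠ 1 := by
      intro h1
      rw [hz, Complex.exp_eq_one_iff] at h1
      obtain ⟨m, hm⟩ := h1
      have hpi : (2 * Real.pi * Complex.I : ℂ) ≠ 0 := Complex.two_pi_I_ne_zero
      have h2 : ((((p' : ℤ) - p : ℤ) : ℂ) / ((k + 1 : ℕ) : ℂ)) = m := by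
        apply mul_left_cancel₀ hpi
        rw [hm]; ring
      rw [div_eq_iff (by exact_mod_cast Nat.succ_ne_zero k)] at h2
      have h3 : ((p' : ℤ) - p : ℤ) = m * ((k + 1 : ℕ) : ℤ) := by exact_mod_cast h2
      have h4 : |(p' : ℤ) - p| < ((k + 1 : ℕ) : ℤ) := by rw [abs_lt]; constructor <;> push_cast <;> omega
      have hm0 : m = 0 := by
        by_contra hm0
        have : 1 ≤ |m| := Int.one_le_abs hm0
        rw [h3, abs_mul, Nat.abs_cast] at h4
        nlinarith
      rw [hm0] at h3
      omega
    have hsum : ∑ j ∈ Finset.range (k + 1), z ^ j = 0 := by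
      have := mul_geom_sum z (k + 1)
      rw [hpow, sub_self] at this
      exact (mul_eq_zero.mp this).resolve_left (sub_ne_zero.mpr hne)
    rw [hsum, mul_zero]
    exact zero_smul ℂ α

/-- The `2`-form `ω_L(v, w) = s(v, L w)`. -/
def fundamentalForm (s : V →L[ℝ] V →L[ℝ] ℝ) (L : V →L[ℝ] V) (hL : ∀ v, s v (L v) = 0)
    (hs : Continuous fun v : V × V => s v.1 v.2) : V [⋀^Fin 2]→L[ℝ] ℂ where
  toFun v := (s (v 0) (L (v 1)) : ℂ)
  map_update_add' v i x y := by
    fin_cases i <;> simp [Function.update]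
  map_update_smul' v i c x := by
    fin_cases i <;> simp [Function.update]
  map_eq_zero_of_eq' v i j hv hij := by
    have h01 : v 0 = v 1 := by
      fin_cases i <;> fin_cases j <;> simp_all
    simp [h01, hL]
  cont := by
    have : Continuous fun v : Fin 2 → V => s (v 0) (L (v 1)) :=
      hs.comp (g := fun v : V × V => s v.1 v.2) (f := fun v : Fin 2 → V => (v 0, L (v 1)))
        ((continuous_apply 0).prodMk (L.continuous.comp (continuous_apply 1)))
    exact Complex.continuous_ofReal.comp this

/-- The covolume `v ↦ det (s (e_a, v_b))` of a family `e`. For an `s`-orthonormal basis `e`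
this is the volume form `e^1 ∧ ⋯ ∧ e^N` of `s` for the orientation given by `e`. -/
def volForm {ι : Type} [Fintype ι] [DecidableEq ι] (s : V →L[ℝ] V →L[ℝ] ℝ) (e : ι → V) :
    V [⋀^ι]→L[ℝ] ℂ where
  toAlternatingMap := Complex.ofRealCLM.toLinearMap.compAlternatingMap
    ((Matrix.detRowAlternating (n := ι) (R := ℝ)).compLinearMap
      (LinearMap.pi fun a => (s (e a)).toLinearMap))
  cont := by
    have h : Continuous fun v : ι → V =>
        ((Matrix.det (Matrix.of fun b a => s (e a) (v b)) : ℝ) : ℂ) := by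
      refine Complex.continuous_ofReal.comp (Continuous.matrix_det ?_)
      refine continuous_matrix fun b a => ?_
      exact (s (e a)).continuous.comp (continuous_apply b)
    exact h

/-- Insert the vectors `u_1, …, u_k` into the first `k` slots of `φ`. -/
def contractLeft {k l : ℕ} (φ : V [⋀^Fin k ⊕ Fin l]→L[ℝ] ℂ) (u : Fin k → V) :
    V [⋀^Fin l]→L[ℝ] ℂ where
  toFun w := φ (Sum.elim u w)
  map_update_add' w i x y := by
    classical
    simp only [← Sum.update_elim_inr, ContinuousAlternatingMap.map_update_add]
  map_update_smul' w i c x := by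
    classical
    simp only [← Sum.update_elim_inr, ContinuousAlternatingMap.map_update_smul]
  map_eq_zero_of_eq' w i j hw hij :=
    φ.map_eq_zero_of_eq _ (i := Sum.inr i) (j := Sum.inr j) (by simpa using hw) (by simpa using hij)
  cont := by
    refine φ.coe_continuous.comp (continuous_pi fun a => ?_)
    cases a with
    | inl a => exact continuous_const
    | inr a => exact continuous_apply a

/-- The (conjugate-linear) Hodge star operator of the metric `s`, computed in an `s`-orthonormal
oriented basis `e_1, …, e_N`: for a `k`-form `β`, with `l = N - k`,
`(* β)(w) = ∑_{i_1 < ⋯ < i_k} conj (β(e_{i_1}, …, e_{i_k})) vol(e_{i_1}, …, e_{i_k}, w_1, …, w_l)`.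
It is characterised by `α ∧ * β = ⟨α, β⟩ vol` with `⟨ , ⟩` the Hermitian product on forms. -/
def hodge {N : ℕ} (s : V →L[ℝ] V →L[ℝ] ℝ) (e : Fin N → V) (β : Ext V) : Ext V := fun l =>
  if h : l ≤ N then
    (((N - l).factorial : ℕ) : ℂ)⁻¹ • ∑ i : Fin (N - l) → Fin N,
      (starRingEnd ℂ) (β (N - l) (e ∘ i)) •
        contractLeft
          (volForm s (e ∘ (finSumFinEquiv.trans (finCongr (Nat.sub_add_cancel h)) :
            Fin (N - l) ⊕ Fin l ≃ Fin N)))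
          (e ∘ i)
  else 0

/-- The family `(u_1, …, u_n, I u_1, …, I u_n, J u_1, …, J u_n, K u_1, …, K u_n)`. -/
def quatFrame {n : ℕ} (I J K : V →L[ℝ] V) (u : Fin n → V) : Fin (4 * n) → V := fun j =>
  (![ContinuousLinearMap.id ℝ V, I, J, K] (finProdFinEquiv.symm j).1) (u (finProdFinEquiv.symm j).2)

/-- `u` is a quaternionic orthonormal basis: the family `quatFrame I J K u` is orthonormal. -/
def IsQuatOrthonormal {n : ℕ} (s : V →L[ℝ] V →L[ℝ] ℝ) (I J K : V →L[ℝ] V) (u : Fin n → V) :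
    Prop :=
  ∀ a b, s (quatFrame I J K u a) (quatFrame I J K u b) = if a = b then 1 else 0

end Algebra

/-! ### Differential forms on a manifold -/

section Forms

variable {E : Type*} [NormedAddCommGroup E] [NormedSpace ℝ E]
  {M : Type*} [TopologicalSpace M] [ChartedSpace E M]

variable (E M) in
/-- (Not necessarily smooth, inhomogeneous) complex-valued differential forms on `M`. -/
abbrev Form : Type _ := ∀ x : M, Ext (TangentSpace 𝓘(ℝ, E) x)

/-- The expression of a `k`-form in the chart around `x₀`, i.e. its pullback to `E` under the
inverse of the chart. It is meaningful on the target of the chart. -/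
def inChart {k : ℕ} (x₀ : M) (η : ∀ x : M, TangentSpace 𝓘(ℝ, E) x [⋀^Fin k]→L[ℝ] ℂ) :
    E → E [⋀^Fin k]→L[ℝ] ℂ := fun y =>
  (η ((chartAt E x₀).symm y)).compContinuousLinearMap
    (mfderiv 𝓘(ℝ, E) 𝓘(ℝ, E) (chartAt E x₀).symm y)

/-- Smoothness of a differential form: smoothness of its expressions in charts. -/
def IsSmooth (η : Form E M) : Prop :=
  ∀ (k : ℕ) (x₀ : M), ContDiffOn ℝ ∞ (inChart x₀ fun x => η x k) (chartAt E x₀).target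

/-- The exterior derivative of a `k`-form, computed at `x` in the chart around `x`. -/
def extD {k : ℕ} (η : ∀ x : M, TangentSpace 𝓘(ℝ, E) x [⋀^Fin k]→L[ℝ] ℂ) (x : M) :
    TangentSpace 𝓘(ℝ, E) x [⋀^Fin (k + 1)]→L[ℝ] ℂ :=
  (extDeriv (inChart x η) (chartAt E x x)).compContinuousLinearMap
    (mfderiv 𝓘(ℝ, E) 𝓘(ℝ, E) (chartAt E x) x)

/-- `∂`, on forms of type `(p,q)` the `(p+1,q)`-component of `d`, for the almost complex
structure `L`. -/
def del (L : ∀ x : M, TangentSpace 𝓘(ℝ, E) x →L[ℝ] TangentSpace 𝓘(ℝ, E) x) (η : Form E M) :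
    Form E M := fun x k =>
  match k with
  | 0 => 0
  | k + 1 => ∑ pq ∈ Finset.HasAntidiagonal.antidiagonal k,
      typeComp (L x) (pq.1 + 1) pq.2 (extD (fun y => typeComp (L y) pq.1 pq.2 (η y k)) x)

/-- `∂̄`, on forms of type `(p,q)` the `(p,q+1)`-component of `d`, for the almost complex
structure `L`. -/
def delbar (L : ∀ x : M, TangentSpace 𝓘(ℝ, E) x →L[ℝ] TangentSpace 𝓘(ℝ, E) x) (η : Form E M) :
    Form E M := fun x k =>
  match k with
  | 0 => 0
  | k + 1 => ∑ pq ∈ Finset.HasAntidiagonal.antidiagonal k,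
      typeComp (L x) pq.1 (pq.2 + 1) (extD (fun y => typeComp (L y) pq.1 pq.2 (η y k)) x)

end Forms

/-! ### Hypercomplex Hermitian and HKT manifolds -/

section Hypercomplex

variable {E : Type*} [NormedAddCommGroup E] [NormedSpace ℝ E]
  {M : Type*} [TopologicalSpace M] [ChartedSpace E M]

variable [IsManifold 𝓘(ℝ, E) ∞ M]

/-- An endomorphism field `L` has vanishing Nijenhuis tensor,
`[LX, LY] - L [LX, Y] - L [X, LY] - [X, Y] = 0`; if `L^2 = -1` this is integrability of `L`. -/
def IsIntegrable (L : ∀ x : M, TangentSpace 𝓘(ℝ, E) x →L[ℝ] TangentSpace 𝓘(ℝ, E) x) : Prop :=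
  ∀ (X Y : ∀ x : M, TangentSpace 𝓘(ℝ, E) x) (x : M),
    CMDiffAt ∞ (T% X) x → CMDiffAt ∞ (T% Y) x →
      VectorField.mlieBracket 𝓘(ℝ, E) (fun y => L y (X y)) (fun y => L y (Y y)) x
        - L x (VectorField.mlieBracket 𝓘(ℝ, E) (fun y => L y (X y)) Y x)
        - L x (VectorField.mlieBracket 𝓘(ℝ, E) X (fun y => L y (Y y)) x)
        - VectorField.mlieBracket 𝓘(ℝ, E) X Y x = 0

/-- Smoothness of an endomorphism field, as a section of `Hom(TM, TM)`. -/
def IsSmoothEnd (L : ∀ x : M, TangentSpace 𝓘(ℝ, E) x →L[ℝ] TangentSpace 𝓘(ℝ, E) x) : Prop :=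
  ContMDiff 𝓘(ℝ, E) (𝓘(ℝ, E).prod 𝓘(ℝ, E →L[ℝ] E)) ∞
    (fun x => Bundle.TotalSpace.mk' (E →L[ℝ] E)
      (E := fun x : M => TangentSpace 𝓘(ℝ, E) x →L[ℝ] TangentSpace 𝓘(ℝ, E) x) x (L x))

variable (E M) in
/-- A hypercomplex Hermitian structure on `M`: a smooth action of the quaternions on `TM`, given
by the standard triple `I, J, K`, such that every imaginary unit quaternion
`a I + b J + c K` acts by an integrable almost complex structure,
and a Riemannian metric `s` for which all of these are Hermitian. -/
structure HypercomplexHermitian where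
  I : ∀ x : M, TangentSpace 𝓘(ℝ, E) x →L[ℝ] TangentSpace 𝓘(ℝ, E) x
  J : ∀ x : M, TangentSpace 𝓘(ℝ, E) x →L[ℝ] TangentSpace 𝓘(ℝ, E) x
  K : ∀ x : M, TangentSpace 𝓘(ℝ, E) x →L[ℝ] TangentSpace 𝓘(ℝ, E) x
  smooth_I : IsSmoothEnd I
  smooth_J : IsSmoothEnd J
  smooth_K : IsSmoothEnd K
  I_sq : ∀ x v, I x (I x v) = -v
  J_sq : ∀ x v, J x (J x v) = -v
  I_J : ∀ x v, I x (J x v) = K x v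
  J_I : ∀ x v, J x (I x v) = -(K x v)
  integrable : ∀ a b c : ℝ, a ^ 2 + b ^ 2 + c ^ 2 = 1 →
    IsIntegrable fun x => a • I x + b • J x + c • K x
  metric : Bundle.ContMDiffRiemannianMetric 𝓘(ℝ, E) ∞ E (fun x : M => TangentSpace 𝓘(ℝ, E) x)
  hermitian : ∀ a b c : ℝ, a ^ 2 + b ^ 2 + c ^ 2 = 1 → ∀ x v w,
    metric.inner x ((a • I x + b • J x + c • K x) v) ((a • I x + b • J x + c • K x) w)
      = metric.inner x v w

namespace HypercomplexHermitian

variable (X : HypercomplexHermitian E M)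

lemma hermitian_J (x : M) (v w : TangentSpace 𝓘(ℝ, E) x) :
    X.metric.inner x (X.J x v) (X.J x w) = X.metric.inner x v w := by
  simpa using X.hermitian 0 1 0 (by norm_num) x v w

lemma hermitian_K (x : M) (v w : TangentSpace 𝓘(ℝ, E) x) :
    X.metric.inner x (X.K x v) (X.K x w) = X.metric.inner x v w := by
  simpa using X.hermitian 0 0 1 (by norm_num) x v w

lemma K_sq (x : M) (v : TangentSpace 𝓘(ℝ, E) x) : X.K x (X.K x v) = -v := by
  rw [← X.I_J x v, ← X.I_J, X.J_I, ← X.I_J, map_neg, X.I_sq, X.J_sq]; simp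

lemma inner_J_self (x : M) (v : TangentSpace 𝓘(ℝ, E) x) :
    X.metric.inner x v (X.J x v) = 0 := by
  have h := X.hermitian_J x v (X.J x v)
  rw [X.J_sq, map_neg, X.metric.symm] at h
  linarith

lemma inner_K_self (x : M) (v : TangentSpace 𝓘(ℝ, E) x) :
    X.metric.inner x v (X.K x v) = 0 := by
  have h := X.hermitian_K x v (X.K x v)
  rw [X.K_sq, map_neg, X.metric.symm] at h
  linarith

lemma continuous_inner (x : M) :
    Continuous fun v : TangentSpace 𝓘(ℝ, E) x × TangentSpace 𝓘(ℝ, E) x =>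
      X.metric.inner x v.1 v.2 := by
  have h : Continuous fun v : E × E => (show E →L[ℝ] E →L[ℝ] ℝ from X.metric.inner x) v.1 v.2 := by
    fun_prop
  exact h

/-- `Ω = (ω_J + i ω_K) / 2`, where `ω_L(v, w) = s(v, L w)`; a form of type `(2,0)` for `I`. -/
def Omega : Form E M := fun x => ofDegree
  ((1 / 2 : ℂ) •
    (fundamentalForm (X.metric.inner x) (X.J x) (X.inner_J_self x) (X.continuous_inner x)
      + Complex.I •
        fundamentalForm (X.metric.inner x) (X.K x) (X.inner_K_self x) (X.continuous_inner x)))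

/-- A smooth form in `Λ^{*,0}` with respect to `I`. -/
def IsSmoothStarZero (η : Form E M) : Prop :=
  IsSmooth η ∧ ∀ x k, IsOfType (X.I x) k 0 (η x k)

/-- The action of the unit quaternion `J` on forms induced by its action on `TM`: multiplicative,
and `(J α)(v) = α (J⁻¹ v)` on `1`-forms. -/
def actJ (η : Form E M) : Form E M := fun x => pull (-X.J x) (η x)

/-- The inverse of `actJ`. -/
def actJInv (η : Form E M) : Form E M := fun x => pull (X.J x) (η x)

/-- `∂_J = J ∘ ∂̄ ∘ J⁻¹`: on functions `∂_J f = J (∂̄ f)`, and it satisfies the graded Leibniz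
rule. -/
def delJ (η : Form E M) : Form E M := X.actJ (delbar X.I (X.actJInv η))

/-- `L_Ω`, the exterior multiplication by `Ω`. -/
def LOmega (η : Form E M) : Form E M := fun x => wedge (X.Omega x) (η x)

/-- `θ` is a smooth form of type `(0,1)` with `∂̄ (Ω^n) = θ ∧ Ω^n`. -/
def IsThetaBar (n : ℕ) (θ : Form E M) : Prop :=
  IsSmooth θ ∧
  (∀ x, ∃ α : TangentSpace 𝓘(ℝ, E) x [⋀^Fin 1]→L[ℝ] ℂ, IsOfType (X.I x) 0 1 α ∧ θ x = ofDegree α) ∧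
  delbar X.I (fun x => wedgePow (X.Omega x) n) = fun x => wedge (θ x) (wedgePow (X.Omega x) n)

section Bismut

variable [FiniteDimensional ℝ E]

/-- `D` is the Bismut connection of the Hermitian structure `(s, L)`: it preserves `s` and `L`,
and its torsion, viewed as the tensor `s(T(u, v), w)`, is totally skew-symmetric. Note that
`D Y x v` is `(∇_v Y)(x)`. -/
structure IsBismut (L : ∀ x : M, TangentSpace 𝓘(ℝ, E) x →L[ℝ] TangentSpace 𝓘(ℝ, E) x)
    (D : CovariantDerivative 𝓘(ℝ, E) E (fun x : M => TangentSpace 𝓘(ℝ, E) x)) : Prop where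
  metric : ∀ (Y Z : ∀ x : M, TangentSpace 𝓘(ℝ, E) x) (x : M), MDiffAt (T% Y) x → MDiffAt (T% Z) x →
    ∀ v : TangentSpace 𝓘(ℝ, E) x,
      mfderiv 𝓘(ℝ, E) 𝓘(ℝ, ℝ) (fun y => X.metric.inner y (Y y) (Z y)) x v =
        X.metric.inner x (D Y x v) (Z x) + X.metric.inner x (Y x) (D Z x v)
  complex : ∀ (Y : ∀ x : M, TangentSpace 𝓘(ℝ, E) x) (x : M), MDiffAt (T% Y) x →
    ∀ v : TangentSpace 𝓘(ℝ, E) x, D (fun y => L y (Y y)) x v = L x (D Y x v)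
  torsion : ∀ (x : M) (u v w : TangentSpace 𝓘(ℝ, E) x),
    X.metric.inner x (D.torsion x u v) w = -X.metric.inner x (D.torsion x u w) v

/-- The HKT condition: the Bismut connections of `(s, I)`, `(s, J)` and `(s, K)` coincide. -/
def IsHKT : Prop :=
  ∃ D : CovariantDerivative 𝓘(ℝ, E) E (fun x : M => TangentSpace 𝓘(ℝ, E) x),
    X.IsBismut X.I D ∧ X.IsBismut X.J D ∧ X.IsBismut X.K D

end Bismut

end HypercomplexHermitian

end Hypercomplex

section Star

/-- `ℝ^{4n}`. -/
abbrev Model (n : ℕ) : Type := EuclideanSpace ℝ (Fin (4 * n))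

variable {n : ℕ} {M : Type*} [TopologicalSpace M] [ChartedSpace (Model n) M]
  [IsManifold 𝓘(ℝ, Model n) ∞ M] (X : HypercomplexHermitian (Model n) M)

/-- A quaternionic orthonormal basis of `T_x M`; its choice does not affect `star`, since the
quaternionic unitary group is contained in the special orthogonal group. -/
def HypercomplexHermitian.frame (x : M) : Fin n → TangentSpace 𝓘(ℝ, Model n) x :=
  Classical.epsilon (IsQuatOrthonormal (X.metric.inner x) (X.I x) (X.J x) (X.K x))

/-- The (conjugate-linear) Hodge star operator of the Riemannian metric, for the quaternionic
orientation. -/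
def HypercomplexHermitian.star (η : Form (Model n) M) : Form (Model n) M := fun x =>
  hodge (X.metric.inner x) (quatFrame (X.I x) (X.J x) (X.K x) (X.frame x)) (η x)

/-- `∂^* = - * ∂ *`, the formal Hermitian adjoint of `∂`. -/
def HypercomplexHermitian.delStar (η : Form (Model n) M) : Form (Model n) M :=
  -X.star (del X.I (X.star η))

/-- `δ_J^* = - [L_Ω, ∂^*]`. -/
def HypercomplexHermitian.deltaJStar (η : Form (Model n) M) : Form (Model n) M :=
  -(X.LOmega (X.delStar η) - X.delStar (X.LOmega η))

end Star

end HKT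

/-! Let `D` be the common Bismut connection and `T` its torsion. Since `D` preserves the metric and
`I`, `J`, `K`, the star operator, the action of `J` on forms and multiplication by `Ω` are all
parallel. For a connection with torsion, `dφ = ∑ e^a ∧ (∇_a φ + ½ T(e_a)·φ)`, where `T(e_a)·` is the
derivation `der` of the exterior algebra (`HasCovJet.extD_eq`). Skewness of `s(T(u, v), w)` makes
`T(e_a)` a skew endomorphism, so its derivation commutes with the star. Writing `π` for the
projection to `Λ^{*,0}`, one gets on `Λ^{*,0}` `∂^* φ = -π ∑ ι_a (∇_a φ + ½ T(e_a)·φ)` and `∂_J φ =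
π ∑ J e^a ∧ (∇_a φ + ½ (J T(e_a) J⁻¹)·φ)` (`HasCovJet.delStar_eq`, `HasCovJet.delJ_eq`).

In `δ_J^* - ∂_J` the first-order terms cancel: `[ι_a, Ω ∧] = ι_a Ω ∧`, and the `(1,0)`-part of `J
e^a` is `-ι_a Ω`. What remains is algebraic in `T` (`QuatHerm.identity`). The terms of shape `e ∧ e
∧ ι` are killed by `π`, because `J` and `K` are integrable (`QuatHerm.proj0_quadratic`). The rest is
multiplication by the `(1,0)`-part of `-½ (λ_J + i λ_K)`, with the Lee covectors `λ_L(v) = ½ ∑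
s(T(v, e_a), L e_a)`.

On the other side `Ω^n` is parallel, so `∂̄ Ω^n` comes from the torsion alone. As `Ω^n` has top
degree among forms of type `(p,0)`, its `∂̄` is `θ̄ ∧ Ω^n` with `θ̄` the `(0,1)`-part of `i λ_I`
(`QuatHerm.typeComp_top`). Integrability of `I` and `J` gives `λ_J = λ_K ∘ I` and `λ_K = λ_I ∘ J`,
whence the remaining `1`-form above is `J θ̄` (`QuatHerm.thetaJ_eq`). The form `θ̄` is unique since
`Ω^n` vanishes nowhere, and smooth since `T` is expressed by first derivatives of `ω_I`.

To make parallelism concrete, a smooth frame is built near each point in which `s`, `I`, `J`, `K`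
have constant coefficients (`exists_intertwiner`, `AdaptedFrame`). Operators with constant
coefficients in this frame then commute with `∇`. -/

namespace HKT

/-! ### Creation and annihilation operators on the exterior algebra -/

section ExteriorAlgebra

variable {V : Type*} [NormedAddCommGroup V] [NormedSpace ℝ V]

open ContinuousAlternatingMap

@[simp] lemma smul_zero_form {k : ℕ} (c : ℂ) : c • (0 : V [⋀^Fin k]→L[ℝ] ℂ) = 0 := by ext v; simp

@[simp] lemma zero_smul_form {k : ℕ} (φ : V [⋀^Fin k]→L[ℝ] ℂ) : (0 : ℂ) • φ = 0 := by ext v; simp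

@[simp] lemma smul_zero_ext (c : ℂ) : c • (0 : Ext V) = 0 := by funext k; ext v; simp

@[simp] lemma zero_smul_ext (η : Ext V) : (0 : ℂ) • η = 0 := by funext k; ext v; simp

/-- Exterior multiplication by a complex-valued `1`-form. -/
def eps : (V →L[ℝ] ℂ) →ₗ[ℂ] Module.End ℂ (Ext V) :=
  LinearMap.mk₂ ℂ
    (fun α η k => match k with
      | 0 => 0
      | k + 1 => alternatizeUncurryFin (α.smulRight (η k)))
    (by
      intro α β η; funext k
      cases k with
      | zero => simp
      | succ k => ext v; simp [alternatizeUncurryFin_apply, add_mul, Finset.sum_add_distrib, smul_add])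
    (by
      intro c α η; funext k
      cases k with
      | zero => ext v; simp
      | succ k => ext v; simp [alternatizeUncurryFin_apply, Finset.mul_sum, mul_assoc, mul_left_comm])
    (by
      intro α η ζ; funext k
      cases k with
      | zero => simp
      | succ k => ext v; simp [alternatizeUncurryFin_apply, Finset.sum_add_distrib])
    (by
      intro c α η; funext k
      cases k with
      | zero => ext v; simp
      | succ k => ext v; simp [alternatizeUncurryFin_apply, Finset.mul_sum, mul_left_comm])

@[simp] lemma eps_zero_deg (α : V →L[ℝ] ℂ) (η : Ext V) : eps α η 0 = 0 := rfl

lemma eps_succ (α : V →L[ℝ] ℂ) (η : Ext V) (k : ℕ) :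
    eps α η (k + 1) = alternatizeUncurryFin (α.smulRight (η k)) := rfl

lemma eps_succ_apply (α : V →L[ℝ] ℂ) (η : Ext V) (k : ℕ) (v : Fin (k + 1) → V) :
    eps α η (k + 1) v = ∑ i : Fin (k + 1), (-1) ^ (i : ℕ) * (α (v i) * η k (i.removeNth v)) := by
  rw [eps_succ, alternatizeUncurryFin_apply]
  simp

/-- Contraction with a vector. -/
def inn : V →ₗ[ℝ] Module.End ℂ (Ext V) :=
  { toFun := fun v =>
      { toFun := fun η k => (η (k + 1)).curryLeft v
        map_add' := fun η ζ => by funext k; simp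
        map_smul' := fun c η => by funext k; ext w; simp }
    map_add' := fun v w => by ext η k u; simp
    map_smul' := fun c v => by ext η k u; simp }

lemma inn_apply (v : V) (η : Ext V) (k : ℕ) (w : Fin k → V) :
    inn v η k w = η (k + 1) (Matrix.vecCons v w) := rfl

lemma inn_deg (v : V) (η : Ext V) (k : ℕ) : inn v η k = (η (k + 1)).curryLeft v := rfl

lemma ext_inn {η ζ : Ext V} (h0 : η 0 = ζ 0) (h : ∀ v, inn v η = inn v ζ) : η = ζ := by
  funext k
  cases k with
  | zero => exact h0
  | succ k =>
    ext w
    have := congrArg (fun ξ : Ext V => ξ k (Matrix.vecTail w)) (h (w 0))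
    have hw : Matrix.vecCons (w 0) (Matrix.vecTail w) = w := Matrix.cons_head_tail w
    simpa only [inn_apply, hw] using this

/-- This is the induction step for operator identities on `Ext V`: both sides are commuted past
every contraction, which lowers the degree by one. -/
lemma deg_eq_of_inn {k : ℕ} {η ζ : Ext V} (h : ∀ v, inn v η k = inn v ζ k) :
    η (k + 1) = ζ (k + 1) := by
  ext w
  have := congrArg (fun ξ => ξ (Matrix.vecTail w)) (h (w 0))
  have hw : Matrix.vecCons (w 0) (Matrix.vecTail w) = w := Matrix.cons_head_tail w
  simpa only [inn_apply, hw] using this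

/-- The canonical anticommutation relation. The term `i = 0` of the alternating sum gives `α v • η`;
in the others `v` stays in the first slot and the index shift produces the sign. -/
lemma inn_eps (v : V) (α : V →L[ℝ] ℂ) (η : Ext V) :
    inn v (eps α η) = α v • η - eps α (inn v η) := by
  funext k
  ext w
  rw [inn_apply, eps_succ_apply, Fin.sum_univ_succ]
  cases k with
  | zero =>
    have : (0 : Fin 1).removeNth (Matrix.vecCons v w) = w := Subsingleton.elim _ _
    simp [this]
  | succ k =>
    rw [Pi.sub_apply, ContinuousAlternatingMap.sub_apply, eps_succ_apply, sub_eq_add_neg,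
      ← Finset.sum_neg_distrib]
    congr 1
    · simp [Matrix.vecCons]
    · refine Finset.sum_congr rfl fun i _ => ?_
      rw [inn_apply]
      have : (i.succ).removeNth (Matrix.vecCons v w) = Matrix.vecCons v (i.removeNth w) := by
        funext j
        refine Fin.cases ?_ (fun j => ?_) j <;> simp [Fin.removeNth, Matrix.vecCons]
      rw [this]
      simp [pow_succ]

lemma eps_eps (α β : V →L[ℝ] ℂ) (η : Ext V) : eps α (eps β η) = -eps β (eps α η) := by
  funext k
  induction k generalizing η with
  | zero => simp
  | succ k ih =>
    refine deg_eq_of_inn fun v => ?_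
    simp only [map_neg, inn_eps, map_sub, map_smul, Pi.sub_apply, Pi.smul_apply, Pi.neg_apply, ih]
    abel

lemma inn_one (v : V) : inn v (one : Ext V) = 0 := by
  funext k; rfl

@[simp] lemma one_zero : (one : Ext V) 0 = ContinuousAlternatingMap.constOfIsEmpty ℝ V (Fin 0) (1 : ℂ) := rfl

lemma one_succ (k : ℕ) : (one : Ext V) (k + 1) = 0 := rfl

/-- The degree involution. -/
def sgn : Module.End ℂ (Ext V) where
  toFun η k := (-1 : ℂ) ^ k • η k
  map_add' η ζ := by funext k; simp
  map_smul' c η := by funext k; simp [smul_smul, mul_comm]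

lemma sgn_apply (η : Ext V) (k : ℕ) : sgn η k = (-1 : ℂ) ^ k • η k := rfl

@[simp] lemma sgn_one : sgn (one : Ext V) = one := by
  funext k
  cases k with
  | zero => simp [sgn_apply]
  | succ k => rw [sgn_apply, one_succ]; ext v; simp

@[simp] lemma sgn_sgn (η : Ext V) : sgn (sgn η) = η := by
  funext k; simp [sgn_apply, smul_smul, ← mul_pow]

lemma sgn_eps (α : V →L[ℝ] ℂ) (η : Ext V) : sgn (eps α η) = -eps α (sgn η) := by
  funext k
  cases k with
  | zero => simp [sgn_apply]
  | succ k =>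
    ext v
    simp only [sgn_apply, Pi.neg_apply, ContinuousAlternatingMap.smul_apply,
      ContinuousAlternatingMap.neg_apply, eps_succ_apply, smul_eq_mul, Finset.mul_sum,
      ← Finset.sum_neg_distrib]
    refine Finset.sum_congr rfl fun i _ => ?_
    rw [pow_succ]; ring

lemma sgn_inn (v : V) (η : Ext V) : sgn (inn v η) = -inn v (sgn η) := by
  funext k
  ext w
  simp [sgn_apply, inn_apply, pow_succ]

lemma inn_ofDegree {k : ℕ} (φ : V [⋀^Fin (k + 1)]→L[ℝ] ℂ) (v : V) :
    inn v (ofDegree φ) = ofDegree (φ.curryLeft v) := by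
  funext l
  rw [inn_deg]
  unfold ofDegree
  by_cases h : k = l
  · subst h; simp
  · simp [h]

lemma inn_ofDegree_zero (φ : V [⋀^Fin 0]→L[ℝ] ℂ) (v : V) : inn v (ofDegree φ) = 0 := by
  funext l
  rw [inn_deg]
  simp [ofDegree]

@[simp] lemma ofDegree_self {k : ℕ} (φ : V [⋀^Fin k]→L[ℝ] ℂ) : ofDegree φ k = φ := by
  simp [ofDegree]

lemma ofDegree_of_ne {k l : ℕ} (φ : V [⋀^Fin k]→L[ℝ] ℂ) (h : k ≠ l) : ofDegree φ l = 0 := by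
  simp [ofDegree, h]

/-- A `1`-form as a covector. -/
def toCovector (φ : V [⋀^Fin 1]→L[ℝ] ℂ) : V →L[ℝ] ℂ :=
  (ContinuousAlternatingMap.ofSubsingleton ℝ V ℂ (0 : Fin 1)).symm φ

lemma toCovector_apply (φ : V [⋀^Fin 1]→L[ℝ] ℂ) (v : V) : toCovector φ v = φ ![v] := by
  simp only [toCovector]
  rw [← (Equiv.apply_symm_apply (ContinuousAlternatingMap.ofSubsingleton ℝ V ℂ (0 : Fin 1)) φ)]
  simp only [Equiv.symm_apply_apply, ContinuousAlternatingMap.ofSubsingleton_apply_apply]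
  rfl

lemma eps_one_apply (α : V →L[ℝ] ℂ) (v : Fin 1 → V) : eps α one 1 v = α (v 0) := by
  simp [eps_succ_apply]

lemma eps_one_deg (α : V →L[ℝ] ℂ) {k : ℕ} (hk : k ≠ 1) : eps α one k = 0 := by
  match k with
  | 0 => rfl
  | 1 => exact absurd rfl hk
  | k + 2 => ext v; simp [eps_succ_apply, one_succ]

lemma ofDegree_eq_eps (φ : V [⋀^Fin 1]→L[ℝ] ℂ) : ofDegree φ = eps (toCovector φ) one := by
  funext k
  by_cases hk : k = 1
  · subst hk
    ext v
    rw [eps_one_apply, toCovector_apply, ofDegree_self]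
    congr 1
    funext i
    fin_cases i; rfl
  · rw [eps_one_deg _ hk, ofDegree_of_ne _ (Ne.symm hk)]

end ExteriorAlgebra

end HKT

namespace HKT

/-! ### The wedge product in terms of creation operators -/

section Wedge

variable {V : Type*} [NormedAddCommGroup V] [NormedSpace ℝ V]

open ContinuousAlternatingMap Equiv

/-- Antisymmetrization of an arbitrary function of `m` vectors. -/
def altSum {m : ℕ} (F : (Fin m → V) → ℂ) (v : Fin m → V) : ℂ :=
  ∑ σ : Perm (Fin m), ((Perm.sign σ : ℤ) : ℂ) * F (v ∘ σ)

omit [NormedAddCommGroup V] [NormedSpace ℝ V] in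
lemma altSum_comp_perm {m : ℕ} (F : (Fin m → V) → ℂ) (c : Perm (Fin m)) (v : Fin m → V) :
    altSum (fun w => F (w ∘ c)) v = ((Perm.sign c : ℤ) : ℂ) * altSum F v := by
  unfold altSum
  rw [Finset.mul_sum, ← Equiv.sum_comp (Equiv.mulRight c)
    (fun σ => ((Perm.sign c : ℤ) : ℂ) * (((Perm.sign σ : ℤ) : ℂ) * F (v ∘ σ)))]
  refine Finset.sum_congr rfl fun σ _ => ?_
  have h : ((Perm.sign c : ℤ) : ℂ) * ((Perm.sign c : ℤ) : ℂ) = 1 := by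
    rcases Int.units_eq_one_or (Perm.sign c) with h | h <;> simp [h]
  simp only [Equiv.coe_mulRight, Perm.sign_mul, Units.val_mul, Int.cast_mul, Perm.coe_mul]
  have hF : F ((v ∘ σ) ∘ c) = F (v ∘ σ ∘ c) := rfl
  rw [hF]
  linear_combination (-((Perm.sign σ : ℤ) : ℂ) * F (v ∘ σ ∘ c)) * h

omit [NormedAddCommGroup V] [NormedSpace ℝ V] in
-- Each inner permutation only reindexes the outer antisymmetrization, and the two signs cancel; so
-- an inner antisymmetrization over a block costs just the number of its permutations.
lemma altSum_sum_perm {m k : ℕ} (F : (Fin m → V) → ℂ) (emb : Perm (Fin k) → Perm (Fin m))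
    (hemb : ∀ τ, Perm.sign (emb τ) = Perm.sign τ) (v : Fin m → V) :
    altSum (fun w => ∑ τ : Perm (Fin k), ((Perm.sign τ : ℤ) : ℂ) * F (w ∘ emb τ)) v
      = (k.factorial : ℂ) * altSum F v := by
  have h1 : altSum (fun w => ∑ τ : Perm (Fin k), ((Perm.sign τ : ℤ) : ℂ) * F (w ∘ emb τ)) v
      = ∑ τ : Perm (Fin k), ((Perm.sign τ : ℤ) : ℂ) * altSum (fun w => F (w ∘ emb τ)) v := by
    simp only [altSum, Finset.mul_sum]
    rw [Finset.sum_comm]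
    refine Finset.sum_congr rfl fun τ _ => Finset.sum_congr rfl fun σ _ => ?_
    ring
  rw [h1]
  have h2 : ∀ τ : Perm (Fin k), ((Perm.sign τ : ℤ) : ℂ) * altSum (fun w => F (w ∘ emb τ)) v
      = altSum F v := by
    intro τ
    rw [altSum_comp_perm, hemb, ← mul_assoc]
    rcases Int.units_eq_one_or (Perm.sign τ) with h | h <;> simp [h]
  simp [h2, Fintype.card_perm]

lemma altSum_alternating {m : ℕ} (γ : V [⋀^Fin m]→L[ℝ] ℂ) (v : Fin m → V) :
    altSum γ v = (m.factorial : ℂ) * γ v := by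
  have h : ∀ σ : Perm (Fin m), ((Perm.sign σ : ℤ) : ℂ) * γ (v ∘ σ) = γ v := by
    intro σ
    have : γ (v ∘ σ) = Perm.sign σ • γ v := γ.toAlternatingMap.map_perm v σ
    rw [this]
    rcases Int.units_eq_one_or (Perm.sign σ) with h | h <;> simp [h]
  simp [altSum, h, Fintype.card_perm]

/-- Antisymmetrize the alternating-sum formula for `eps`. Its `i`-th term is a cycle of sign
`(-1)^i` applied to the term `i = 0`, so all `m + 1` terms contribute equally, and `(m + 1)! / (m +
1) = m!`. -/
lemma eps_eq_altSum (a : V →L[ℝ] ℂ) (η : Ext V) (m : ℕ) (v : Fin (m + 1) → V) :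
    eps a η (m + 1) v
      = (m.factorial : ℂ)⁻¹ * altSum (fun w => a (w 0) * η m (fun j => w j.succ)) v := by
  have h1 := altSum_alternating (eps a η (m + 1)) v
  have h2 : altSum (eps a η (m + 1)) v
      = ∑ i : Fin (m + 1), (-1) ^ (i : ℕ) *
        altSum (fun w => (fun w : Fin (m + 1) → V => a (w 0) * η m (fun j => w j.succ))
          (w ∘ i.cycleRange.symm)) v := by
    simp only [altSum, Finset.mul_sum]
    rw [Finset.sum_comm]
    refine Finset.sum_congr rfl fun σ _ => ?_
    rw [eps_succ_apply, Finset.mul_sum]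
    refine Finset.sum_congr rfl fun i _ => ?_
    simp only [Function.comp_apply, Fin.cycleRange_symm_zero, Fin.cycleRange_symm_succ]
    rw [mul_left_comm]
    rfl
  rw [h2, Finset.sum_congr rfl fun (i : Fin (m + 1)) _ => congrArg ((-1 : ℂ) ^ (i : ℕ) * ·)
    (altSum_comp_perm (fun w : Fin (m + 1) → V => a (w 0) * η m (fun j => w j.succ))
      i.cycleRange.symm v)] at h1
  simp only [Perm.sign_symm, Fin.sign_cycleRange] at h1
  have h3 : ∀ i : Fin (m + 1), (-1 : ℂ) ^ (i : ℕ) *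
      ((((-1 : ℤˣ) ^ (i : ℕ) : ℤˣ) : ℤ) *
        altSum (fun w : Fin (m + 1) → V => a (w 0) * η m (fun j => w j.succ)) v)
      = altSum (fun w : Fin (m + 1) → V => a (w 0) * η m (fun j => w j.succ)) v := by
    intro i
    push_cast
    rw [← mul_assoc, ← mul_pow]
    simp
  rw [Finset.sum_congr rfl fun i _ => h3 i] at h1
  rw [Finset.sum_const, Finset.card_univ, Fintype.card_fin, nsmul_eq_mul, Nat.factorial_succ] at h1
  have hm : ((m + 1 : ℕ) : ℂ) ≠ 0 := Nat.cast_ne_zero.mpr (Nat.succ_ne_zero m)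
  have hf : (m.factorial : ℂ) ≠ 0 := Nat.cast_ne_zero.mpr (Nat.factorial_ne_zero m)
  rw [Nat.cast_mul, mul_assoc] at h1
  rw [mul_left_cancel₀ hm h1]
  field_simp

/-- The identification of index sets used by `wedgeHom`. -/
def idxEquiv {k l m : ℕ} (h : k + l = m) : Fin k ⊕ Fin l ≃ Fin m :=
  finSumFinEquiv.trans (finCongr h)

lemma wedgeHom_apply {k l m : ℕ} (h : k + l = m) (α : V [⋀^Fin k]→L[ℝ] ℂ)
    (β : V [⋀^Fin l]→L[ℝ] ℂ) (v : Fin m → V) :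
    wedgeHom h α β v = ((k.factorial * l.factorial : ℕ) : ℂ)⁻¹ *
      altSum (fun w => α (fun i => w (idxEquiv h (Sum.inl i))) *
        β (fun i => w (idxEquiv h (Sum.inr i)))) v := by
  unfold wedgeHom
  rw [ContinuousAlternatingMap.smul_apply,
    ContinuousMultilinearMap.alternatization_apply_apply, smul_eq_mul]
  congr 1
  refine Finset.sum_congr rfl fun σ _ => ?_
  rw [Units.smul_def, zsmul_eq_mul]
  rfl

/-- Permutations of the first block, as permutations of the whole index set. -/
def blockPerm {k l m : ℕ} (h : k + l = m) (τ : Perm (Fin k)) : Perm (Fin m) :=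
  (idxEquiv h).permCongr (Perm.sumCongr τ 1)

lemma sign_blockPerm {k l m : ℕ} (h : k + l = m) (τ : Perm (Fin k)) :
    Perm.sign (blockPerm h τ) = Perm.sign τ := by
  simp [blockPerm]

/-- Associativity of the wedge product with a `1`-form on the left. Both sides are multiples of the
antisymmetrization of the same function `G` of three blocks of arguments; the inner
antisymmetrizations, over the first `k + 1` indices on one side and the last `m` on the other,
contribute `(k + 1)!` and `m!`. Only the degree `m` part of `γ` enters `eps`, hence the form of
`hγ`. -/
lemma wedgeHom_eps {k l m : ℕ} (h : k + l = m) (h' : k + 1 + l = m + 1) (a : V →L[ℝ] ℂ)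
    (α β γ : Ext V) (hγ : γ m = wedgeHom h (α k) (β l)) :
    wedgeHom h' (eps a α (k + 1)) (β l) = eps a γ (m + 1) := by
  ext v
  have hk : (k.factorial : ℂ) ≠ 0 := Nat.cast_ne_zero.mpr (Nat.factorial_ne_zero k)
  have hk1 : ((k + 1).factorial : ℂ) ≠ 0 := Nat.cast_ne_zero.mpr (Nat.factorial_ne_zero _)
  have hl : (l.factorial : ℂ) ≠ 0 := Nat.cast_ne_zero.mpr (Nat.factorial_ne_zero l)
  have hm : (m.factorial : ℂ) ≠ 0 := Nat.cast_ne_zero.mpr (Nat.factorial_ne_zero m)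
  set G : (Fin (m + 1) → V) → ℂ := fun w => a (w 0) *
    (α k (fun i => w (idxEquiv h (Sum.inl i)).succ) *
      β l (fun i => w (idxEquiv h (Sum.inr i)).succ)) with hG
  have e0 : idxEquiv h' (Sum.inl 0) = 0 := by
    ext; simp [idxEquiv]
  have e1 : ∀ i : Fin k, idxEquiv h' (Sum.inl i.succ) = (idxEquiv h (Sum.inl i)).succ := by
    intro i; ext; simp [idxEquiv]
  have e2 : ∀ i : Fin l, idxEquiv h' (Sum.inr i) = (idxEquiv h (Sum.inr i)).succ := by
    intro i; ext; simp [idxEquiv]; omega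
  have hL : wedgeHom h' (eps a α (k + 1)) (β l) v
      = (((k + 1).factorial * l.factorial : ℕ) : ℂ)⁻¹ * ((k.factorial : ℂ)⁻¹ *
        altSum (fun w => ∑ τ : Perm (Fin (k + 1)), ((Perm.sign τ : ℤ) : ℂ) *
          G (w ∘ blockPerm h' τ)) v) := by
    rw [wedgeHom_apply]
    congr 1
    simp only [altSum, Finset.mul_sum]
    refine Finset.sum_congr rfl fun σ _ => ?_
    rw [eps_eq_altSum, altSum, Finset.mul_sum, Finset.sum_mul, Finset.mul_sum]
    refine Finset.sum_congr rfl fun τ _ => ?_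
    simp only [hG, Function.comp_apply, ← e1, ← e2]
    rw [← e0]
    simp only [blockPerm, Equiv.permCongr_apply, Equiv.symm_apply_apply, Perm.sumCongr_apply,
      Sum.map_inl, Sum.map_inr, Perm.coe_one, id]
    ring
  have hR : eps a γ (m + 1) v = (m.factorial : ℂ)⁻¹ *
      (((k.factorial * l.factorial : ℕ) : ℂ)⁻¹ *
        altSum (fun w => ∑ τ : Perm (Fin m), ((Perm.sign τ : ℤ) : ℂ) *
          G (w ∘ Perm.decomposeFin.symm (0, τ))) v) := by
    rw [eps_eq_altSum, hγ]
    congr 1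
    simp only [altSum, Finset.mul_sum]
    refine Finset.sum_congr rfl fun σ _ => ?_
    rw [wedgeHom_apply, altSum, Finset.mul_sum, Finset.mul_sum, Finset.mul_sum]
    refine Finset.sum_congr rfl fun τ _ => ?_
    simp only [hG, Function.comp_apply, Perm.decomposeFin_symm_apply_zero,
      Perm.decomposeFin_symm_apply_succ, Equiv.swap_self, Equiv.refl_apply]
    ring
  rw [hL, hR, altSum_sum_perm G (blockPerm h') (sign_blockPerm h'),
    altSum_sum_perm G (fun τ => Perm.decomposeFin.symm (0, τ)) (by intro τ; simp)]
  push_cast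
  field_simp

lemma wedgeHom_add_left {k l m : ℕ} (h : k + l = m) (α α' : V [⋀^Fin k]→L[ℝ] ℂ)
    (β : V [⋀^Fin l]→L[ℝ] ℂ) :
    wedgeHom h (α + α') β = wedgeHom h α β + wedgeHom h α' β := by
  ext v
  simp only [wedgeHom_apply, ContinuousAlternatingMap.add_apply, altSum, ← mul_add,
    ← Finset.sum_add_distrib, add_mul]

lemma wedgeHom_smul_left {k l m : ℕ} (h : k + l = m) (c : ℂ) (α : V [⋀^Fin k]→L[ℝ] ℂ)
    (β : V [⋀^Fin l]→L[ℝ] ℂ) :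
    wedgeHom h (c • α) β = c • wedgeHom h α β := by
  ext v
  simp only [wedgeHom_apply, ContinuousAlternatingMap.smul_apply, altSum, Finset.mul_sum,
    smul_eq_mul]
  refine Finset.sum_congr rfl fun σ _ => by ring

/-- Replacing the membership proof in the definition by an `if` allows sums over a plain
antidiagonal, without subtypes. -/
lemma wedge_apply (α β : Ext V) (m : ℕ) :
    wedge α β m = ∑ p ∈ Finset.HasAntidiagonal.antidiagonal m,
      if h : p.1 + p.2 = m then wedgeHom h (α p.1) (β p.2) else 0 := by
  rw [wedge, ← Finset.sum_coe_sort (Finset.HasAntidiagonal.antidiagonal m)]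
  refine Finset.sum_congr rfl fun p _ => ?_
  rw [dif_pos (Finset.HasAntidiagonal.mem_antidiagonal.mp p.2)]

lemma wedge_add_left (α α' β : Ext V) : wedge (α + α') β = wedge α β + wedge α' β := by
  funext m
  simp only [wedge, Pi.add_apply, wedgeHom_add_left, Finset.sum_add_distrib]

lemma wedge_smul_left (c : ℂ) (α β : Ext V) : wedge (c • α) β = c • wedge α β := by
  funext m
  simp only [wedge, Pi.smul_apply, wedgeHom_smul_left, Finset.smul_sum]

lemma wedgeHom_zero_left {k l m : ℕ} (h : k + l = m) (β : V [⋀^Fin l]→L[ℝ] ℂ) :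
    wedgeHom h (0 : V [⋀^Fin k]→L[ℝ] ℂ) β = 0 := by
  ext v
  simp [wedgeHom_apply, altSum]

lemma wedge_one (β : Ext V) : wedge one β = β := by
  funext m
  rw [wedge_apply, Finset.sum_eq_single (0, m)]
  · rw [dif_pos (zero_add m)]
    ext v
    have hm : (m.factorial : ℂ) ≠ 0 := Nat.cast_ne_zero.mpr (Nat.factorial_ne_zero m)
    have h2 : (fun w : Fin m → V => β m fun i => w (idxEquiv (zero_add m) (Sum.inr i))) = β m := by
      funext w
      congr 1
      funext i
      congr 1
      ext; simp [idxEquiv]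
    rw [wedgeHom_apply]
    simp only [one_zero, ContinuousAlternatingMap.constOfIsEmpty_apply, one_mul]
    rw [h2, altSum_alternating]
    simp [hm]
  · rintro ⟨p, q⟩ hp hne
    rw [Finset.HasAntidiagonal.mem_antidiagonal] at hp
    rw [dif_pos hp]
    cases p with
    | zero => exact absurd (by simpa using hp) (by simpa using hne)
    | succ p => exact wedgeHom_zero_left _ _
  · intro h; simp at h

/-- Together with `wedge_one` this turns left multiplication by any form generated by covectors into
a composition of operators `eps`; the permutation sums are not needed afterwards for such products.
-/
lemma wedge_eps (a : V →L[ℝ] ℂ) (α β : Ext V) : wedge (eps a α) β = eps a (wedge α β) := by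
  funext m
  cases m with
  | zero =>
    rw [wedge_apply, Finset.sum_eq_single (0, 0)]
    · exact wedgeHom_zero_left _ _
    · rintro ⟨p, q⟩ hp hne
      rw [Finset.HasAntidiagonal.mem_antidiagonal] at hp
      exact absurd (Prod.ext (by simp at hp ⊢; omega) (by simp at hp ⊢; omega)) hne
    · intro h; simp at h
  | succ m =>
    rw [wedge_apply, Finset.Nat.sum_antidiagonal_succ]
    have h0 : (if h : (0 : ℕ) + (m + 1) = m + 1 then
        wedgeHom h (eps a α 0) (β (m + 1)) else 0) = 0 := by
      rw [dif_pos (zero_add _)]; exact wedgeHom_zero_left _ _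
    rw [h0, zero_add]
    have h1 : eps a (wedge α β) (m + 1) = ∑ p ∈ Finset.HasAntidiagonal.antidiagonal m,
        eps a (fun l => if h : p.1 + p.2 = l then wedgeHom h (α p.1) (β p.2) else 0) (m + 1) := by
      ext v
      rw [ContinuousAlternatingMap.sum_apply]
      simp only [eps_succ_apply, wedge_apply, ContinuousAlternatingMap.sum_apply, Finset.mul_sum]
      rw [Finset.sum_comm]
    rw [h1]
    refine Finset.sum_congr rfl fun p hp => ?_
    rw [Finset.HasAntidiagonal.mem_antidiagonal] at hp
    have hp' : p.1 + 1 + p.2 = m + 1 := by omega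
    rw [dif_pos hp']
    exact wedgeHom_eps hp hp' a α β _ (by rw [dif_pos hp])

end Wedge

end HKT

namespace HKT

/-! ### Derivations of the exterior algebra and pullbacks -/

section Derivations

variable {V : Type*} [NormedAddCommGroup V] [NormedSpace ℝ V]

open ContinuousAlternatingMap

/-- The derivation of the exterior algebra induced by an endomorphism `X`,
`φ ↦ ∑ i, φ (…, X v_i, …)`. -/
def der : (V →L[ℝ] V) →ₗ[ℝ] Module.End ℂ (Ext V) :=
  { toFun := fun X =>
      { toFun := fun η k => (η k).fderivCompContinuousLinearMap (.id ℝ V) X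
        map_add' := fun η ζ => by
          funext k; ext v; simp [fderivCompContinuousLinearMap_apply, Finset.sum_add_distrib]
        map_smul' := fun c η => by
          funext k; ext v; simp [fderivCompContinuousLinearMap_apply, Finset.mul_sum] }
    map_add' := fun X Y => by ext η k v; simp
    map_smul' := fun c X => by ext η k v; simp }

lemma der_deg (X : V →L[ℝ] V) (η : Ext V) (k : ℕ) :
    der X η k = (η k).fderivCompContinuousLinearMap (.id ℝ V) X := rfl

lemma der_apply (X : V →L[ℝ] V) (η : Ext V) (k : ℕ) (v : Fin k → V) :
    der X η k v = ∑ i, η k (Function.update v i (X (v i))) := by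
  rw [der_deg, fderivCompContinuousLinearMap_apply]
  refine Finset.sum_congr rfl fun i _ => ?_
  congr 1
  funext j
  by_cases h : j = i
  · subst h; simp
  · simp [h]

lemma inn_der (v : V) (X : V →L[ℝ] V) (η : Ext V) :
    inn v (der X η) = der X (inn v η) + inn (X v) η := by
  funext k
  ext w
  rw [inn_apply, der_apply, Fin.sum_univ_succ, add_comm]
  simp only [Pi.add_apply, ContinuousAlternatingMap.add_apply, der_apply, inn_apply]
  congr 1
  · refine Finset.sum_congr rfl fun i _ => ?_
    congr 1
    simp only [Matrix.vecCons, Fin.cons_succ, Fin.cons_update]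
  · congr 1
    simp [Matrix.vecCons]

@[simp] lemma der_deg_zero (X : V →L[ℝ] V) (η : Ext V) : der X η 0 = 0 := by
  ext v
  simp [der_apply]

@[simp] lemma der_one (X : V →L[ℝ] V) : der X (one : Ext V) = 0 := by
  refine ext_inn (by simp) fun v => ?_
  rw [inn_der, inn_one, inn_one]
  simp

lemma der_eps (X : V →L[ℝ] V) (α : V →L[ℝ] ℂ) (η : Ext V) :
    der X (eps α η) = eps (α.comp X) η + eps α (der X η) := by
  funext k
  induction k generalizing η with
  | zero => simp
  | succ k ih =>
    refine deg_eq_of_inn fun v => ?_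
    simp only [inn_der, inn_eps, map_add, map_sub, map_smul, Pi.add_apply, Pi.sub_apply,
      Pi.smul_apply, ih, ContinuousLinearMap.comp_apply]
    abel

lemma pull_eps (A : V →L[ℝ] V) (α : V →L[ℝ] ℂ) (η : Ext V) :
    pull A (eps α η) = eps (α.comp A) (pull A η) := by
  funext k
  cases k with
  | zero => rfl
  | succ k => ext v; simp only [pull, compContinuousLinearMap_apply, eps_succ_apply]; rfl

lemma inn_pull (A : V →L[ℝ] V) (v : V) (η : Ext V) :
    inn v (pull A η) = pull A (inn (A v) η) := by
  funext k
  ext w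
  simp only [inn_apply, pull, compContinuousLinearMap_apply]
  congr 1
  funext i
  refine Fin.cases ?_ (fun j => ?_) i <;> simp [Matrix.vecCons]

lemma pull_add (A : V →L[ℝ] V) (η ζ : Ext V) : pull A (η + ζ) = pull A η + pull A ζ := rfl

lemma pull_smul (A : V →L[ℝ] V) (c : ℂ) (η : Ext V) : pull A (c • η) = c • pull A η := rfl

/-- `pull` as a linear map. -/
def pullL (A : V →L[ℝ] V) : Module.End ℂ (Ext V) where
  toFun := pull A
  map_add' := pull_add A
  map_smul' := pull_smul A

lemma pullL_apply (A : V →L[ℝ] V) (η : Ext V) : pullL A η = pull A η := rfl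

@[simp] lemma pull_one (A : V →L[ℝ] V) : pull A one = one := by
  refine ext_inn rfl fun v => ?_
  rw [inn_pull, inn_one, inn_one]
  rfl

lemma pull_pull (A B : V →L[ℝ] V) (η : Ext V) : pull A (pull B η) = pull (B.comp A) η := rfl

lemma pull_wedge (A : V →L[ℝ] V) (α β : Ext V) :
    pull A (wedge α β) = wedge (pull A α) (pull A β) := by
  funext m
  ext v
  simp only [pull, wedge, compContinuousLinearMap_apply, ContinuousAlternatingMap.sum_apply,
    wedgeHom_apply, altSum]
  rfl

lemma pull_der (A A' X : V →L[ℝ] V) (h : A'.comp A = .id ℝ V)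
    (η : Ext V) :
    pull A (der X (pull A' η)) = der (A'.comp (X.comp A)) η := by
  funext k
  ext v
  simp only [pull, compContinuousLinearMap_apply, der_apply]
  refine Finset.sum_congr rfl fun i _ => ?_
  congr 1
  funext j
  by_cases hj : j = i
  · subst hj; simp
  · simpa [hj] using congrArg (fun f => f (v j)) h

end Derivations

/-! ### Orthonormal bases -/

section ONB

variable {V : Type*} [NormedAddCommGroup V] [NormedSpace ℝ V]

/-- `e` is an orthonormal basis for the symmetric bilinear form `s`. -/
structure IsONB {N : ℕ} (s : V →L[ℝ] V →L[ℝ] ℝ) (e : Fin N → V) : Prop where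
  symm : ∀ u v, s u v = s v u
  orth : ∀ a b, s (e a) (e b) = if a = b then 1 else 0
  expand : ∀ v, ∑ a, s (e a) v • e a = v

/-- The covector `s(u, ·)`. -/
def cov (s : V →L[ℝ] V →L[ℝ] ℝ) : V →ₗ[ℝ] V →L[ℝ] ℂ where
  toFun u := Complex.ofRealCLM.comp (s u)
  map_add' u v := by ext w; simp
  map_smul' c v := by ext w; simp

@[simp] lemma cov_apply (s : V →L[ℝ] V →L[ℝ] ℝ) (u v : V) : cov s u v = (s u v : ℂ) := rfl

namespace IsONB

variable {N : ℕ} {s : V →L[ℝ] V →L[ℝ] ℝ} {e : Fin N → V}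

lemma sum_apply {W : Type*} [AddCommGroup W] [Module ℝ W] (h : IsONB s e) (f : V →ₗ[ℝ] W) (v : V) :
    ∑ a, s (e a) v • f (e a) = f v := by
  conv_rhs => rw [← h.expand v]
  simp

lemma sum_apply' {W : Type*} [AddCommGroup W] [Module ℝ W] [Module ℂ W] [IsScalarTower ℝ ℂ W]
    (h : IsONB s e) (f : V →ₗ[ℝ] W) (v : V) :
    ∑ a, (s (e a) v : ℂ) • f (e a) = f v := by
  rw [← h.sum_apply f v]
  refine Finset.sum_congr rfl fun a _ => ?_
  rw [← smul_one_smul ℂ (s (e a) v) (f (e a))]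
  simp

lemma covector_expand (h : IsONB s e) (α : V →L[ℝ] ℂ) : ∑ a, α (e a) • cov s (e a) = α := by
  ext v
  have := h.sum_apply' (α : V →ₗ[ℝ] ℂ) v
  simpa [mul_comm] using this

/-- Summing `s(e_a, v_i) ι_{e_a}` over `a` restores `ι_{v_i}`, so the operator is the
alternatization of `curryLeft`, which on an alternating form of degree `k + 1` is multiplication by
`k + 1`. -/
lemma euler (h : IsONB s e) (η : Ext V) (k : ℕ) :
    (∑ a, eps (cov s (e a)) (inn (e a) η)) (k + 1) = ((k : ℂ) + 1) • η (k + 1) := by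
  have h2 : (∑ a, eps (cov s (e a)) (inn (e a) η)) (k + 1)
      = ContinuousAlternatingMap.alternatizeUncurryFin (η (k + 1)).curryLeft := by
    ext v
    rw [Finset.sum_apply, ContinuousAlternatingMap.sum_apply,
      ContinuousAlternatingMap.alternatizeUncurryFin_apply]
    simp only [eps_succ_apply, cov_apply]
    rw [Finset.sum_comm]
    refine Finset.sum_congr rfl fun i _ => ?_
    rw [← Finset.mul_sum, zsmul_eq_mul]
    push_cast
    congr 1
    have := congrArg (fun φ : V [⋀^Fin k]→L[ℝ] ℂ => φ (i.removeNth v))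
      (h.sum_apply' ((η (k + 1)).curryLeft : V →ₗ[ℝ] V [⋀^Fin k]→L[ℝ] ℂ) (v i))
    simpa [ContinuousAlternatingMap.sum_apply, inn_apply] using this
  rw [h2, ContinuousAlternatingMap.alternatizeUncurryFin_curryLeft]
  ext v
  simp

lemma finiteDimensional (h : IsONB s e) : FiniteDimensional ℝ V := by
  have : Submodule.span ℝ (Set.range e) = ⊤ := by
    rw [eq_top_iff]
    intro v _
    rw [← h.expand v]
    exact Submodule.sum_mem _ fun a _ => Submodule.smul_mem _ _ (Submodule.subset_span ⟨a, rfl⟩)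
  exact ⟨(Submodule.fg_def).mpr ⟨Set.range e, Set.finite_range e, this⟩⟩

lemma linearIndependent (h : IsONB s e) : LinearIndependent ℝ e := by
  rw [Fintype.linearIndependent_iff]
  intro g hg i
  have := congrArg (s (e i)) hg
  simpa [h.orth] using this

/-- The basis underlying an orthonormal basis. -/
def basis (h : IsONB s e) : Module.Basis (Fin N) ℝ V :=
  Module.Basis.mk h.linearIndependent (by
    intro v _
    rw [← h.expand v]
    exact Submodule.sum_mem _ fun a _ => Submodule.smul_mem _ _ (Submodule.subset_span ⟨a, rfl⟩))

@[simp] lemma basis_apply (h : IsONB s e) (a : Fin N) : h.basis a = e a := by simp [basis]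

lemma basis_repr (h : IsONB s e) (v : V) (a : Fin N) : h.basis.repr v a = s (e a) v := by
  conv_lhs => rw [← h.expand v]
  simp only [map_sum, map_smul, ← h.basis_apply, Module.Basis.repr_self]
  simp [Finsupp.single_apply]

lemma deg_eq_zero (h : IsONB s e) {k : ℕ} (hk : N < k) (φ : V [⋀^Fin k]→L[ℝ] ℂ) : φ = 0 := by
  have := h.finiteDimensional
  ext v
  refine φ.toAlternatingMap.map_linearDependent v fun hv => ?_
  have := hv.fintype_card_le_finrank
  rw [Module.finrank_eq_card_basis h.basis] at this
  simp at this
  omega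

/-- The exterior algebra is generated by `1`-forms. -/
lemma ext_induction (h : IsONB s e) {p : Ext V → Prop} (hone : p one)
    (hadd : ∀ η ζ, p η → p ζ → p (η + ζ)) (hsmul : ∀ (c : ℂ) η, p η → p (c • η))
    (heps : ∀ u η, p η → p (eps (cov s u) η)) (η : Ext V) : p η := by
  have h0 : p 0 := by simpa using hsmul 0 _ hone
  have hsum : ∀ {ι : Type} (t : Finset ι) (f : ι → Ext V), (∀ i, p (f i)) → p (∑ i ∈ t, f i) := by
    intro ι t f hf
    classical
    induction t using Finset.induction_on with
    | empty => simpa using h0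
    | insert a t ha ih => rw [Finset.sum_insert ha]; exact hadd _ _ (hf a) ih
  have hdeg : ∀ (k : ℕ) (φ : V [⋀^Fin k]→L[ℝ] ℂ), p (ofDegree φ) := by
    intro k
    induction k with
    | zero =>
      intro φ
      have : ofDegree φ = φ ![] • (one : Ext V) := by
        refine ext_inn ?_ fun v => ?_
        · ext w
          simp [Subsingleton.elim w ![]]
        · rw [inn_ofDegree_zero, map_smul, inn_one, smul_zero_ext]
      rw [this]
      exact hsmul _ _ hone
    | succ k ih =>
      intro φ
      -- The Euler identity writes a form of degree `k + 1` as a combination of products of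
      -- covectors with forms of degree `k`.
      have : ofDegree φ = ((k : ℂ) + 1)⁻¹ • ∑ a, eps (cov s (e a)) (inn (e a) (ofDegree φ)) := by
        funext l
        have hk : ((k : ℂ) + 1) ≠ 0 := by exact_mod_cast Nat.succ_ne_zero k
        by_cases hl : k + 1 = l
        · subst hl
          rw [Pi.smul_apply, h.euler, smul_smul, inv_mul_cancel₀ hk, one_smul]
        · cases l with
          | zero => rw [ofDegree_of_ne _ hl]; ext v; simp
          | succ l => rw [Pi.smul_apply, h.euler, ofDegree_of_ne _ hl]; ext v; simp
      rw [this]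
      refine hsmul _ _ (hsum _ _ fun a => heps _ _ ?_)
      rw [inn_ofDegree]
      exact ih _
  -- Degrees above `N` vanish, so the infinite family of components is a finite sum.
  have : η = ∑ k ∈ Finset.range (N + 1), ofDegree (η k) := by
    funext l
    rw [Finset.sum_apply]
    by_cases hl : l < N + 1
    · rw [Finset.sum_eq_single l]
      · simp
      · intro b _ hb; exact ofDegree_of_ne _ hb
      · intro hb; exact absurd (Finset.mem_range.mpr hl) hb
    · rw [h.deg_eq_zero (by omega) (η l), Finset.sum_eq_zero]
      intro b hb
      exact ofDegree_of_ne _ (by have := Finset.mem_range.mp hb; omega)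
  rw [this]
  exact hsum _ _ fun k => hdeg k _

/-- Both sides are derivations that kill `1` and agree on covectors, and these generate the exterior
algebra. -/
lemma der_expand (h : IsONB s e) (X : V →L[ℝ] V) (η : Ext V) :
    der X η = ∑ b, eps ((cov s (e b)).comp X) (inn (e b) η) := by
  refine h.ext_induction (p := fun η => der X η = ∑ b, eps ((cov s (e b)).comp X) (inn (e b) η))
    ?_ ?_ ?_ ?_ η
  · simp [inn_one]
  · intro η ζ h1 h2; simp [h1, h2, Finset.sum_add_distrib]
  · intro c η h1; simp [h1, Finset.smul_sum]
  · intro u η h1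
    rw [der_eps, h1]
    simp only [inn_eps, map_sub, map_smul, map_sum, Finset.sum_sub_distrib]
    rw [sub_eq_add_neg, ← Finset.sum_neg_distrib]
    congr 1
    · have : (cov s u).comp X = ∑ b, cov s u (e b) • (cov s (e b)).comp X := by
        conv_lhs => rw [← h.covector_expand (cov s u)]
        ext v; simp
      conv_lhs => rw [this]
      simp only [map_sum, map_smul, LinearMap.sum_apply, LinearMap.smul_apply]
    · refine Finset.sum_congr rfl fun b _ => eps_eps _ _ _

end IsONB

end ONB

end HKT

namespace HKT

/-! ### Hodge types -/

section Types

variable {V : Type*} [NormedAddCommGroup V] [NormedSpace ℝ V]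

open ContinuousAlternatingMap

/-- The `(1,0)`-part of a covector. -/
def part10 (I : V →L[ℝ] V) : (V →L[ℝ] ℂ) →ₗ[ℂ] (V →L[ℝ] ℂ) where
  toFun α := (1 / 2 : ℂ) • (α - Complex.I • α.comp I)
  map_add' α β := by ext v; simp; ring
  map_smul' c α := by ext v; simp; ring

/-- The `(0,1)`-part of a covector. -/
def part01 (I : V →L[ℝ] V) : (V →L[ℝ] ℂ) →ₗ[ℂ] (V →L[ℝ] ℂ) where
  toFun α := (1 / 2 : ℂ) • (α + Complex.I • α.comp I)
  map_add' α β := by ext v; simp; ring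
  map_smul' c α := by ext v; simp; ring

lemma part10_apply (I : V →L[ℝ] V) (α : V →L[ℝ] ℂ) (v : V) :
    part10 I α v = (1 / 2 : ℂ) * (α v - Complex.I * α (I v)) := by simp [part10]

lemma part01_apply (I : V →L[ℝ] V) (α : V →L[ℝ] ℂ) (v : V) :
    part01 I α v = (1 / 2 : ℂ) * (α v + Complex.I * α (I v)) := by simp [part01]; ring

lemma part10_add_part01 (I : V →L[ℝ] V) (α : V →L[ℝ] ℂ) : part10 I α + part01 I α = α := by
  ext v
  simp only [_root_.add_apply, part10_apply, part01_apply]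
  ring

lemma rot_apply (I : V →L[ℝ] V) (t : ℝ) (v : V) :
    rot I t v = Real.cos t • v + Real.sin t • I v := by simp [rot]

lemma exp_I_mul (t : ℝ) :
    Complex.exp (t * Complex.I) = (Real.cos t : ℂ) + Real.sin t * Complex.I := by
  rw [Complex.exp_mul_I, Complex.ofReal_cos, Complex.ofReal_sin]

variable {I : V →L[ℝ] V}

lemma part10_comp (hI : ∀ v, I (I v) = -v) (α : V →L[ℝ] ℂ) (v : V) :
    part10 I α (I v) = Complex.I * part10 I α v := by
  simp only [part10_apply, hI, map_neg]
  linear_combination (1 / 2 * α (I v)) * Complex.I_mul_I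

lemma part01_comp (hI : ∀ v, I (I v) = -v) (α : V →L[ℝ] ℂ) (v : V) :
    part01 I α (I v) = -Complex.I * part01 I α v := by
  simp only [part01_apply, hI, map_neg]
  linear_combination (1 / 2 * α (I v)) * Complex.I_mul_I

lemma part10_rot (hI : ∀ v, I (I v) = -v) (α : V →L[ℝ] ℂ) (t : ℝ) :
    (part10 I α).comp (rot I t) = Complex.exp (t * Complex.I) • part10 I α := by
  ext v
  simp only [ContinuousLinearMap.comp_apply, rot_apply, map_add, map_smul, part10_comp hI,
    _root_.smul_apply, exp_I_mul, Complex.real_smul, smul_eq_mul]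
  ring

lemma part01_rot (hI : ∀ v, I (I v) = -v) (α : V →L[ℝ] ℂ) (t : ℝ) :
    (part01 I α).comp (rot I t) = Complex.exp (-(t * Complex.I)) • part01 I α := by
  have h : Complex.exp (-(t * Complex.I)) = (Real.cos t : ℂ) - Real.sin t * Complex.I := by
    have := exp_I_mul (-t)
    simp only [Real.cos_neg, Real.sin_neg] at this
    push_cast at this ⊢
    rw [← neg_mul, this]; ring
  ext v
  simp only [ContinuousLinearMap.comp_apply, rot_apply, map_add, map_smul, part01_comp hI,
    _root_.smul_apply, h, Complex.real_smul, smul_eq_mul]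
  ring

lemma eps_congr {η ζ : Ext V} {k : ℕ} (h : η k = ζ k) (α : V →L[ℝ] ℂ) :
    eps α η (k + 1) = eps α ζ (k + 1) := by
  rw [eps_succ, eps_succ, h]

lemma comp_eq_pull (A : V →L[ℝ] V) (η : Ext V) (k : ℕ) :
    (η k).compContinuousLinearMap A = pull A η k := rfl

lemma eps_type_aux {η : Ext V} {k : ℕ} {R : V →L[ℝ] V} {c d : ℂ} {α : V →L[ℝ] ℂ}
    (hη : (η k).compContinuousLinearMap R = c • η k) (hα : α.comp R = d • α) :
    (eps α η (k + 1)).compContinuousLinearMap R = (d * c) • eps α η (k + 1) := by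
  rw [comp_eq_pull, pull_eps, hα,
    eps_congr (η := pull R η) (ζ := c • η) (by rw [← comp_eq_pull, hη]; rfl)]
  simp only [map_smul, LinearMap.smul_apply, Pi.smul_apply, smul_smul, mul_comm]

lemma IsOfType.eps10 (hI : ∀ v, I (I v) = -v) {η : Ext V} {k p q : ℕ} (h : IsOfType I p q (η k))
    (α : V →L[ℝ] ℂ) : IsOfType I (p + 1) q (eps (part10 I α) η (k + 1)) := by
  refine ⟨by rw [h.1]; omega, fun t => ?_⟩
  rw [eps_type_aux (h.2 t) (part10_rot hI α t), ← Complex.exp_add]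
  congr 2
  push_cast; ring

lemma IsOfType.eps01 (hI : ∀ v, I (I v) = -v) {η : Ext V} {k p q : ℕ} (h : IsOfType I p q (η k))
    (α : V →L[ℝ] ℂ) : IsOfType I p (q + 1) (eps (part01 I α) η (k + 1)) := by
  refine ⟨by rw [h.1]; omega, fun t => ?_⟩
  rw [eps_type_aux (h.2 t) (part01_rot hI α t), ← Complex.exp_add]
  congr 2
  push_cast; ring

lemma IsOfType.zero {k p q : ℕ} (h : k = p + q) : IsOfType I p q (0 : V [⋀^Fin k]→L[ℝ] ℂ) :=
  ⟨h, fun t => by ext v; simp⟩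

lemma IsOfType.add {k p q : ℕ} {φ ψ : V [⋀^Fin k]→L[ℝ] ℂ} (h : IsOfType I p q φ)
    (h' : IsOfType I p q ψ) : IsOfType I p q (φ + ψ) := by
  refine ⟨h.1, fun t => ?_⟩
  rw [smul_add, ← h.2, ← h'.2]
  rfl

lemma IsOfType.smul {k p q : ℕ} {φ : V [⋀^Fin k]→L[ℝ] ℂ} (h : IsOfType I p q φ) (c : ℂ) :
    IsOfType I p q (c • φ) := by
  refine ⟨h.1, fun t => ?_⟩
  rw [smul_comm, ← h.2]
  rfl

lemma typeComp_add (L : V →L[ℝ] V) (p q : ℕ) {k : ℕ} (φ ψ : V [⋀^Fin k]→L[ℝ] ℂ) :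
    typeComp L p q (φ + ψ) = typeComp L p q φ + typeComp L p q ψ := by
  unfold typeComp
  split_ifs
  · ext v
    simp [mul_add, Finset.sum_add_distrib]
  · simp

lemma typeComp_smul (L : V →L[ℝ] V) (p q : ℕ) {k : ℕ} (c : ℂ) (φ : V [⋀^Fin k]→L[ℝ] ℂ) :
    typeComp L p q (c • φ) = c • typeComp L p q φ := by
  unfold typeComp
  split_ifs
  · ext v
    simp [Finset.mul_sum, mul_left_comm]
  · simp

/-- `typeComp` as a linear map. -/
def typeCompL (L : V →L[ℝ] V) (p q k : ℕ) :
    (V [⋀^Fin k]→L[ℝ] ℂ) →ₗ[ℂ] (V [⋀^Fin k]→L[ℝ] ℂ) where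
  toFun := typeComp L p q
  map_add' := typeComp_add L p q
  map_smul' := typeComp_smul L p q

lemma typeCompL_apply (L : V →L[ℝ] V) (p q k : ℕ) (φ : V [⋀^Fin k]→L[ℝ] ℂ) :
    typeCompL L p q k φ = typeComp L p q φ := rfl

@[simp] lemma typeComp_zero (L : V →L[ℝ] V) (p q k : ℕ) :
    typeComp L p q (0 : V [⋀^Fin k]→L[ℝ] ℂ) = 0 := (typeCompL L p q k).map_zero

section Span

variable {N : ℕ} {s : V →L[ℝ] V →L[ℝ] ℝ} {e : Fin N → V}

/-- Every form is a sum of forms of pure type. -/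
lemma mem_span_types (h : IsONB s e) (hI : ∀ v, I (I v) = -v) {k : ℕ} (φ : V [⋀^Fin k]→L[ℝ] ℂ) :
    φ ∈ Submodule.span ℂ {ψ : V [⋀^Fin k]→L[ℝ] ℂ | ∃ p q, IsOfType I p q ψ} := by
  induction k with
  | zero =>
    refine Submodule.subset_span ⟨0, 0, rfl, fun t => ?_⟩
    ext v
    simp [Subsingleton.elim (rot I t ∘ v) v]
  | succ k ih =>
    have key : ∀ (α : V →L[ℝ] ℂ) (ψ : V [⋀^Fin k]→L[ℝ] ℂ), eps α (ofDegree ψ) (k + 1) ∈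
        Submodule.span ℂ {ψ : V [⋀^Fin (k + 1)]→L[ℝ] ℂ | ∃ p q, IsOfType I p q ψ} := by
      intro α ψ
      induction ih ψ using Submodule.span_induction with
      | mem ψ hψ =>
        obtain ⟨p, q, hψ⟩ := hψ
        rw [← ofDegree_self ψ] at hψ
        rw [← part10_add_part01 I α, map_add]
        exact Submodule.add_mem _ (Submodule.subset_span ⟨_, _, hψ.eps10 hI α⟩)
          (Submodule.subset_span ⟨_, _, hψ.eps01 hI α⟩)
      | zero =>
        rw [eps_congr (ζ := 0) (by simp), _root_.map_zero]
        exact Submodule.zero_mem _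
      | add x y _ _ hx hy =>
        rw [eps_congr (ζ := ofDegree x + ofDegree y) (by simp), map_add]
        exact Submodule.add_mem _ hx hy
      | smul c x _ hx =>
        rw [eps_congr (ζ := c • ofDegree x) (by simp), map_smul]
        exact Submodule.smul_mem _ _ hx
    have hk : ((k : ℂ) + 1) ≠ 0 := by exact_mod_cast Nat.succ_ne_zero k
    have : φ = ((k : ℂ) + 1)⁻¹ • ∑ a, eps (cov s (e a)) (ofDegree (φ.curryLeft (e a))) (k + 1) := by
      have := h.euler (ofDegree φ) k
      rw [ofDegree_self, Finset.sum_apply] at this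
      simp only [inn_ofDegree] at this
      rw [this, smul_smul, inv_mul_cancel₀ hk, one_smul]
    rw [this]
    exact Submodule.smul_mem _ _ (Submodule.sum_mem _ fun a _ => key _ _)

lemma isOfType_typeComp (h : IsONB s e) (hI : ∀ v, I (I v) = -v) {k p q : ℕ} (hk : k = p + q)
    (φ : V [⋀^Fin k]→L[ℝ] ℂ) : IsOfType I p q (typeComp I p q φ) := by
  induction mem_span_types h hI φ using Submodule.span_induction with
  | mem ψ hψ =>
    obtain ⟨p', q', hψ⟩ := hψ
    rw [typeComp_of_isOfType I hk hψ]
    split_ifs with hp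
    · subst hp
      have : q = q' := by have := hψ.1; omega
      subst this
      exact hψ
    · exact IsOfType.zero hk
  | zero => rw [typeComp_zero]; exact IsOfType.zero hk
  | add x y _ _ hx hy => rw [typeComp_add]; exact hx.add hy
  | smul c x _ hx => rw [typeComp_smul]; exact hx.smul c

lemma sum_typeComp (h : IsONB s e) (hI : ∀ v, I (I v) = -v) {k : ℕ} (φ : V [⋀^Fin k]→L[ℝ] ℂ) :
    ∑ pq ∈ Finset.HasAntidiagonal.antidiagonal k, typeComp I pq.1 pq.2 φ = φ := by
  induction mem_span_types h hI φ using Submodule.span_induction with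
  | mem ψ hψ =>
    obtain ⟨p, q, hψ⟩ := hψ
    rw [Finset.sum_eq_single (p, q)]
    · rw [typeComp_of_isOfType I hψ.1 hψ, if_pos rfl]
    · rintro ⟨p', q'⟩ hpq hne
      rw [Finset.HasAntidiagonal.mem_antidiagonal] at hpq
      rw [typeComp_of_isOfType I hpq.symm hψ, if_neg]
      rintro rfl
      have := hψ.1
      simp at hne hpq
      omega
    · intro hn
      exact absurd (Finset.HasAntidiagonal.mem_antidiagonal.mpr hψ.1.symm) hn
  | zero => simp
  | add x y _ _ hx hy => simp only [typeComp_add, Finset.sum_add_distrib, hx, hy]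
  | smul c x _ hx => simp only [typeComp_smul, ← Finset.smul_sum, hx]

lemma eq_zero_of_smul_eq_smul {k : ℕ} {φ : V [⋀^Fin k]→L[ℝ] ℂ} {a b : ℂ} (h : a • φ = b • φ)
    (hab : a ≠ b) : φ = 0 := by
  ext v
  have h1 : a * φ v = b * φ v := congrArg (fun ψ : V [⋀^Fin k]→L[ℝ] ℂ => ψ v) h
  by_contra h2
  exact hab (mul_right_cancel₀ h2 h1)

/-- `φ` has weight `w` under the circle action generated by `I`. -/
def HasWeight (I : V →L[ℝ] V) (w : ℤ) {k : ℕ} (φ : V [⋀^Fin k]→L[ℝ] ℂ) : Prop :=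
  ∀ t : ℝ, φ.compContinuousLinearMap (rot I t) = Complex.exp ((w : ℂ) * t * Complex.I) • φ

lemma IsOfType.hasWeight {k p q : ℕ} {φ : V [⋀^Fin k]→L[ℝ] ℂ} (h : IsOfType I p q φ) :
    HasWeight I ((p : ℤ) - q) φ := fun t => by rw [h.2]; push_cast; rfl

lemma HasWeight.typeComp (h : IsONB s e) (hI : ∀ v, I (I v) = -v) {k p q : ℕ} (hk : k = p + q)
    {w : ℤ} {φ : V [⋀^Fin k]→L[ℝ] ℂ} (hw : HasWeight I w φ) :
    HKT.typeComp I p q φ = if w = (p : ℤ) - q then φ else 0 := by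
  have hne : ∀ p q : ℕ, k = p + q → w ≠ (p : ℤ) - q → HKT.typeComp I p q φ = 0 := by
    intro p q hk hwne
    set m : ℤ := (p : ℤ) - q - w with hm
    have hm0 : (m : ℝ) ≠ 0 := by
      rw [Int.cast_ne_zero]; omega
    -- At this angle the weights `p - q` and `w` differ by the phase `exp (iπ) = -1`. The `(p,
    -- q)`-component is thus multiplied by two opposite nonzero numbers at once, and must vanish.
    set t : ℝ := Real.pi / m with ht
    have h1 := hw t
    conv_lhs at h1 => rw [← sum_typeComp h hI φ]
    have h2 : (∑ pq ∈ Finset.HasAntidiagonal.antidiagonal k,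
        HKT.typeComp I pq.1 pq.2 φ).compContinuousLinearMap (rot I t)
        = ∑ pq ∈ Finset.HasAntidiagonal.antidiagonal k,
          Complex.exp (((pq.1 : ℂ) - pq.2) * t * Complex.I) • HKT.typeComp I pq.1 pq.2 φ := by
      have := _root_.map_sum (compContinuousLinearMapₗ (N := ℂ) (ι := Fin k) (rot I t))
        (fun pq : ℕ × ℕ => HKT.typeComp I pq.1 pq.2 φ)
        (Finset.HasAntidiagonal.antidiagonal k)
      refine this.trans (Finset.sum_congr rfl fun pq hpq => ?_)
      exact (isOfType_typeComp h hI
        (Finset.HasAntidiagonal.mem_antidiagonal.mp hpq).symm φ).2 t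
    rw [h2] at h1
    have h3 := congrArg (typeCompL I p q k) h1
    rw [_root_.map_sum, map_smul] at h3
    have hterm : ∀ pq ∈ Finset.HasAntidiagonal.antidiagonal k, pq ≠ (p, q) →
        typeCompL I p q k (Complex.exp (((pq.1 : ℂ) - pq.2) * t * Complex.I) •
          HKT.typeComp I pq.1 pq.2 φ) = 0 := by
      rintro ⟨p', q'⟩ hpq hne
      rw [Finset.HasAntidiagonal.mem_antidiagonal] at hpq
      rw [map_smul, typeCompL_apply,
        typeComp_of_isOfType I hk (isOfType_typeComp h hI hpq.symm φ), if_neg, smul_zero_form]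
      rintro rfl
      simp at hne hpq
      omega
    rw [Finset.sum_eq_single_of_mem (p, q)
      (Finset.HasAntidiagonal.mem_antidiagonal.mpr hk.symm) hterm, map_smul, typeCompL_apply,
      typeComp_of_isOfType I hk (isOfType_typeComp h hI hk φ), if_pos rfl, typeCompL_apply] at h3
    refine eq_zero_of_smul_eq_smul h3 fun h4 => ?_
    have h5 : ((p : ℂ) - q) * t * Complex.I = (w : ℂ) * t * Complex.I + Real.pi * Complex.I := by
      have : (m : ℂ) * t = Real.pi := by
        rw [ht]; push_cast
        field_simp [(by exact_mod_cast hm0 : (m : ℂ) ≠ 0)]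
      rw [← this, hm]; push_cast; ring
    simp only [h5, Complex.exp_add, Complex.exp_pi_mul_I] at h4
    have h6 := Complex.exp_ne_zero ((w : ℂ) * t * Complex.I)
    apply h6
    linear_combination (-1 / 2 : ℂ) * h4
  split_ifs with hwp
  · conv_rhs => rw [← sum_typeComp h hI φ]
    rw [Finset.sum_eq_single_of_mem (p, q)
      (Finset.HasAntidiagonal.mem_antidiagonal.mpr hk.symm)]
    rintro ⟨p', q'⟩ hpq hne'
    rw [Finset.HasAntidiagonal.mem_antidiagonal] at hpq
    refine hne _ _ hpq.symm fun h7 => hne' ?_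
    simp at hpq
    rw [Prod.mk.injEq]
    omega
  · exact hne p q hk hwp

/-- The weights occurring on `k`-forms are `p - q` with `p + q = k`, hence at most `k`. -/
lemma HasWeight.eq_zero (h : IsONB s e) (hI : ∀ v, I (I v) = -v) {k : ℕ} {w : ℤ}
    {φ : V [⋀^Fin k]→L[ℝ] ℂ} (hw : HasWeight I w φ) (hk : (k : ℤ) < w) : φ = 0 := by
  rw [← sum_typeComp h hI φ]
  refine Finset.sum_eq_zero fun pq hpq => ?_
  rw [Finset.HasAntidiagonal.mem_antidiagonal] at hpq
  rw [hw.typeComp h hI hpq.symm, if_neg]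
  omega

end Span

end Types

end HKT

namespace HKT

/-! ### Forms of type `(*, 0)` -/

section StarZero

variable {V : Type*} [NormedAddCommGroup V] [NormedSpace ℝ V] {I : V →L[ℝ] V}

/-- `η ∈ Λ^{*,0}`. -/
def StarZero (I : V →L[ℝ] V) (η : Ext V) : Prop := ∀ k, IsOfType I k 0 (η k)

/-- The projection to `Λ^{*,0}`. -/
def proj0 (I : V →L[ℝ] V) : Module.End ℂ (Ext V) where
  toFun η k := typeComp I k 0 (η k)
  map_add' η ζ := by funext k; exact typeComp_add I k 0 _ _
  map_smul' c η := by funext k; exact typeComp_smul I k 0 c _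

lemma proj0_apply (I : V →L[ℝ] V) (η : Ext V) (k : ℕ) : proj0 I η k = typeComp I k 0 (η k) := rfl

lemma StarZero.proj0 {η : Ext V} (h : StarZero I η) : proj0 I η = η := by
  funext k
  rw [proj0_apply, typeComp_of_isOfType I (by simp) (h k), if_pos rfl]

lemma StarZero.one : StarZero I (one : Ext V) := by
  intro k
  cases k with
  | zero =>
    refine ⟨rfl, fun t => ?_⟩
    ext v
    simp
  | succ k => rw [one_succ]; exact IsOfType.zero (by simp)

lemma StarZero.eps10 (hI : ∀ v, I (I v) = -v) {η : Ext V} (h : StarZero I η) (α : V →L[ℝ] ℂ) :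
    StarZero I (eps (part10 I α) η) := by
  intro k
  cases k with
  | zero => exact IsOfType.zero (by simp)
  | succ k => exact (h k).eps10 hI α

lemma pull_der_comm {R X : V →L[ℝ] V} (h : R.comp X = X.comp R) (η : Ext V) :
    pull R (der X η) = der X (pull R η) := by
  funext k
  ext v
  simp only [pull, ContinuousAlternatingMap.compContinuousLinearMap_apply, der_apply]
  refine Finset.sum_congr rfl fun i _ => ?_
  congr 1
  funext j
  by_cases hj : j = i
  · subst hj
    simpa using (congrArg (fun f => f (v j)) h).symm
  · simp [hj]

variable {N : ℕ} {s : V →L[ℝ] V →L[ℝ] ℝ} {e : Fin N → V}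

lemma StarZero.of_proj0 (h : IsONB s e) (hI : ∀ v, I (I v) = -v) (η : Ext V) :
    StarZero I (HKT.proj0 I η) := fun k => isOfType_typeComp h hI (by simp) (η k)

/-- A product has no antiholomorphic part only if neither factor has one. This is checked on forms
of pure type and extended by linearity. -/
lemma proj0_eps (h : IsONB s e) (hI : ∀ v, I (I v) = -v) (α : V →L[ℝ] ℂ) (η : Ext V) :
    proj0 I (eps α η) = eps (part10 I α) (proj0 I η) := by
  funext k
  cases k with
  | zero => rw [proj0_apply]; simp
  | succ k =>
    have key : ∀ φ ∈ Submodule.span ℂ {ψ : V [⋀^Fin k]→L[ℝ] ℂ | ∃ p q, IsOfType I p q ψ},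
        typeComp I (k + 1) 0 (eps α (ofDegree φ) (k + 1))
          = eps (part10 I α) (ofDegree (typeComp I k 0 φ)) (k + 1) := by
      intro φ hφ
      induction hφ using Submodule.span_induction with
      | mem ψ hψ =>
        obtain ⟨p, q, hψ'⟩ := hψ
        have hψ := hψ'
        rw [← ofDegree_self ψ] at hψ'
        rw [typeComp_of_isOfType I (by simp) hψ]
        conv_lhs => rw [← part10_add_part01 I α, map_add, LinearMap.add_apply, Pi.add_apply]
        rw [typeComp_add, typeComp_of_isOfType I (by simp) (hψ'.eps10 hI α),
          typeComp_of_isOfType I (by simp) (hψ'.eps01 hI α)]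
        have := hψ.1
        by_cases hk : k = p
        · have h2 : k + 1 ≠ p := by omega
          simp [hk]
        · have h1 : k + 1 ≠ p := by
            intro h1; omega
          have h2 : k + 1 ≠ p + 1 := by omega
          rw [if_neg h2, if_neg h1, if_neg hk,
            eps_congr (ζ := 0) (by simp), _root_.map_zero, add_zero]
          rfl
      | zero =>
        rw [eps_congr (ζ := 0) (by simp), typeComp_zero, _root_.map_zero,
          eps_congr (η := ofDegree 0) (ζ := 0) (by simp), _root_.map_zero]
        exact typeComp_zero _ _ _ _
      | add x y _ _ hx hy =>
        rw [eps_congr (ζ := ofDegree x + ofDegree y) (by simp), map_add, Pi.add_apply,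
          typeComp_add, hx, hy, typeComp_add,
          eps_congr (η := ofDegree (_ + _)) (ζ := ofDegree (typeComp I k 0 x) +
            ofDegree (typeComp I k 0 y)) (by simp), map_add]
        rfl
      | smul c x _ hx =>
        rw [eps_congr (ζ := c • ofDegree x) (by simp), map_smul, Pi.smul_apply,
          typeComp_smul, hx, typeComp_smul,
          eps_congr (η := ofDegree (c • _)) (ζ := c • ofDegree (typeComp I k 0 x)) (by simp),
          map_smul]
        rfl
    have := key (η k) (mem_span_types h hI _)
    rw [proj0_apply, eps_congr (ζ := ofDegree (η k)) (by simp), this]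
    exact eps_congr (by simp [proj0_apply]) _

lemma pull_rot_deg {η : Ext V} (h : StarZero I η) (t : ℝ) (k : ℕ) :
    pull (rot I t) η k = Complex.exp ((k : ℂ) * t * Complex.I) • η k := by
  rw [← comp_eq_pull, (h k).2 t]; simp

lemma exp_mul_succ (k : ℕ) (t : ℝ) : Complex.exp (((k + 1 : ℕ) : ℂ) * t * Complex.I)
    = Complex.exp ((k : ℂ) * t * Complex.I) * (Real.cos t + Real.sin t * Complex.I) := by
  rw [← exp_I_mul, ← Complex.exp_add]
  congr 1; push_cast; ring

lemma cos_sq_add_sin_sq (t : ℝ) : (Real.cos t : ℂ) ^ 2 + (Real.sin t : ℂ) ^ 2 = 1 := by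
  exact_mod_cast Real.cos_sq_add_sin_sq t

/-- The vector `v + i I v` is of type `(0,1)`. Contracting the `(k+1,0)`-form `η` with it would give
a `k`-form of weight `k + 2`, which is zero. -/
lemma StarZero.inn_I (h : IsONB s e) (hI : ∀ v, I (I v) = -v) {η : Ext V} (hη : StarZero I η)
    (v : V) : inn (I v) η = Complex.I • inn v η := by
  funext k
  set ψ : V [⋀^Fin k]→L[ℝ] ℂ := (inn v η + Complex.I • inn (I v) η) k with hψ
  have hw : HasWeight I ((k : ℤ) + 2) ψ := by
    intro t
    set R := rot I t with hR
    have h1 : ∀ u, inn u (pull R η) k = Complex.exp (((k + 1 : ℕ) : ℂ) * t * Complex.I) • inn u η k := by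
      intro u
      rw [inn_deg, pull_rot_deg hη, inn_deg]
      ext w; simp
    have h2 : (Real.cos t : ℂ) • pull R (inn v η) k + (Real.sin t : ℂ) • pull R (inn (I v) η) k
        = Complex.exp (((k + 1 : ℕ) : ℂ) * t * Complex.I) • inn v η k := by
      rw [← h1, inn_pull, hR, rot_apply]
      ext w
      simp [pull]
    have h3 : (Real.cos t : ℂ) • pull R (inn (I v) η) k - (Real.sin t : ℂ) • pull R (inn v η) k
        = Complex.exp (((k + 1 : ℕ) : ℂ) * t * Complex.I) • inn (I v) η k := by
      rw [← h1, inn_pull, hR, rot_apply, hI]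
      ext w
      simp [pull, sub_eq_add_neg]
    have h4 : Complex.exp ((((k : ℤ) + 2 : ℤ) : ℂ) * t * Complex.I)
        = Complex.exp ((k : ℂ) * t * Complex.I) * (Real.cos t + Real.sin t * Complex.I) ^ 2 := by
      rw [← exp_I_mul, ← Complex.exp_nat_mul, ← Complex.exp_add]
      congr 1; push_cast; ring
    rw [h4]
    rw [exp_mul_succ] at h2 h3
    ext w
    have h2' := congrArg (fun φ => φ w) h2
    have h3' := congrArg (fun φ => φ w) h3
    simp only [ContinuousAlternatingMap.add_apply, ContinuousAlternatingMap.smul_apply,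
      ContinuousAlternatingMap.sub_apply, smul_eq_mul] at h2' h3'
    have h5 : ψ.compContinuousLinearMap R w = pull R (inn v η) k w
        + Complex.I * pull R (inn (I v) η) k w := rfl
    have h6 : ψ w = inn v η k w + Complex.I * inn (I v) η k w := rfl
    rw [h5, ContinuousAlternatingMap.smul_apply, h6, smul_eq_mul]
    linear_combination (Real.cos t + Real.sin t * Complex.I) * h2' +
      Complex.I * (Real.cos t + Real.sin t * Complex.I) * h3' -
      (pull R (inn v η) k w + Complex.I * pull R (inn (I v) η) k w) * cos_sq_add_sin_sq t
      + ((Real.sin t) ^ 2 * pull R (inn v η) k w -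
        Real.cos t * Real.sin t * pull R (inn (I v) η) k w) * Complex.I_mul_I
  have h0 := hw.eq_zero h hI (by omega)
  ext w
  have : inn v η k w + Complex.I * inn (I v) η k w = 0 := congrArg (fun φ => φ w) h0
  rw [Pi.smul_apply, ContinuousAlternatingMap.smul_apply, smul_eq_mul]
  linear_combination (-Complex.I) * this + inn (I v) η k w * Complex.I_mul_I

/-- Since contraction with `I v` is `i` times contraction with `v`, rotating `v` by the angle `t`
multiplies the contraction by `cos t + i sin t`. Dividing by this phase lowers the weight from `k +
1` to `k`. -/
lemma StarZero.inn (h : IsONB s e) (hI : ∀ v, I (I v) = -v) {η : Ext V} (hη : StarZero I η)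
    (v : V) : StarZero I (inn v η) := by
  intro k
  refine ⟨by simp, fun t => ?_⟩
  set R := rot I t with hR
  have h1 : HKT.inn v (pull R η) k = Complex.exp (((k + 1 : ℕ) : ℂ) * t * Complex.I) •
      HKT.inn v η k := by
    rw [inn_deg, pull_rot_deg hη, inn_deg]
    ext w; simp
  rw [inn_pull, hR, rot_apply, map_add, map_smul, map_smul, exp_mul_succ] at h1
  ext w
  have h2 := congrArg (fun φ => φ w) h1
  have h3 : pull R ((Real.cos t • HKT.inn v + Real.sin t • HKT.inn (I v)) η) k w
      = (Real.cos t + Real.sin t * Complex.I) * pull R (HKT.inn v η) k w := by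
    rw [LinearMap.add_apply, LinearMap.smul_apply, LinearMap.smul_apply, hη.inn_I h hI]
    simp [pull]; ring
  rw [← hR, h3] at h2
  rw [comp_eq_pull]
  simp only [ContinuousAlternatingMap.smul_apply, smul_eq_mul] at h2 ⊢
  have h5 : ((Real.cos t : ℂ) - Real.sin t * Complex.I) * (Real.cos t + Real.sin t * Complex.I) = 1 := by
    linear_combination cos_sq_add_sin_sq t - (Real.sin t) ^ 2 * Complex.I_mul_I
  have h6 : Complex.exp (((k : ℂ) - ((0 : ℕ) : ℂ)) * t * Complex.I)
      = Complex.exp ((k : ℂ) * t * Complex.I) := by simp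
  rw [h6]
  linear_combination ((Real.cos t : ℂ) - Real.sin t * Complex.I) * h2 +
    (Complex.exp ((k : ℂ) * t * Complex.I) * HKT.inn v η k w - pull R (HKT.inn v η) k w) * h5

/-- Moving an endomorphism across the canonical element `∑ e^b ⊗ e_b`. -/
lemma IsONB.sum_comp (h : IsONB s e) (X : V →L[ℝ] V) (F : V →ₗ[ℝ] Ext V) :
    ∑ b, eps ((cov s (e b)).comp X) (F (e b)) = ∑ a, eps (cov s (e a)) (F (X (e a))) := by
  have h1 : ∀ b, (cov s (e b)).comp X = ∑ a, ((s (e b) (X (e a)) : ℝ) : ℂ) • cov s (e a) := by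
    intro b
    rw [← h.covector_expand ((cov s (e b)).comp X)]
    rfl
  have h2 : ∀ a, F (X (e a)) = ∑ b, ((s (e b) (X (e a)) : ℝ) : ℂ) • F (e b) := by
    intro a
    exact (h.sum_apply' F (X (e a))).symm
  simp only [h1, h2, map_sum, map_smul, LinearMap.sum_apply, LinearMap.smul_apply]
  rw [Finset.sum_comm]

lemma part10_eq (α : V →L[ℝ] ℂ) : part10 I α = (1 / 2 : ℂ) • α - (Complex.I / 2) • α.comp I := by
  ext v
  rw [part10_apply]
  simp
  ring

/-- On `Λ^{*,0}` only the `(1,0)`-parts of the covectors matter. -/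
lemma StarZero.sum_eps_inn (h : IsONB s e) (hI : ∀ v, I (I v) = -v) {η : Ext V} (hη : StarZero I η)
    (Y : V →L[ℝ] V) :
    ∑ b, eps ((part10 I (cov s (e b))).comp Y) (HKT.inn (e b) η)
      = ∑ b, eps ((cov s (e b)).comp Y) (HKT.inn (e b) η) := by
  have h1 : ∀ b, (part10 I (cov s (e b))).comp Y
      = (1 / 2 : ℂ) • (cov s (e b)).comp Y - (Complex.I / 2) • (cov s (e b)).comp (I.comp Y) := by
    intro b; rw [part10_eq]; rfl
  have h2 := h.sum_comp Y ((HKT.inn : V →ₗ[ℝ] _).flip η)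
  have h3 := h.sum_comp (I.comp Y) ((HKT.inn : V →ₗ[ℝ] _).flip η)
  simp only [LinearMap.flip_apply, ContinuousLinearMap.comp_apply] at h2 h3
  simp only [h1, map_sub, map_smul, LinearMap.sub_apply, LinearMap.smul_apply,
    Finset.sum_sub_distrib, ← Finset.smul_sum]
  rw [h3, h2]
  simp only [hη.inn_I h hI, map_smul, ← Finset.smul_sum, smul_smul]
  have h4 : (1 / 2 : ℂ) - Complex.I / 2 * Complex.I = 1 := by
    linear_combination (-1 / 2 : ℂ) * Complex.I_mul_I
  rw [← sub_smul, h4, one_smul]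

lemma StarZero.euler10 (h : IsONB s e) (hI : ∀ v, I (I v) = -v) {η : Ext V} (hη : StarZero I η)
    (k : ℕ) : (∑ b, eps (part10 I (cov s (e b))) (HKT.inn (e b) η)) k = (k : ℂ) • η k := by
  have := hη.sum_eps_inn h hI (.id ℝ V)
  simp only [ContinuousLinearMap.comp_id] at this
  rw [this]
  cases k with
  | zero => ext v; simp
  | succ k => rw [h.euler]; push_cast; rfl

/-- The trace of the projection to `(1,0)`-covectors, that is, the complex dimension. -/
lemma trace10 (h : IsONB s e) (hs : ∀ v, s v (I v) = 0) :
    ∑ b, part10 I (cov s (e b)) (e b) = (N : ℂ) / 2 := by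
  simp [part10_apply, h.orth, hs]
  ring

/-- A form of type `(p, 0)` killed by multiplication with all `(1,0)`-forms has top degree. -/
lemma StarZero.eq_zero_of_eps (h : IsONB s e) (hI : ∀ v, I (I v) = -v) (hs : ∀ v, s v (I v) = 0)
    {η : Ext V} (hη : StarZero I η) {k : ℕ} (hk : 2 * k ≠ N)
    (h0 : ∀ α, eps (part10 I α) η (k + 1) = 0) : η k = 0 := by
  -- Contract the vanishing products with the frame. By the anticommutation relation, the trace and
  -- the Euler identity, this reads `(N / 2 - k) • η k = 0`.
  have h1 : (∑ b, HKT.inn (e b) (eps (part10 I (cov s (e b))) η)) k = 0 := by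
    rw [Finset.sum_apply]
    refine Finset.sum_eq_zero fun b _ => ?_
    rw [inn_deg, h0]; simp
  simp only [inn_eps, Finset.sum_sub_distrib, ← Finset.sum_smul] at h1
  rw [Pi.sub_apply, hη.euler10 h hI, Pi.smul_apply, trace10 h hs, ← sub_smul] at h1
  refine (smul_eq_zero.mp h1).resolve_left fun h2 => hk ?_
  have : ((2 * k : ℕ) : ℂ) = N := by push_cast; linear_combination (-2 : ℂ) * h2
  exact_mod_cast this

/-- Descending induction on the degree, `d` bounding the distance to the degrees above `N`, where
all forms vanish. Multiplication by a `(1,0)`-form raises the degree and stays above `N / 2`, so it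
kills `η` by induction, and the preceding lemma applies. -/
lemma StarZero.deg_eq_zero (h : IsONB s e) (hI : ∀ v, I (I v) = -v) (hs : ∀ v, s v (I v) = 0)
    {η : Ext V} (hη : StarZero I η) {k : ℕ} (hk : N < 2 * k) : η k = 0 := by
  obtain ⟨d, hd⟩ : ∃ d, N + 1 ≤ k + d := ⟨N + 1, by omega⟩
  induction d generalizing k η with
  | zero => exact h.deg_eq_zero (by omega) _
  | succ d ih =>
    exact hη.eq_zero_of_eps h hI hs (by omega) fun α =>
      ih (hη.eps10 hI α) (by omega) (by omega)

end StarZero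

end HKT

namespace HKT

/-! ### The Hodge star operator -/

section Hodge

variable {V : Type*} [NormedAddCommGroup V] [NormedSpace ℝ V]
  {N : ℕ} {s : V →L[ℝ] V →L[ℝ] ℝ} {e : Fin N → V}

lemma ext_cast (η : Ext V) {m m' : ℕ} (h : m = m') (v : Fin m' → V) :
    η m' v = η m (v ∘ Fin.cast h) := by
  subst h; rfl

/-- The volume form as an element of the exterior algebra. -/
def vol (s : V →L[ℝ] V →L[ℝ] ℝ) (e : Fin N → V) : Ext V := ofDegree (volForm s e)

lemma volForm_apply {ι : Type} [Fintype ι] [DecidableEq ι] (e : ι → V) (v : ι → V) :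
    volForm s e v = ((Matrix.det (Matrix.of fun b a => s (e a) (v b)) : ℝ) : ℂ) := rfl

lemma vol_apply {m : ℕ} (h : m = N) (v : Fin m → V) :
    vol s e m v = ((Matrix.det (Matrix.of fun b a => s (e a) (v (Fin.cast h.symm b))) : ℝ) : ℂ) := by
  subst h
  rw [vol, ofDegree_self]; rfl

lemma vol_of_ne {m : ℕ} (h : N ≠ m) : vol s e m = 0 := ofDegree_of_ne _ h

lemma contractLeft_apply {k l : ℕ} (φ : V [⋀^Fin k ⊕ Fin l]→L[ℝ] ℂ) (u : Fin k → V)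
    (w : Fin l → V) : contractLeft φ u w = φ (Sum.elim u w) := rfl

lemma hodge_apply {k l : ℕ} (hkl : k + l = N) (β : Ext V) (w : Fin l → V) :
    hodge s e β l w = ((k.factorial : ℕ) : ℂ)⁻¹ * ∑ i : Fin k → Fin N,
      (starRingEnd ℂ) (β k (e ∘ i)) * vol s e (k + l) (Fin.append (e ∘ i) w) := by
  obtain rfl : k = N - l := by omega
  rw [hodge, dif_pos (by omega : l ≤ N), ContinuousAlternatingMap.smul_apply, smul_eq_mul]
  congr 1
  rw [ContinuousAlternatingMap.sum_apply]
  refine Finset.sum_congr rfl fun i _ => ?_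
  rw [ContinuousAlternatingMap.smul_apply, smul_eq_mul]
  congr 1
  rw [vol_apply hkl]
  rw [contractLeft_apply, volForm_apply]
  set σ : Fin (N - l) ⊕ Fin l ≃ Fin N :=
    finSumFinEquiv.trans (finCongr (Nat.sub_add_cancel (by omega : l ≤ N))) with hσ
  rw [← Matrix.det_submatrix_equiv_self σ]
  congr 2
  ext b a
  simp only [Matrix.of_apply, Matrix.submatrix_apply, Function.comp_apply]
  congr 1
  rcases b with b | b
  · simp only [Sum.elim_inl, hσ, Equiv.trans_apply, finSumFinEquiv_apply_left]
    exact (Fin.append_left (e ∘ i) w b).symm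
  · simp only [Sum.elim_inr, hσ, Equiv.trans_apply, finSumFinEquiv_apply_right]
    exact (Fin.append_right (e ∘ i) w b).symm

lemma hodge_of_lt {l : ℕ} (h : N < l) (β : Ext V) : hodge s e β l = 0 := by
  rw [hodge, dif_neg (by omega)]

lemma hodge_add (β γ : Ext V) : hodge s e (β + γ) = hodge s e β + hodge s e γ := by
  funext l
  by_cases h : l ≤ N
  · ext w
    rw [Pi.add_apply, ContinuousAlternatingMap.add_apply]
    simp only [hodge_apply (Nat.sub_add_cancel h)]
    rw [← mul_add, ← Finset.sum_add_distrib]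
    simp [add_mul]
  · rw [Pi.add_apply]; simp [hodge_of_lt (not_le.mp h)]

lemma hodge_smul (c : ℂ) (β : Ext V) : hodge s e (c • β) = (starRingEnd ℂ) c • hodge s e β := by
  funext l
  by_cases h : l ≤ N
  · ext w
    rw [Pi.smul_apply, ContinuousAlternatingMap.smul_apply]
    simp only [hodge_apply (Nat.sub_add_cancel h)]
    rw [smul_eq_mul, mul_left_comm, Finset.mul_sum (a := (starRingEnd ℂ) c)]
    simp [mul_assoc]
  · rw [Pi.smul_apply]; simp [hodge_of_lt (not_le.mp h)]

variable (s e) in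
/-- The Hodge star operator as a semilinear map. -/
def hodgeL : Ext V →ₛₗ[starRingEnd ℂ] Ext V where
  toFun := hodge s e
  map_add' := hodge_add
  map_smul' := hodge_smul

lemma hodge_zero : hodge s e 0 = 0 := map_zero (hodgeL s e)

lemma hodge_neg (η : Ext V) : hodge s e (-η) = -hodge s e η := map_neg (hodgeL s e) η

lemma hodge_sum {ι : Type*} (t : Finset ι) (f : ι → Ext V) :
    hodge s e (∑ i ∈ t, f i) = ∑ i ∈ t, hodge s e (f i) := map_sum (hodgeL s e) f t

/-- For even `N` the degrees `l` and `N - l` have the same parity. -/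
lemma hodge_sgn (hN : Even N) (η : Ext V) : hodge s e (sgn η) = sgn (hodge s e η) := by
  funext l
  by_cases h : l ≤ N
  · ext w
    rw [sgn_apply, ContinuousAlternatingMap.smul_apply]
    simp only [hodge_apply (Nat.sub_add_cancel h)]
    rw [smul_eq_mul, mul_left_comm, Finset.mul_sum (a := (-1 : ℂ) ^ l)]
    congr 1
    refine Finset.sum_congr rfl fun i _ => ?_
    have : (-1 : ℂ) ^ (N - l) = (-1) ^ l := by
      rw [← Nat.sub_add_cancel h, Nat.even_add] at hN
      rcases Nat.even_or_odd l with h1 | h1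
      · rw [h1.neg_one_pow, (hN.mpr h1).neg_one_pow]
      · rw [h1.neg_one_pow, Odd.neg_one_pow]
        rw [← Nat.not_even_iff_odd] at h1 ⊢
        rwa [hN]
    rw [sgn_apply, ContinuousAlternatingMap.smul_apply, this]
    simp [mul_assoc]
  · rw [hodge_of_lt (not_le.mp h), sgn_apply, hodge_of_lt (not_le.mp h)]
    simp

omit [NormedAddCommGroup V] [NormedSpace ℝ V] in
lemma append_insertNth {k l : ℕ} (j : Fin (k + 1)) (a : V) (v : Fin k → V) (w : Fin l → V) :
    Fin.append (j.insertNth a v : Fin (k + 1) → V) w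
      = ((Fin.cast (by omega) (Fin.castAdd l j) : Fin (k + l + 1)).insertNth a (Fin.append v w) :
        Fin (k + l + 1) → V) ∘ Fin.cast (by omega) := by
  have h : Fin.append (j.insertNth a v : Fin (k + 1) → V) w ∘
      Fin.cast (by omega : k + l + 1 = k + 1 + l)
      = ((Fin.cast (by omega) (Fin.castAdd l j) : Fin (k + l + 1)).insertNth a (Fin.append v w) :
        Fin (k + l + 1) → V) := by
    rw [Fin.eq_insertNth_iff]
    refine ⟨?_, ?_⟩
    · rw [Function.comp_apply]
      exact (Fin.append_left _ w j).trans (by simp)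
    · funext i
      rw [Fin.removeNth, Function.comp_apply]
      refine Fin.addCases (fun i => ?_) (fun i => ?_) i
      · rw [Fin.append_left, show Fin.cast (by omega : k + l + 1 = k + 1 + l)
          ((Fin.cast (by omega) (Fin.castAdd l j) : Fin (k + l + 1)).succAbove (Fin.castAdd l i))
            = Fin.castAdd l (j.succAbove i) by
          ext; simp only [Fin.succAbove, Fin.lt_def]; split_ifs <;> simp_all <;> omega]
        rw [Fin.append_left, Fin.insertNth_apply_succAbove]
      · rw [Fin.append_right, show Fin.cast (by omega : k + l + 1 = k + 1 + l)
          ((Fin.cast (by omega) (Fin.castAdd l j) : Fin (k + l + 1)).succAbove (Fin.natAdd k i))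
            = Fin.natAdd (k + 1) i by
          ext; simp only [Fin.succAbove, Fin.lt_def]; split_ifs with h1
          · simp at h1; omega
          · simp; omega]
        rw [Fin.append_right]
  rw [← h]
  rfl

omit [NormedAddCommGroup V] [NormedSpace ℝ V] in
lemma append_cons {k l : ℕ} (a : V) (v : Fin k → V) (w : Fin l → V) :
    Fin.append v (Matrix.vecCons a w)
      = ((⟨k, by omega⟩ : Fin (k + l + 1)).insertNth a (Fin.append v w) : Fin (k + l + 1) → V) := by
  rw [Fin.eq_insertNth_iff]
  refine ⟨?_, ?_⟩
  · exact Fin.append_right v (Matrix.vecCons a w) 0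
  · funext i
    rw [Fin.removeNth]
    refine Fin.addCases (fun i => ?_) (fun i => ?_) i
    · rw [Fin.append_left, show ((⟨k, by omega⟩ : Fin (k + l + 1)).succAbove (Fin.castAdd l i))
            = Fin.castAdd (l + 1) i by
          ext; simp [Fin.succAbove, Fin.lt_def]]
      exact Fin.append_left v (Matrix.vecCons a w) i
    · rw [Fin.append_right, show ((⟨k, by omega⟩ : Fin (k + l + 1)).succAbove (Fin.natAdd k i))
            = Fin.natAdd k i.succ by
          ext; simp [Fin.succAbove, Fin.lt_def]; omega]
      exact Fin.append_right v (Matrix.vecCons a w) i.succ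

lemma map_insertNth (η : Ext V) {m : ℕ} (p : Fin (m + 1)) (a : V) (x : Fin m → V) :
    η (m + 1) (p.insertNth a x : Fin (m + 1) → V) = (-1) ^ (p : ℕ) * inn a η m x := by
  have := (η (m + 1)).toAlternatingMap.map_insertNth p a x
  simpa [inn_apply] using this

/-- `* (u ∧ η) = ± ι_u * η`. -/
lemma IsONB.hodge_eps (h : IsONB s e) (u : V) (η : Ext V) :
    hodge s e (eps (cov s u) η) = inn u (hodge s e (sgn η)) := by
  funext l
  ext w
  rw [inn_apply]
  rcases lt_trichotomy N l with hl | rfl | hl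
  · rw [hodge_of_lt hl, hodge_of_lt (by omega)]; rfl
  · rw [hodge_of_lt (Nat.lt_succ_self N), hodge_apply (Nat.zero_add N)]; simp
  · obtain ⟨k, hk⟩ := Nat.exists_eq_add_of_lt hl
    have h1 : k + 1 + l = N := by omega
    have h2 : k + (l + 1) = N := by omega
    rw [hodge_apply h1, hodge_apply h2]
    have h3 : ∀ i : Fin (k + 1) → Fin N,
        (starRingEnd ℂ) (eps (cov s u) η (k + 1) (e ∘ i)) *
          vol s e (k + 1 + l) (Fin.append (e ∘ i) w)
        = ∑ j : Fin (k + 1), (s u (e (i j)) : ℂ) * ((starRingEnd ℂ) (η k (e ∘ j.removeNth i)) *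
          inn (e (i j)) (vol s e) (k + l) (Fin.append (e ∘ j.removeNth i) w)) := by
      intro i
      rw [eps_succ_apply, map_sum, Finset.sum_mul]
      refine Finset.sum_congr rfl fun j _ => ?_
      have h4 : e ∘ i = (j.insertNth (e (i j)) (e ∘ j.removeNth i) : Fin (k + 1) → V) := by
        have := (Fin.insertNth_self_removeNth j (e ∘ i)).symm
        exact this
      conv_lhs => enter [2]; rw [h4]
      rw [append_insertNth, ← ext_cast (vol s e) (m := k + 1 + l) (m' := k + l + 1) (by omega),
        map_insertNth]
      have h5 : ((-1 : ℂ) ^ (j : ℕ)) * (-1) ^ (j : ℕ) = 1 := by rw [← mul_pow]; simp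
      simp only [map_mul, map_pow, map_neg, map_one, cov_apply, Complex.conj_ofReal,
        Fin.val_cast, Fin.val_castAdd]
      have h6 : j.removeNth (e ∘ i) = e ∘ j.removeNth i := rfl
      rw [h6, Function.comp_apply]
      linear_combination (s u (e (i j)) : ℂ) * ((starRingEnd ℂ) (η k (e ∘ j.removeNth i)) *
          inn (e (i j)) (vol s e) (k + l) (Fin.append (e ∘ j.removeNth i) w)) * h5
    simp only [h3]
    rw [Finset.sum_comm]
    -- Split the multi-index into its `j`-th entry and the rest. Summing over the `j`-th entry
    -- reassembles `u` from its coordinates, and the result no longer depends on `j`.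
    have h7 : ∀ j : Fin (k + 1), ∑ i : Fin (k + 1) → Fin N,
        (s u (e (i j)) : ℂ) * ((starRingEnd ℂ) (η k (e ∘ j.removeNth i)) *
          inn (e (i j)) (vol s e) (k + l) (Fin.append (e ∘ j.removeNth i) w))
        = ∑ i : Fin k → Fin N, (starRingEnd ℂ) (η k (e ∘ i)) *
          inn u (vol s e) (k + l) (Fin.append (e ∘ i) w) := by
      intro j
      have h11 : ∀ (a : Fin N) (i : Fin k → Fin N),
          j.removeNth ((Fin.insertNthEquiv (fun _ => Fin N) j) (a, i)) = i :=
        fun a i => Fin.removeNth_insertNth (α := fun _ => Fin N) j a i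
      rw [← (Fin.insertNthEquiv (fun _ => Fin N) j).sum_comp, Fintype.sum_prod_type,
        Finset.sum_comm]
      refine Finset.sum_congr rfl fun i _ => ?_
      simp only [h11]
      simp only [Fin.insertNthEquiv_apply, Fin.insertNth_apply_same]
      have h8 := h.sum_apply' ((inn : V →ₗ[ℝ] _).flip (vol s e)) u
      simp only [LinearMap.flip_apply] at h8
      rw [← h8, Finset.sum_apply, ContinuousAlternatingMap.sum_apply, Finset.mul_sum]
      refine Finset.sum_congr rfl fun a _ => ?_
      rw [h.symm u (e a), Pi.smul_apply, ContinuousAlternatingMap.smul_apply, smul_eq_mul]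
      ring
    -- The `k + 1` equal contributions turn the normalization `1 / (k + 1)!` into `1 / k!`.
    simp only [h7, Finset.sum_const, Finset.card_univ, Fintype.card_fin, nsmul_eq_mul]
    -- Moving `u` to the front past the `k` inserted vectors costs `(-1)^k`, which is the sign
    -- carried by `sgn η`.
    have h9 : ∀ i : Fin k → Fin N, (starRingEnd ℂ) (sgn η k (e ∘ i)) *
        vol s e (k + (l + 1)) (Fin.append (e ∘ i) (Matrix.vecCons u w)) =
        (starRingEnd ℂ) (η k (e ∘ i)) *
          inn u (vol s e) (k + l) (Fin.append (e ∘ i) w) := by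
      intro i
      rw [append_cons, sgn_apply, ContinuousAlternatingMap.smul_apply]
      have := map_insertNth (vol s e) (⟨k, by omega⟩ : Fin (k + l + 1)) u (Fin.append (e ∘ i) w)
      have h5 : ((-1 : ℂ) ^ (k : ℕ)) * (-1) ^ (k : ℕ) = 1 := by rw [← mul_pow]; simp
      erw [this]
      simp only [smul_eq_mul, map_mul, map_pow, map_neg, map_one]
      linear_combination ((starRingEnd ℂ) (η k (e ∘ i)) *
          inn u (vol s e) (k + l) (Fin.append (e ∘ i) w)) * h5
    simp only [h9]
    rw [Nat.factorial_succ]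
    push_cast
    have : ((k : ℂ) + 1) ≠ 0 := by exact_mod_cast Nat.succ_ne_zero k
    have : ((k.factorial : ℕ) : ℂ) ≠ 0 := by exact_mod_cast k.factorial_ne_zero
    field_simp

end Hodge

end HKT

namespace HKT

/-! ### The square of the star, and its commutation with skew endomorphisms and isometries -/

section Hodge

variable {V : Type*} [NormedAddCommGroup V] [NormedSpace ℝ V]
  {N : ℕ} {s : V →L[ℝ] V →L[ℝ] ℝ} {e : Fin N → V}

lemma IsONB.eps_vol (h : IsONB s e) (α : V →L[ℝ] ℂ) : eps α (vol s e) = 0 := by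
  funext k
  cases k with
  | zero => rfl
  | succ k =>
    by_cases hk : N = k
    · exact h.deg_eq_zero (by omega) _
    · rw [eps_congr (ζ := 0) (by rw [vol_of_ne hk]; rfl), map_zero]

lemma hodge_one : hodge s e one = vol s e := by
  funext l
  rcases lt_trichotomy N l with hl | rfl | hl
  · rw [hodge_of_lt hl, vol_of_ne hl.ne]
  · ext w
    rw [hodge_apply (Nat.zero_add N), Fintype.sum_unique, one_zero]
    have : ∀ v : Fin 0 → V, Fin.append v w = w ∘ Fin.cast (Nat.zero_add N) :=
      fun v => Fin.append_left_nil v w rfl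
    rw [this, ← ext_cast]
    simp
  · ext w
    obtain ⟨k, hk⟩ := Nat.exists_eq_add_of_lt hl
    rw [hodge_apply (k := k + 1) (by omega), one_succ, vol_of_ne (m := l) (by omega)]
    simp

lemma volForm_frame (i : Fin N → Fin N) :
    volForm s e (e ∘ i) = if Function.Injective i then volForm s e (e ∘ i) else 0 := by
  split_ifs with hi
  · rfl
  · rw [Function.Injective] at hi
    push Not at hi
    obtain ⟨a, b, hab, hne⟩ := hi
    exact (volForm s e).map_eq_zero_of_eq _ (by simp [hab]) hne

lemma IsONB.vol_perm (h : IsONB s e) (σ : Equiv.Perm (Fin N)) :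
    volForm s e (e ∘ σ) = ((Equiv.Perm.sign σ : ℤ) : ℂ) := by
  have h1 : volForm s e e = 1 := by
    rw [volForm_apply]
    have : (Matrix.of fun b a => s (e a) (e b)) = (1 : Matrix (Fin N) (Fin N) ℝ) := by
      ext a b
      rw [Matrix.of_apply, h.orth, Matrix.one_apply]
      simp [eq_comm]
    rw [this, Matrix.det_one]; simp
  have := (volForm s e).toAlternatingMap.map_perm e σ
  have h2 : volForm s e (e ∘ σ) = Equiv.Perm.sign σ • volForm s e e := this
  rw [h2, h1, Units.smul_def]
  simp

/-- Only injective index maps contribute; these are the `N!` permutations, each contributing the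
square of its sign. -/
lemma IsONB.sum_vol (h : IsONB s e) :
    ∑ i : Fin N → Fin N, (starRingEnd ℂ) (volForm s e (e ∘ i)) * volForm s e (e ∘ i)
      = ((N.factorial : ℕ) : ℂ) := by
  have h1 : ∑ σ : Equiv.Perm (Fin N),
      (starRingEnd ℂ) (volForm s e (e ∘ σ)) * volForm s e (e ∘ σ) = ((N.factorial : ℕ) : ℂ) := by
    simp only [h.vol_perm]
    have : ∀ σ : Equiv.Perm (Fin N), (starRingEnd ℂ) ((Equiv.Perm.sign σ : ℤ) : ℂ) *
        ((Equiv.Perm.sign σ : ℤ) : ℂ) = 1 := by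
      intro σ
      rcases Int.units_eq_one_or (Equiv.Perm.sign σ) with h | h <;> simp [h]
    rw [Finset.sum_congr rfl fun σ _ => this σ]
    simp [Fintype.card_perm]
  rw [← h1]
  symm
  refine Finset.sum_of_injOn (fun σ : Equiv.Perm (Fin N) => (σ : Fin N → Fin N))
    (fun σ _ τ _ h => Equiv.coe_fn_injective h) (fun _ _ => Finset.mem_coe.mpr (Finset.mem_univ _))
    (fun i _ hi => ?_) (fun _ _ => rfl)
  rw [volForm_frame, if_neg, mul_zero]
  intro hinj
  refine hi ⟨Equiv.ofBijective i (Finite.injective_iff_bijective.mp hinj), by simp, rfl⟩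

lemma IsONB.hodge_vol (h : IsONB s e) : hodge s e (vol s e) = one := by
  funext l
  rcases Nat.eq_zero_or_pos l with rfl | hl
  · ext w
    rw [hodge_apply (Nat.add_zero N), one_zero]
    have : ∀ v : Fin N → V, Fin.append v w = v := fun v => Fin.append_right_nil v w rfl
    simp only [this]
    simp only [vol, Nat.add_zero, ofDegree_self]
    rw [h.sum_vol, inv_mul_cancel₀ (by exact_mod_cast N.factorial_ne_zero)]
    rfl
  · obtain ⟨m, rfl⟩ := Nat.exists_eq_succ_of_ne_zero (by omega : l ≠ 0)
    rw [one_succ]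
    by_cases hm : m + 1 ≤ N
    · ext w
      rw [hodge_apply (Nat.sub_add_cancel hm), vol_of_ne (m := N - (m + 1)) (by omega)]
      simp
    · exact hodge_of_lt (not_le.mp hm) _

/-- `* ι_u η = ∓ u ∧ * η`. -/
lemma IsONB.hodge_inn (h : IsONB s e) (hN : Even N) (u : V) (η : Ext V) :
    hodge s e (inn u η) = -eps (cov s u) (hodge s e (sgn η)) := by
  refine h.ext_induction (p := fun η => hodge s e (inn u η) = -eps (cov s u) (hodge s e (sgn η)))
    ?_ ?_ ?_ ?_ η
  · rw [inn_one, hodge_zero, sgn_one, hodge_one, h.eps_vol, neg_zero]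
  · intro η ζ h1 h2
    rw [map_add, hodge_add, h1, h2, map_add, hodge_add, map_add, neg_add]
  · intro c η h1
    rw [map_smul, hodge_smul, h1, map_smul, hodge_smul, map_smul]
    funext k; ext v; simp
  · intro v η h1
    have h2 : hodge s e (inn u (sgn η)) = -eps (cov s u) (hodge s e η) := by
      rw [← neg_neg (inn u (sgn η)), ← sgn_inn, hodge_neg, hodge_sgn hN, h1, map_neg, sgn_eps,
        hodge_sgn hN, sgn_sgn, neg_neg]
    have h3 := inn_eps v (cov s u) (hodge s e η)
    rw [cov_apply, h.symm u v] at h3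
    rw [inn_eps, sub_eq_add_neg, hodge_add, hodge_neg, hodge_smul, h.hodge_eps, cov_apply,
      Complex.conj_ofReal, sgn_inn, hodge_neg, h2, sgn_eps, hodge_neg, h.hodge_eps, sgn_sgn,
      map_neg, map_neg, map_neg, h3]
    abel

/-- The star exchanges `eps` and `inn` up to the degree involution, so applying it twice returns
each generator with one sign. -/
lemma IsONB.hodge_hodge (h : IsONB s e) (hN : Even N) (η : Ext V) :
    hodge s e (hodge s e η) = sgn η := by
  refine h.ext_induction (p := fun η => hodge s e (hodge s e η) = sgn η) ?_ ?_ ?_ ?_ η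
  · rw [hodge_one, h.hodge_vol, sgn_one]
  · intro η ζ h1 h2
    rw [hodge_add, hodge_add, h1, h2, map_add]
  · intro c η h1
    rw [hodge_smul, hodge_smul, h1, map_smul, Complex.conj_conj]
  · intro u η h1
    rw [h.hodge_eps, h.hodge_inn hN, hodge_sgn hN, hodge_sgn hN, hodge_sgn hN, sgn_sgn, h1, sgn_eps]

lemma IsONB.eps_hodge (h : IsONB s e) (hN : Even N) (u : V) (η : Ext V) :
    eps (cov s u) (hodge s e η) = -hodge s e (inn u (sgn η)) := by
  rw [h.hodge_inn hN, sgn_sgn, neg_neg]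

/-- A skew endomorphism is an infinitesimal isometry. Its derivation kills the volume form, being
trace-free, and its actions on vectors and covectors correspond under `s`; the claim follows on
generators. It is applied both to the torsion endomorphisms `T(e_a)` and to the derivatives of an
adapted frame. -/
lemma IsONB.hodge_der (h : IsONB s e) (hN : Even N) {X : V →L[ℝ] V}
    (hX : ∀ u v, s (X u) v = -s u (X v)) (η : Ext V) :
    hodge s e (der X η) = der X (hodge s e η) := by
  have hcov : ∀ u, (cov s u).comp X = -cov s (X u) := by
    intro u; ext v; simp [hX]
  have hvol : der X (vol s e) = 0 := by
    rw [h.der_expand]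
    refine Finset.sum_eq_zero fun a _ => ?_
    have h1 : inn (e a) (vol s e) = hodge s e (eps (cov s (e a)) one) := by
      rw [h.hodge_eps, sgn_one, hodge_one]
    have h2 : s (e a) (X (e a)) = 0 := by
      have := hX (e a) (e a)
      rw [h.symm] at this; linarith
    have h3 : inn (X (e a)) (eps (cov s (e a)) one) = 0 := by
      rw [inn_eps, inn_one, map_zero, cov_apply, h2]; simp
    rw [hcov, map_neg, LinearMap.neg_apply, h1, h.eps_hodge hN, sgn_eps, map_neg, sgn_one, h3,
      neg_zero, hodge_zero]; simp
  refine h.ext_induction (p := fun η => hodge s e (der X η) = der X (hodge s e η)) ?_ ?_ ?_ ?_ η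
  · rw [der_one, hodge_zero, hodge_one, hvol]
  · intro η ζ h1 h2
    rw [map_add, hodge_add, h1, h2, hodge_add, map_add]
  · intro c η h1
    rw [map_smul, hodge_smul, h1, hodge_smul, map_smul]
  · intro u η h1
    rw [der_eps, hodge_add, hcov, map_neg, LinearMap.neg_apply, hodge_neg, h.hodge_eps, h.hodge_eps,
      h.hodge_eps, hodge_sgn hN, hodge_sgn hN, h1]
    have h3 := inn_der u X (sgn (hodge s e η))
    have h4 : ∀ ζ : Ext V, sgn (der X ζ) = der X (sgn ζ) := by
      intro ζ
      funext k
      ext v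
      simp [sgn_apply, der_apply, Finset.mul_sum]
    rw [h4, h3]
    abel

/-- The star operator depends on the frame only through the volume form. -/
lemma IsONB.hodge_congr (h : IsONB s e) {e' : Fin N → V} (h' : IsONB s e') 
    (hv : vol s e = vol s e') (η : Ext V) : hodge s e η = hodge s e' η := by
  refine h.ext_induction (p := fun η => ∀ ζ, ζ = η ∨ ζ = sgn η → hodge s e ζ = hodge s e' ζ) ?_ ?_ ?_ ?_ η η (Or.inl rfl)
  · rw [sgn_one]
    rintro ζ (rfl | rfl) <;> rw [hodge_one, hodge_one, hv]
  · intro η ζ h1 h2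
    rintro ξ (rfl | rfl)
    · rw [hodge_add, hodge_add, h1 _ (Or.inl rfl), h2 _ (Or.inl rfl)]
    · rw [map_add, hodge_add, hodge_add, h1 _ (Or.inr rfl), h2 _ (Or.inr rfl)]
  · intro c η h1
    rintro ξ (rfl | rfl)
    · rw [hodge_smul, hodge_smul, h1 _ (Or.inl rfl)]
    · rw [map_smul, hodge_smul, hodge_smul, h1 _ (Or.inr rfl)]
  · intro u η h1
    rintro ξ (rfl | rfl)
    · rw [h.hodge_eps, h'.hodge_eps, h1 _ (Or.inr rfl)]
    · rw [sgn_eps, hodge_neg, hodge_neg, h.hodge_eps, h'.hodge_eps, sgn_sgn, h1 _ (Or.inl rfl)]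

lemma vol_comp {s' : V →L[ℝ] V →L[ℝ] ℝ} {A : V →L[ℝ] V} (hA : ∀ u v, s' (A u) (A v) = s u v)
    {m : ℕ} (v : Fin m → V) : vol s' (A ∘ e) m (A ∘ v) = vol s e m v := by
  by_cases hm : m = N
  · rw [vol_apply hm, vol_apply hm]
    simp [hA]
  · rw [vol_of_ne (Ne.symm hm), vol_of_ne (Ne.symm hm)]; rfl

/-- Naturality of the star operator under isometries. -/
lemma pull_hodge {s' : V →L[ℝ] V →L[ℝ] ℝ} {A : V →L[ℝ] V} (hA : ∀ u v, s' (A u) (A v) = s u v)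
    (η : Ext V) : pull A (hodge s' (A ∘ e) η) = hodge s e (pull A η) := by
  funext l
  by_cases hl : l ≤ N
  · ext w
    simp only [pull, ContinuousAlternatingMap.compContinuousLinearMap_apply]
    rw [hodge_apply (Nat.sub_add_cancel hl), hodge_apply (Nat.sub_add_cancel hl)]
    congr 1
    refine Finset.sum_congr rfl fun i _ => ?_
    congr 1
    rw [← vol_comp hA]
    congr 1
    funext j
    refine Fin.addCases (fun i => ?_) (fun i => ?_) j <;> simp
  · rw [hodge_of_lt (not_le.mp hl)]
    simp only [pull]
    rw [hodge_of_lt (not_le.mp hl)]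
    ext w; simp

end Hodge

end HKT

namespace HKT

/-! ### Independence of the star of the quaternionic frame -/

section Frames

variable {V : Type*} [NormedAddCommGroup V] [NormedSpace ℝ V]
  {N : ℕ} {s : V →L[ℝ] V →L[ℝ] ℝ} {e : Fin N → V}

lemma IsONB.inner_expand (h : IsONB s e) (u v : V) : ∑ c, s (e c) u * s (e c) v = s u v := by
  conv_rhs => rw [← h.expand v]
  rw [map_sum]
  refine Finset.sum_congr rfl fun c _ => ?_
  rw [map_smul, smul_eq_mul, h.symm u, mul_comm]

lemma IsONB.comp {s' : V →L[ℝ] V →L[ℝ] ℝ} (h : IsONB s e) (A A' : V →L[ℝ] V)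
    (hA : ∀ u v, s' (A u) (A v) = s u v) (hA' : ∀ v, A (A' v) = v) : IsONB s' (A ∘ e) where
  symm u v := by rw [← hA' u, ← hA' v, hA, hA, h.symm]
  orth a b := by simp [hA, h.orth]
  expand v := by
    conv_rhs => rw [← hA' v, ← h.expand (A' v), map_sum]
    refine Finset.sum_congr rfl fun a _ => ?_
    rw [map_smul, Function.comp_apply, ← hA (e a) (A' v), hA']

/-- A real endomorphism commuting with a complex structure has nonnegative determinant. -/
lemma det_nonneg_of_commute [FiniteDimensional ℝ V] {I A : V →L[ℝ] V} (hI : ∀ v, I (I v) = -v)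
    (hA : ∀ v, A (I v) = I (A v)) : 0 ≤ LinearMap.det (A : V →ₗ[ℝ] V) := by
  -- `I` makes `V` a complex vector space on which `A` is complex linear; the real determinant is
  -- then the norm `|det_ℂ|²`.
  let ρ : ℂ →ₐ[ℝ] Module.End ℝ V := Complex.lift ⟨(I : V →ₗ[ℝ] V), by
    ext v; simp [hI]⟩
  let _ : Module ℂ V := Module.compHom V ρ.toRingHom
  have hsmul : ∀ (z : ℂ) (v : V), z • v = z.re • v + z.im • I v := by
    intro z v
    change ρ z v = _
    simp [ρ, Complex.lift_apply, Complex.liftAux_apply, Module.algebraMap_end_apply]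
  have : IsScalarTower ℝ ℂ V := ⟨fun r z v => by
    rw [hsmul, hsmul]; simp [smul_add, mul_smul]⟩
  let B : V →ₗ[ℂ] V :=
    { toFun := A
      map_add' := map_add A
      map_smul' := fun z v => by
        simp only [RingHom.id_apply, hsmul, map_add, map_smul, hA] }
  have : Module.Finite ℂ V := Module.Finite.of_restrictScalars_finite ℝ ℂ V
  have h1 : (A : V →ₗ[ℝ] V) = B.restrictScalars ℝ := by ext v; rfl
  rw [h1, LinearMap.det_restrictScalars, Algebra.norm_complex_apply]
  exact Complex.normSq_nonneg _

/-- An isometry has determinant `±1`, and commuting with a complex structure excludes `-1`. -/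
lemma IsONB.vol_comp_of_commute (h : IsONB s e) {I A : V →L[ℝ] V} (hI : ∀ v, I (I v) = -v)
    (hA : ∀ v, A (I v) = I (A v)) (hs : ∀ u v, s (A u) (A v) = s u v) :
    vol s (A ∘ e) = vol s e := by
  have := h.finiteDimensional
  set P : Matrix (Fin N) (Fin N) ℝ := Matrix.of fun c a => s (e c) (A (e a)) with hP
  have hdet : LinearMap.det (A : V →ₗ[ℝ] V) = P.det := by
    rw [← LinearMap.det_toMatrix h.basis]
    congr 1
    ext c a
    rw [LinearMap.toMatrix_apply, h.basis_repr, h.basis_apply]; rfl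
  have hPP : P.transpose * P = 1 := by
    ext a b
    rw [Matrix.mul_apply]
    simp only [hP, Matrix.transpose_apply, Matrix.of_apply]
    rw [h.inner_expand, hs, h.orth, Matrix.one_apply]
  have h1 : P.det = 1 := by
    have h2 := congrArg Matrix.det hPP
    rw [Matrix.det_mul, Matrix.det_transpose, Matrix.det_one] at h2
    have h3 := det_nonneg_of_commute hI hA
    rw [hdet] at h3
    nlinarith
  funext m
  by_cases hm : m = N
  · ext v
    rw [vol_apply hm, vol_apply hm]
    congr 1
    have : (Matrix.of fun b a => s ((A ∘ e) a) (v (Fin.cast hm.symm b)))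
        = (Matrix.of fun b a => s (e a) (v (Fin.cast hm.symm b))) * P := by
      ext b a
      rw [Matrix.mul_apply]
      simp only [hP, Matrix.of_apply, Function.comp_apply]
      rw [← h.inner_expand]
      exact Finset.sum_congr rfl fun c _ => mul_comm _ _
    rw [this, Matrix.det_mul, h1, mul_one]
  · rw [vol_of_ne (Ne.symm hm), vol_of_ne (Ne.symm hm)]

lemma quatFrame_apply {n : ℕ} (I J K : V →L[ℝ] V) (u : Fin n → V) (c : Fin 4) (j : Fin n) :
    quatFrame I J K u (finProdFinEquiv (c, j)) = (![ContinuousLinearMap.id ℝ V, I, J, K] c) (u j) := by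
  simp [quatFrame]

/-- The star operator does not depend on the quaternionic orthonormal frame. -/
lemma hodge_quatFrame {n : ℕ} {I J K : V →L[ℝ] V} {u u' : Fin n → V} (hI : ∀ v, I (I v) = -v)
    (hIJ : ∀ v, I (J v) = K v) (h : IsONB s (quatFrame I J K u)) (h' : IsONB s (quatFrame I J K u'))
    (η : Ext V) : hodge s (quatFrame I J K u) η = hodge s (quatFrame I J K u') η := by
  refine h.hodge_congr h' ?_ η
  set e := quatFrame I J K u
  set e' := quatFrame I J K u'
  -- The isometry taking one frame to the other. It commutes with `I` because `I` permutes the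
  -- vectors of a quaternionic frame, up to sign, in the same way for both frames.
  let A : V →L[ℝ] V := ∑ a, (s (e a)).smulRight (e' a)
  have hAv : ∀ v, A v = ∑ a, s (e a) v • e' a := fun v => by simp [A]
  have hAe : ∀ a, A (e a) = e' a := fun a => by
    rw [hAv]; simp [h.orth]
  have hs : ∀ u v, s (A u) (A v) = s u v := by
    intro u v
    rw [← h.inner_expand u v, hAv u, hAv v]
    simp only [map_sum, map_smul, _root_.sum_apply, _root_.smul_apply, h'.orth, smul_eq_mul]
    simp [mul_comm]
  have key : ∀ c j, A ((![ContinuousLinearMap.id ℝ V, I, J, K] c) (u j))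
      = (![ContinuousLinearMap.id ℝ V, I, J, K] c) (u' j) := by
    intro c j
    rw [← quatFrame_apply I J K u, ← quatFrame_apply I J K u']
    exact hAe _
  have hAI : ∀ v, A (I v) = I (A v) := by
    intro v
    rw [← h.expand v]
    simp only [map_sum, map_smul]
    refine Finset.sum_congr rfl fun a _ => ?_
    congr 1
    obtain ⟨⟨c, j⟩, rfl⟩ := finProdFinEquiv.surjective a
    rw [hAe, show e _ = _ from quatFrame_apply I J K u c j,
      show e' _ = _ from quatFrame_apply I J K u' c j]
    have k0 := key 0 j
    have k1 := key 1 j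
    have k2 := key 2 j
    have k3 := key 3 j
    simp at k0 k1 k2 k3
    fin_cases c
    · simpa using k1
    · simp [hI, k0]
    · simp [hIJ, k3]
    · simp [← hIJ, hI, k2]
  have : e' = A ∘ e := by funext a; exact (hAe a).symm
  rw [this, h.vol_comp_of_commute hI hAI hs]

end Frames

/-! ### The star operator and Hodge types -/

section HodgeTypes

variable {V : Type*} [NormedAddCommGroup V] [NormedSpace ℝ V]
  {N : ℕ} {s : V →L[ℝ] V →L[ℝ] ℝ} {e : Fin N → V} {I : V →L[ℝ] V}

lemma rot_isometry (hI : ∀ v, I (I v) = -v)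
    (hsI : ∀ u v, s (I u) (I v) = s u v) (t : ℝ) (u v : V) :
    s (rot I t u) (rot I t v) = s u v := by
  have h1 : s u (I v) = - s (I u) v := by
    have := hsI u (I v)
    rw [hI, map_neg] at this
    linarith
  simp only [rot_apply, map_add, map_smul, _root_.add_apply, _root_.smul_apply, smul_eq_mul, hsI,
    h1]
  linear_combination s u v * Real.cos_sq_add_sin_sq t

lemma rot_neg_rot (hI : ∀ v, I (I v) = -v) (t : ℝ) (v : V) : rot I t (rot I (-t) v) = v := by
  simp only [rot_apply, Real.cos_neg, Real.sin_neg, map_add, map_smul, hI, smul_add, smul_smul]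
  have : v = (Real.cos t ^ 2 + Real.sin t ^ 2) • v := by rw [Real.cos_sq_add_sin_sq, one_smul]
  conv_rhs => rw [this]
  module

lemma IsONB.pull_rot_hodge (h : IsONB s e) (hI : ∀ v, I (I v) = -v)
    (hsI : ∀ u v, s (I u) (I v) = s u v) (t : ℝ) (η : Ext V) :
    pull (rot I t) (hodge s e η) = hodge s e (pull (rot I t) η) := by
  have h1 : ∀ u v, s (rot I t u) (rot I t v) = s u v := rot_isometry hI hsI t
  have h2 : IsONB s (rot I t ∘ e) := h.comp _ (rot I (-t)) h1 (rot_neg_rot hI t)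
  rw [← pull_hodge h1, h.hodge_congr h2 (h.vol_comp_of_commute hI ?_ h1).symm]
  intro v
  simp [rot_apply]

lemma hodge_deg_congr {k l : ℕ} (hkl : k + l = N) {β γ : Ext V} (h : β k = γ k) :
    hodge s e β l = hodge s e γ l := by
  ext w
  rw [hodge_apply hkl, hodge_apply hkl, h]

lemma pull_ofDegree (A : V →L[ℝ] V) {k : ℕ} (φ : V [⋀^Fin k]→L[ℝ] ℂ) :
    pull A (ofDegree φ) = ofDegree (φ.compContinuousLinearMap A) := by
  funext l
  by_cases h : k = l
  · subst h; simp [pull]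
  · rw [ofDegree_of_ne _ h, pull, ofDegree_of_ne _ h]; ext v; simp

lemma smul_ofDegree (c : ℂ) {k : ℕ} (φ : V [⋀^Fin k]→L[ℝ] ℂ) :
    ofDegree (c • φ) = c • ofDegree φ := by
  funext l
  by_cases h : k = l
  · subst h; simp
  · rw [ofDegree_of_ne _ h, Pi.smul_apply, ofDegree_of_ne _ h]; ext v; simp

/-- Rotations by `I` are isometries commuting with `I`, so they commute with the star. The star is
conjugate-linear, so the phase is conjugated and the weight changes sign. -/
lemma HasWeight.hodge (h : IsONB s e) (hI : ∀ v, I (I v) = -v)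
    (hsI : ∀ u v, s (I u) (I v) = s u v) {k : ℕ} {φ : V [⋀^Fin k]→L[ℝ] ℂ} {w : ℤ}
    (hφ : HasWeight I w φ) (l : ℕ) : HasWeight I (-w) (HKT.hodge s e (ofDegree φ) l) := by
  intro t
  have h1 := congrFun (h.pull_rot_hodge hI hsI t (ofDegree φ)) l
  rw [pull_ofDegree, hφ t, smul_ofDegree, hodge_smul, Pi.smul_apply, ← Complex.exp_conj] at h1
  refine h1.trans ?_
  congr 2
  simp

/-- The star operator maps forms of type `(p, q)` to forms of opposite weight. -/
lemma IsONB.typeComp_hodge (h : IsONB s e) (hI : ∀ v, I (I v) = -v)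
    (hsI : ∀ u v, s (I u) (I v) = s u v) {p q p' q' l : ℕ} (hl : l = p' + q')
    (hN : p + q + l = N) (hpq : (p' : ℤ) - q' = q - p) {η ζ : Ext V}
    (hζ : ζ (p + q) = typeComp I p q (η (p + q))) :
    hodge s e ζ l = typeComp I p' q' (hodge s e η l) := by
  have h1 : hodge s e η l = ∑ pq ∈ Finset.HasAntidiagonal.antidiagonal (p + q),
      hodge s e (ofDegree (typeComp I pq.1 pq.2 (η (p + q)))) l := by
    rw [← Finset.sum_apply, ← hodge_sum]
    refine hodge_deg_congr hN ?_
    rw [Finset.sum_apply]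
    simp only [ofDegree_self]
    rw [sum_typeComp h hI]
  have h2 : ∀ pq ∈ Finset.HasAntidiagonal.antidiagonal (p + q),
      HasWeight I (-((pq.1 : ℤ) - pq.2))
        (hodge s e (ofDegree (typeComp I pq.1 pq.2 (η (p + q)))) l) := fun pq hpq =>
    (isOfType_typeComp h hI (Finset.HasAntidiagonal.mem_antidiagonal.mp hpq).symm _).hasWeight.hodge
      h hI hsI l
  rw [h1, ← typeCompL_apply, _root_.map_sum]
  simp only [typeCompL_apply]
  rw [Finset.sum_eq_single_of_mem (p, q) (Finset.HasAntidiagonal.mem_antidiagonal.mpr rfl)]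
  · have := h2 (p, q) (Finset.HasAntidiagonal.mem_antidiagonal.mpr rfl)
    rw [this.typeComp h hI hl, if_pos (by simp only; omega)]
    exact hodge_deg_congr hN (by rw [hζ, ofDegree_self])
  · rintro ⟨p1, q1⟩ hp hne
    rw [(h2 _ hp).typeComp h hI hl, if_neg]
    rw [Finset.HasAntidiagonal.mem_antidiagonal] at hp
    intro h3
    apply hne
    simp only at h3 hp
    rw [Prod.mk.injEq]; omega

end HodgeTypes

end HKT

namespace HKT

/-! ### Quaternionic Hermitian vector spaces and their frames -/

section QuatHerm

variable {V : Type*} [NormedAddCommGroup V] [NormedSpace ℝ V]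

/-- A quaternionic Hermitian structure on a real vector space. -/
structure QuatHerm (s : V →L[ℝ] V →L[ℝ] ℝ) (I J K : V →L[ℝ] V) : Prop where
  I_sq : ∀ v, I (I v) = -v
  J_sq : ∀ v, J (J v) = -v
  I_J : ∀ v, I (J v) = K v
  J_I : ∀ v, J (I v) = -K v
  symm : ∀ u v, s u v = s v u
  pos : ∀ v, v ≠ 0 → 0 < s v v
  herm_I : ∀ u v, s (I u) (I v) = s u v
  herm_J : ∀ u v, s (J u) (J v) = s u v

namespace QuatHerm

variable {s : V →L[ℝ] V →L[ℝ] ℝ} {I J K : V →L[ℝ] V}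

lemma I_K (q : QuatHerm s I J K) (v : V) : I (K v) = -J v := by rw [← q.I_J, q.I_sq]

lemma K_I (q : QuatHerm s I J K) (v : V) : K (I v) = J v := by
  rw [← q.I_J, q.J_I, map_neg, q.I_K, neg_neg]

lemma J_K (q : QuatHerm s I J K) (v : V) : J (K v) = I v := by
  have := q.J_I (J v)
  rw [q.I_J] at this
  rw [this, ← q.I_J, q.J_sq, map_neg, neg_neg]

lemma K_J (q : QuatHerm s I J K) (v : V) : K (J v) = -I v := by
  rw [← q.I_J, q.J_sq, map_neg]

lemma K_sq (q : QuatHerm s I J K) (v : V) : K (K v) = -v := by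
  rw [← q.I_J, q.J_K, q.I_sq]

lemma herm_K (q : QuatHerm s I J K) (u v : V) : s (K u) (K v) = s u v := by
  rw [← q.I_J, ← q.I_J, q.herm_I, q.herm_J]

lemma skew_I (q : QuatHerm s I J K) (u v : V) : s (I u) v = -s u (I v) := by
  rw [← q.herm_I, q.I_sq]; simp

lemma skew_J (q : QuatHerm s I J K) (u v : V) : s (J u) v = -s u (J v) := by
  rw [← q.herm_J, q.J_sq]; simp

lemma skew_K (q : QuatHerm s I J K) (u v : V) : s (K u) v = -s u (K v) := by
  rw [← q.herm_K, q.K_sq]; simp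

lemma self_I (q : QuatHerm s I J K) (v : V) : s v (I v) = 0 := by
  have := q.skew_I v v
  rw [q.symm] at this; linarith

lemma self_J (q : QuatHerm s I J K) (v : V) : s v (J v) = 0 := by
  have := q.skew_J v v
  rw [q.symm] at this; linarith

lemma self_K (q : QuatHerm s I J K) (v : V) : s v (K v) = 0 := by
  have := q.skew_K v v
  rw [q.symm] at this; linarith

/-- The sixteen pairings of `1, I, J, K` reduce to these four, since all of `I, J, K` can be moved
to the second slot and multiplied out. -/
lemma isQuatOrthonormal (q : QuatHerm s I J K) {m : ℕ} {u : Fin m → V}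
    (h : ∀ i j, s (u i) (u j) = (if i = j then 1 else 0) ∧ s (u i) (I (u j)) = 0 ∧
      s (u i) (J (u j)) = 0 ∧ s (u i) (K (u j)) = 0) : IsQuatOrthonormal s I J K u := by
  intro a b
  obtain ⟨⟨c, i⟩, rfl⟩ := finProdFinEquiv.surjective a
  obtain ⟨⟨d, j⟩, rfl⟩ := finProdFinEquiv.surjective b
  rw [quatFrame_apply, quatFrame_apply]
  simp only [EmbeddingLike.apply_eq_iff_eq, Prod.mk.injEq]
  obtain ⟨h1, h2, h3, h4⟩ := h i j
  fin_cases c <;> fin_cases d <;>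
    simp [q.skew_I, q.skew_J, q.skew_K, q.I_sq, q.J_sq, q.K_sq, q.I_J, q.J_I, q.I_K, q.K_I, q.J_K,
      q.K_J, h1, h2, h3, h4]

/-- Quaternionic Gram–Schmidt: as long as `4 m` is less than the dimension, some nonzero vector is
orthogonal to the quaternionic span of the first `m`. Once normalized, its own quaternionic
multiples are orthonormal automatically. -/
lemma exists_isQuatOrthonormal_aux [FiniteDimensional ℝ V] (q : QuatHerm s I J K) (m : ℕ)
    (hm : 4 * m ≤ Module.finrank ℝ V) : ∃ u : Fin m → V,
    ∀ i j, s (u i) (u j) = (if i = j then 1 else 0) ∧ s (u i) (I (u j)) = 0 ∧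
      s (u i) (J (u j)) = 0 ∧ s (u i) (K (u j)) = 0 := by
  induction m with
  | zero => exact ⟨Fin.elim0, fun i => i.elim0⟩
  | succ m ih =>
    obtain ⟨u, hu⟩ := ih (by omega)
    let f : V →ₗ[ℝ] (Fin 4 × Fin m → ℝ) := LinearMap.pi fun p =>
      (s ((![ContinuousLinearMap.id ℝ V, I, J, K] p.1) (u p.2)) : V →ₗ[ℝ] ℝ)
    have hf : LinearMap.ker f ≠ ⊥ := LinearMap.ker_ne_bot_of_finrank_lt (by
      rw [Module.finrank_fintype_fun_eq_card]; simp; omega)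
    obtain ⟨v, hv, hv0⟩ := Submodule.exists_mem_ne_zero_of_ne_bot hf
    have hv' : ∀ c j, s ((![ContinuousLinearMap.id ℝ V, I, J, K] c) (u j)) v = 0 := fun c j =>
      congrFun (LinearMap.mem_ker.mp hv) (c, j)
    set r : ℝ := (Real.sqrt (s v v))⁻¹ with hr
    have hpos := q.pos v hv0
    have hrr : r * (r * s v v) = 1 := by
      have := Real.mul_self_sqrt hpos.le
      rw [hr, ← mul_assoc, ← mul_inv, this, inv_mul_cancel₀ hpos.ne']
    refine ⟨Fin.cons (r • v) u, fun i j => ?_⟩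
    refine Fin.cases ?_ (fun i => ?_) i <;> refine Fin.cases ?_ (fun j => ?_) j
    · simp [q.self_I, q.self_J, q.self_K, hrr]
    · have h0 := hv' 0 j
      have h1 := hv' 1 j
      have h2 := hv' 2 j
      have h3 := hv' 3 j
      simp at h0 h1 h2 h3
      have hne : (0 : Fin (m + 1)) ≠ j.succ := (Fin.succ_ne_zero j).symm
      simp [q.symm v, h0, h1, h2, h3, hne]
    · have h0 := hv' 0 i
      have h1 := hv' 1 i
      have h2 := hv' 2 i
      have h3 := hv' 3 i
      simp [q.skew_I, q.skew_J, q.skew_K] at h0 h1 h2 h3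
      simp [h0, h1, h2, h3]
    · simp [hu i j]

lemma isONB_quatFrame {n : ℕ} (q : QuatHerm s I J K) (hn : Module.finrank ℝ V = 4 * n)
    [FiniteDimensional ℝ V] {u : Fin n → V} (hu : IsQuatOrthonormal s I J K u) :
    IsONB s (quatFrame I J K u) := by
  set e := quatFrame I J K u
  refine ⟨q.symm, hu, ?_⟩
  have hli : LinearIndependent ℝ e := by
    rw [Fintype.linearIndependent_iff]
    intro g hg a
    have := congrArg (s (e a)) hg
    simp only [map_sum, map_smul, smul_eq_mul, map_zero] at this
    simpa [show ∀ b, s (e a) (e b) = _ from hu a] using this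
  set b := basisOfLinearIndependentOfCardEqFinrank' e hli (by simp [hn])
  have hb : ∀ a, b a = e a := fun a => by simp [b]
  intro v
  conv_rhs => rw [← b.sum_repr v]
  refine Finset.sum_congr rfl fun a _ => ?_
  rw [hb]
  congr 1
  conv_lhs => rw [← b.sum_repr v]
  simp only [hb, map_sum, map_smul, smul_eq_mul, show ∀ b, s (e a) (e b) = _ from hu a]
  simp

lemma exists_isQuatOrthonormal {n : ℕ} (q : QuatHerm s I J K) (hn : Module.finrank ℝ V = 4 * n)
    [FiniteDimensional ℝ V] : ∃ u : Fin n → V, IsQuatOrthonormal s I J K u := by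
  obtain ⟨u, hu⟩ := q.exists_isQuatOrthonormal_aux n hn.ge
  exact ⟨u, q.isQuatOrthonormal hu⟩

end QuatHerm

end QuatHerm

end HKT

namespace HKT

/-! ### Multiplication by `Ω` -/

section Omega

variable {V : Type*} [NormedAddCommGroup V] [NormedSpace ℝ V]
  {N : ℕ} {s : V →L[ℝ] V →L[ℝ] ℝ} {e : Fin N → V} {I J K : V →L[ℝ] V}

lemma wedge_sum_left {ι : Type*} (t : Finset ι) (f : ι → Ext V) (β : Ext V) :
    wedge (∑ i ∈ t, f i) β = ∑ i ∈ t, wedge (f i) β :=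
  map_sum (AddMonoidHom.mk' (fun α => wedge α β) fun _ _ => wedge_add_left _ _ _) f t

variable (s J K) in
/-- The contraction of `Ω = (ω_J + i ω_K) / 2` with a vector. -/
def innOmega : V →ₗ[ℝ] V →L[ℝ] ℂ where
  toFun v := (1 / 2 : ℂ) • ((cov s v).comp J + Complex.I • (cov s v).comp K)
  map_add' u v := by ext w; simp; ring
  map_smul' c u := by ext w; simp; ring

lemma innOmega_apply (v w : V) :
    innOmega s J K v w = (1 / 2 : ℂ) * (s v (J w) + Complex.I * s v (K w)) := by
  simp [innOmega]; ring

lemma half_smul_add_half {W : Type*} [AddCommGroup W] [Module ℂ W] (η : W) :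
    (1 / 2 : ℂ) • η + (1 / 2 : ℂ) • η = η := by
  rw [← add_smul]; norm_num

variable (s e J K) in
/-- Exterior multiplication by `Ω`. -/
def mulOmega : Module.End ℂ (Ext V) :=
  (1 / 2 : ℂ) • ∑ b, eps (cov s (e b)) * eps (innOmega s J K (e b))

lemma mulOmega_apply (η : Ext V) : mulOmega s e J K η =
    (1 / 2 : ℂ) • ∑ b, eps (cov s (e b)) (eps (innOmega s J K (e b)) η) := by
  simp [mulOmega]

lemma inn_ofDegree_omega {ϖ : V [⋀^Fin 2]→L[ℝ] ℂ}
    (hϖ : ∀ v, ϖ v = (1 / 2 : ℂ) * (s (v 0) (J (v 1)) + Complex.I * s (v 0) (K (v 1)))) (v : V) :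
    inn v (ofDegree ϖ) = eps (innOmega s J K v) one := by
  rw [inn_ofDegree, ofDegree_eq_eps]
  congr 2
  ext w
  rw [toCovector_apply, innOmega_apply]
  exact hϖ ![v, w]

/-- The Euler identity in degree `2`; its factor `2` explains the `1 / 2` in `mulOmega`. -/
lemma IsONB.ofDegree_omega (h : IsONB s e) {ϖ : V [⋀^Fin 2]→L[ℝ] ℂ}
    (hϖ : ∀ v, ϖ v = (1 / 2 : ℂ) * (s (v 0) (J (v 1)) + Complex.I * s (v 0) (K (v 1)))) :
    ofDegree ϖ = mulOmega s e J K one := by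
  rw [mulOmega_apply]
  simp only [← inn_ofDegree_omega hϖ]
  funext k
  rw [Pi.smul_apply]
  match k with
  | 0 =>
    rw [ofDegree_of_ne _ (by omega), Finset.sum_apply]
    simp
  | k + 1 =>
    rw [h.euler]
    by_cases hk : k = 1
    · subst hk
      ext v; simp; ring
    · rw [ofDegree_of_ne _ (by omega)]; ext v; simp

lemma IsONB.wedge_omega (h : IsONB s e) {ϖ : V [⋀^Fin 2]→L[ℝ] ℂ}
    (hϖ : ∀ v, ϖ v = (1 / 2 : ℂ) * (s (v 0) (J (v 1)) + Complex.I * s (v 0) (K (v 1))))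
    (η : Ext V) : wedge (ofDegree ϖ) η = mulOmega s e J K η := by
  rw [h.ofDegree_omega hϖ, mulOmega_apply, wedge_smul_left, wedge_sum_left, mulOmega_apply]
  simp only [wedge_eps, wedge_one]

lemma QuatHerm.innOmega_antisymm (q : QuatHerm s I J K) (u v : V) :
    innOmega s J K u v = -innOmega s J K v u := by
  rw [innOmega_apply, innOmega_apply, q.symm u, q.symm u, q.skew_J, q.skew_K]
  push_cast; ring

/-- Contraction hits either of the two covectors of `½ ∑ e^b ∧ ι_b Ω`. By antisymmetry of `Ω` the
two results are equal, and their halves add up to `ι_v Ω`. This is the commutator from which the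
cancellation of first-order terms comes. -/
lemma QuatHerm.inn_mulOmega (q : QuatHerm s I J K) (h : IsONB s e) (v : V) (η : Ext V) :
    inn v (mulOmega s e J K η) = eps (innOmega s J K v) η + mulOmega s e J K (inn v η) := by
  rw [mulOmega_apply, mulOmega_apply, map_smul, map_sum]
  have h1 : ∀ b, inn v (eps (cov s (e b)) (eps (innOmega s J K (e b)) η))
      = (s (e b) v : ℂ) • eps (innOmega s J K (e b)) η
        + eps (innOmega s J K v (e b) • cov s (e b)) η
        + eps (cov s (e b)) (eps (innOmega s J K (e b)) (inn v η)) := by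
    intro b
    rw [inn_eps, inn_eps, q.innOmega_antisymm v, cov_apply]
    simp only [map_sub, map_smul, LinearMap.smul_apply, neg_smul]
    abel
  have h2 := h.sum_apply' (((eps : _ →ₗ[ℂ] Module.End ℂ (Ext V)).flip η).restrictScalars ℝ ∘ₗ
    innOmega s J K) v
  simp only [LinearMap.comp_apply, LinearMap.restrictScalars_apply, LinearMap.flip_apply] at h2
  simp only [h1, Finset.sum_add_distrib, h2]
  rw [← LinearMap.sum_apply, ← map_sum, h.covector_expand, smul_add, smul_add, half_smul_add_half]

end Omega

end HKT

namespace HKT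

/-! ### The action of a skew torsion on `Ω` -/

section Torsion

variable {V : Type*} [NormedAddCommGroup V] [NormedSpace ℝ V]
  {N : ℕ} {s : V →L[ℝ] V →L[ℝ] ℝ} {e : Fin N → V} {I J K : V →L[ℝ] V}

/-- `T` is a torsion tensor such that `s(T(u, v), w)` is totally skew-symmetric. -/
structure IsSkewTorsion (s : V →L[ℝ] V →L[ℝ] ℝ) (T : V →L[ℝ] V →L[ℝ] V) : Prop where
  anti : ∀ u v, T u v = -T v u
  skew : ∀ u v w, s (T u v) w = -s (T u w) v

lemma IsSkewTorsion.cyc {T : V →L[ℝ] V →L[ℝ] V} (hT : IsSkewTorsion s T) (u v w : V) :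
    s (T u v) w = s (T v w) u := by
  rw [hT.anti, map_neg, _root_.neg_apply, hT.skew, neg_neg]

/-- The integrability condition for a complex structure preserved by a connection with
torsion `T`. -/
def TorsionIntegrable (T : V →L[ℝ] V →L[ℝ] V) (L : V →L[ℝ] V) : Prop :=
  ∀ u v, T u v = T (L u) (L v) - L (T (L u) v) - L (T u (L v))

variable (s J K) in
/-- The contraction of the derivative of `Ω` along `X`. -/
def innDerOmega (X : V →L[ℝ] V) (b : V) : V →L[ℝ] ℂ :=
  innOmega s J K (X b) + (innOmega s J K b).comp X

lemma QuatHerm.innDerOmega_antisymm (q : QuatHerm s I J K) (X : V →L[ℝ] V) (u v : V) :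
    innDerOmega s J K X u v = -innDerOmega s J K X v u := by
  simp only [innDerOmega, _root_.add_apply, ContinuousLinearMap.comp_apply]
  rw [q.innOmega_antisymm (X u), q.innOmega_antisymm u]
  ring

/-- The Leibniz rule; moving `X` across `∑ e^b ⊗ e_b` collects both of its contributions into the
derivative of `Ω`. -/
lemma IsONB.der_mulOmega (h : IsONB s e) (X : V →L[ℝ] V) (η : Ext V) :
    der X (mulOmega s e J K η) = mulOmega s e J K (der X η) +
      (1 / 2 : ℂ) • ∑ b, eps (cov s (e b)) (eps (innDerOmega s J K X (e b)) η) := by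
  have h1 := h.sum_comp X ((((eps : _ →ₗ[ℂ] Module.End ℂ (Ext V)).flip η).restrictScalars ℝ) ∘ₗ
    innOmega s J K)
  simp only [LinearMap.comp_apply, LinearMap.restrictScalars_apply, LinearMap.flip_apply] at h1
  rw [mulOmega_apply, mulOmega_apply, map_smul, map_sum]
  simp only [der_eps, map_add, Finset.sum_add_distrib, h1, innDerOmega, LinearMap.add_apply,
    smul_add]
  abel

/-- Contraction either meets the `2`-form `der (X a) Ω`, where the two halves agree by antisymmetry,
or passes through it to `η`. The first part is of order zero in `η`, the second is of the shape
handled by `wedgeInn`. -/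
lemma IsONB.sum_inn_eps_eps (q : QuatHerm s I J K) (h : IsONB s e) (X : Fin N → V →L[ℝ] V)
    (η : Ext V) :
    ∑ a, inn (e a) ((1 / 2 : ℂ) • ∑ b, eps (cov s (e b)) (eps (innDerOmega s J K (X a) (e b)) η))
      = ∑ a, eps (innDerOmega s J K (X a) (e a)) η +
        (1 / 2 : ℂ) • ∑ a, ∑ b, eps (cov s (e b))
          (eps (innDerOmega s J K (X a) (e b)) (inn (e a) η)) := by
  rw [Finset.smul_sum, ← Finset.sum_add_distrib]
  refine Finset.sum_congr rfl fun a _ => ?_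
  rw [map_smul, map_sum]
  have h1 : ∀ b, inn (e a) (eps (cov s (e b)) (eps (innDerOmega s J K (X a) (e b)) η))
      = ((if b = a then 1 else 0 : ℝ) : ℂ) • eps (innDerOmega s J K (X a) (e b)) η
        + eps (innDerOmega s J K (X a) (e a) (e b) • cov s (e b)) η
        + eps (cov s (e b)) (eps (innDerOmega s J K (X a) (e b)) (inn (e a) η)) := by
    intro b
    rw [inn_eps, inn_eps, q.innDerOmega_antisymm _ (e a), cov_apply, h.orth]
    simp only [map_sub, map_smul, LinearMap.smul_apply, neg_smul]
    abel
  have h2 : ∑ b, ((if b = a then 1 else 0 : ℝ) : ℂ) • eps (innDerOmega s J K (X a) (e b)) η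
      = eps (innDerOmega s J K (X a) (e a)) η := by
    rw [Finset.sum_eq_single a]
    · simp
    · intro b _ hb; simp [hb]
    · simp
  simp only [h1, Finset.sum_add_distrib, h2]
  rw [← LinearMap.sum_apply, ← map_sum, h.covector_expand, smul_add, smul_add, half_smul_add_half]

variable (s e) in
/-- The operator `∑ e^a ∧ e^c ∧ ι_{B(e_a, e_c)}`. -/
def wedgeInn (B : V → V → V) (η : Ext V) : Ext V :=
  ∑ a, ∑ c, eps (cov s (e a)) (eps (cov s (e c)) (inn (B (e a) (e c)) η))

lemma wedgeInn_congr {B B' : V → V → V} {η : Ext V}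
    (h : ∀ u v, inn (B u v) η = inn (B' u v) η) : wedgeInn s e B η = wedgeInn s e B' η := by
  simp only [wedgeInn, h]

lemma wedgeInn_add (B B' : V → V → V) (η : Ext V) :
    wedgeInn s e (fun u v => B u v + B' u v) η = wedgeInn s e B η + wedgeInn s e B' η := by
  simp only [wedgeInn, map_add, LinearMap.add_apply, Finset.sum_add_distrib]

lemma wedgeInn_neg (B : V → V → V) (η : Ext V) :
    wedgeInn s e (fun u v => -B u v) η = -wedgeInn s e B η := by
  simp only [wedgeInn, map_neg, LinearMap.neg_apply, Finset.sum_neg_distrib]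

lemma wedgeInn_swap (B : V → V → V) (η : Ext V) :
    wedgeInn s e (fun u v => B v u) η = -wedgeInn s e B η := by
  rw [wedgeInn, Finset.sum_comm, wedgeInn, ← Finset.sum_neg_distrib]
  refine Finset.sum_congr rfl fun a _ => ?_
  rw [← Finset.sum_neg_distrib]
  refine Finset.sum_congr rfl fun c _ => ?_
  rw [eps_eps]

lemma StarZero.wedgeInn_I (h : IsONB s e) (hI : ∀ v, I (I v) = -v) {η : Ext V}
    (hη : StarZero I η) (B : V → V → V) :
    wedgeInn s e (fun u v => I (B u v)) η = Complex.I • wedgeInn s e B η := by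
  simp only [wedgeInn, hη.inn_I h hI, map_smul, Finset.smul_sum]

/-- After expanding the derivation in the frame, both endomorphisms are moved from the covector to
the vector index. -/
lemma IsONB.sum_eps_comp_der (h : IsONB s e) (Y : V →L[ℝ] V) (T : V →ₗ[ℝ] V →L[ℝ] V) (η : Ext V) :
    ∑ a, eps ((cov s (e a)).comp Y) (der (T (e a)) η)
      = wedgeInn s e (fun u v => T (Y u) v) η := by
  have h1 := h.sum_comp Y ((((der : _ →ₗ[ℝ] Module.End ℂ (Ext V)).flip η)) ∘ₗ T)
  simp only [LinearMap.comp_apply, LinearMap.flip_apply] at h1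
  rw [h1, wedgeInn]
  refine Finset.sum_congr rfl fun a _ => ?_
  rw [h.der_expand, map_sum]
  have h2 := h.sum_comp (T (Y (e a))) ((inn : V →ₗ[ℝ] _).flip η)
  simp only [LinearMap.flip_apply] at h2
  rw [← map_sum, h2, map_sum]

/-- Skewness of the torsion moves `a` out of `T` into a slot of the metric. This makes the
expression a coefficient along `e_a`, so that the sum against `ι_{e_a}` can be carried out in
`IsONB.sum_innDerOmega`. -/
lemma QuatHerm.innDerOmega_torsion (q : QuatHerm s I J K) {T : V →L[ℝ] V →L[ℝ] V}
    (hT : IsSkewTorsion s T) (a b c : V) : innDerOmega s J K (T a) b c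
      = (1 / 2 : ℂ) * (s a (T b (J c)) + s a (T (J b) c)
        + Complex.I * (s a (T b (K c)) + s a (T (K b) c))) := by
  have h1 : s (T a b) (J c) = s a (T b (J c)) := by rw [hT.cyc, q.symm]
  have h2 : s (T a b) (K c) = s a (T b (K c)) := by rw [hT.cyc, q.symm]
  have h3 : s b (J (T a c)) = s a (T (J b) c) := by
    rw [← neg_eq_iff_eq_neg.mpr (q.skew_J b (T a c)), q.symm, hT.skew, neg_neg, hT.cyc, q.symm]
  have h4 : s b (K (T a c)) = s a (T (K b) c) := by
    rw [← neg_eq_iff_eq_neg.mpr (q.skew_K b (T a c)), q.symm, hT.skew, neg_neg, hT.cyc, q.symm]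
  simp only [innDerOmega, _root_.add_apply, ContinuousLinearMap.comp_apply, innOmega_apply,
    h1, h2, h3, h4]
  ring

/-- Summation over `a` reassembles contractions with `T(e_b, J e_c)`, `T(J e_b, e_c)` and their
analogues for `K`. Antisymmetry of both `T` and the wedge identifies the first kind with the second,
which absorbs the factor `1 / 2`. -/
lemma IsONB.sum_innDerOmega (q : QuatHerm s I J K) (h : IsONB s e) {T : V →L[ℝ] V →L[ℝ] V}
    (hT : IsSkewTorsion s T) (η : Ext V) :
    ∑ a, ∑ b, eps (cov s (e b)) (eps (innDerOmega s J K (T (e a)) (e b)) (inn (e a) η))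
      = wedgeInn s e (fun u v => T (J u) v) η
        + Complex.I • wedgeInn s e (fun u v => T (K u) v) η := by
  have h1 : ∀ a b, eps (innDerOmega s J K (T (e a)) (e b)) (inn (e a) η)
      = ∑ c, eps (cov s (e c)) (innDerOmega s J K (T (e a)) (e b) (e c) • inn (e a) η) := by
    intro a b
    conv_lhs => rw [← h.covector_expand (innDerOmega s J K (T (e a)) (e b))]
    simp only [map_sum, map_smul, LinearMap.sum_apply, LinearMap.smul_apply]
  have h2 : ∀ b c, ∑ a, innDerOmega s J K (T (e a)) (e b) (e c) • inn (e a) η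
      = (1 / 2 : ℂ) • (inn (T (e b) (J (e c))) η + inn (T (J (e b)) (e c)) η
        + Complex.I • (inn (T (e b) (K (e c))) η + inn (T (K (e b)) (e c)) η)) := by
    intro b c
    have h3 := fun v => h.sum_apply' ((inn : V →ₗ[ℝ] _).flip η) v
    simp only [LinearMap.flip_apply] at h3
    simp only [← h3 (T _ _)]
    rw [← Finset.sum_add_distrib, ← Finset.sum_add_distrib, Finset.smul_sum,
      ← Finset.sum_add_distrib, Finset.smul_sum]
    refine Finset.sum_congr rfl fun a _ => ?_
    rw [q.innDerOmega_torsion hT]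
    simp only [smul_smul, ← add_smul]
  have h4 : ∀ L : V → V, wedgeInn s e (fun u v => T u (L v)) η
      = wedgeInn s e (fun u v => T (L u) v) η := by
    intro L
    have := wedgeInn_swap (s := s) (e := e) (fun u v => T (L u) v) η
    rw [← neg_eq_iff_eq_neg, ← wedgeInn_neg] at this
    rw [← this]
    exact wedgeInn_congr fun u v => by rw [hT.anti]
  rw [Finset.sum_comm]
  have h5 : ∀ b, ∑ a, eps (cov s (e b)) (eps (innDerOmega s J K (T (e a)) (e b)) (inn (e a) η))
      = ∑ c, eps (cov s (e b)) (eps (cov s (e c))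
        ((1 / 2 : ℂ) • (inn (T (e b) (J (e c))) η + inn (T (J (e b)) (e c)) η
        + Complex.I • (inn (T (e b) (K (e c))) η + inn (T (K (e b)) (e c)) η)))) := by
    intro b
    simp only [h1, map_sum]
    rw [Finset.sum_comm]
    refine Finset.sum_congr rfl fun c _ => ?_
    rw [← h2, map_sum, map_sum]
  rw [Finset.sum_congr rfl fun b _ => h5 b]
  simp only [map_smul, map_add, smul_add, Finset.sum_add_distrib, ← Finset.smul_sum]
  change (1 / 2 : ℂ) • wedgeInn s e (fun u v => T u (J v)) η +
    (1 / 2 : ℂ) • wedgeInn s e (fun u v => T (J u) v) η +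
    ((1 / 2 : ℂ) • Complex.I • wedgeInn s e (fun u v => T u (K v)) η +
    (1 / 2 : ℂ) • Complex.I • wedgeInn s e (fun u v => T (K u) v) η) = _
  rw [h4, h4]
  funext k
  ext v
  simp
  ring

end Torsion

end HKT

namespace HKT

/-! ### The algebraic identities satisfied by the torsion -/

section Identity

variable {V : Type*} [NormedAddCommGroup V] [NormedSpace ℝ V]

lemma ext_ext {η ζ : Ext V} (h : ∀ k (v : Fin k → V), η k v = ζ k v) : η = ζ := by
  funext k; ext v; exact h k v

lemma ext_two_smul (η : Ext V) : (2 : ℂ) • η = η + η := by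
  refine ext_ext fun k v => ?_
  simp; ring

lemma ext_congr {η ζ : Ext V} (h : η = ζ) (k : ℕ) (v : Fin k → V) : η k v = ζ k v := by rw [h]

variable
  {N : ℕ} {s : V →L[ℝ] V →L[ℝ] ℝ} {e : Fin N → V} {I J K : V →L[ℝ] V}

lemma IsONB.sum_part10_I (h : IsONB s e) (hI : ∀ v, I (I v) = -v) (F : V →ₗ[ℝ] Ext V) :
    ∑ a, eps (part10 I (cov s (e a))) (F (I (e a)))
      = Complex.I • ∑ a, eps (part10 I (cov s (e a))) (F (e a)) := by
  have h1 := h.sum_comp I F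
  have h2 := h.sum_comp I (F ∘ₗ (I : V →ₗ[ℝ] V))
  simp only [LinearMap.comp_apply, ContinuousLinearMap.coe_coe, hI, map_neg,
    Finset.sum_neg_distrib] at h2
  simp only [part10_eq, map_sub, map_smul, LinearMap.sub_apply, LinearMap.smul_apply,
    Finset.sum_sub_distrib, ← Finset.smul_sum, h1, h2]
  generalize ∑ a, eps (cov s (e a)) (F (I (e a))) = A
  generalize ∑ a, eps (cov s (e a)) (F (e a)) = B
  refine ext_ext fun k v => ?_
  simp
  linear_combination (1 / 2 : ℂ) * A k v * Complex.I_mul_I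

/-- After projection only `(1,0)`-covectors remain, and then putting `I` into either slot of `B`
multiplies the sum by `i`. The hypothesis makes the two results opposite, so the sum is its own
negative. -/
lemma IsONB.proj0_wedgeInn_eq_zero (h : IsONB s e) (hI : ∀ v, I (I v) = -v) {η : Ext V}
    (hη : StarZero I η) (B : V →ₗ[ℝ] V →ₗ[ℝ] V) (hB : ∀ u v, B (I u) v = -B u (I v)) :
    proj0 I (wedgeInn s e (fun u v => B u v) η) = 0 := by
  set X := ∑ a, ∑ c, eps (part10 I (cov s (e a))) (eps (part10 I (cov s (e c)))
    (inn (B (e a) (e c)) η)) with hX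
  have h1 : proj0 I (wedgeInn s e (fun u v => B u v) η) = X := by
    simp only [wedgeInn, map_sum, proj0_eps h hI, (hη.inn h hI _).proj0, hX]
  have h2 : ∑ a, ∑ c, eps (part10 I (cov s (e a))) (eps (part10 I (cov s (e c)))
      (inn (B (I (e a)) (e c)) η)) = Complex.I • X := by
    let F : V →ₗ[ℝ] Ext V := ∑ c, ((eps (part10 I (cov s (e c)))).restrictScalars ℝ ∘ₗ
      (inn : V →ₗ[ℝ] _).flip η ∘ₗ B.flip (e c))
    have := h.sum_part10_I hI F
    simp only [F, LinearMap.sum_apply, LinearMap.comp_apply, LinearMap.restrictScalars_apply,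
      LinearMap.flip_apply, map_sum] at this
    exact this
  have h3 : ∑ a, ∑ c, eps (part10 I (cov s (e a))) (eps (part10 I (cov s (e c)))
      (inn (B (e a) (I (e c))) η)) = Complex.I • X := by
    rw [hX, Finset.smul_sum]
    refine Finset.sum_congr rfl fun a _ => ?_
    have := h.sum_part10_I hI ((inn : V →ₗ[ℝ] _).flip η ∘ₗ B (e a))
    simp only [LinearMap.comp_apply, LinearMap.flip_apply] at this
    rw [← map_sum, this, map_smul, map_sum]
  have h4 : Complex.I • X = -(Complex.I • X) := by
    rw [← h3]
    nth_rw 1 [h3]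
    rw [← h2]
    simp only [hB, map_neg, LinearMap.neg_apply, Finset.sum_neg_distrib]
  rw [h1]
  refine ext_ext fun k v => ?_
  have h5 := ext_congr h4 k v
  simp at h5 ⊢
  exact self_eq_neg.mp (mul_left_cancel₀ Complex.I_ne_zero (by linear_combination h5))

lemma wedgeInn_swap_torsion {T : V →L[ℝ] V →L[ℝ] V} (hT : IsSkewTorsion s T) (L : V → V)
    (η : Ext V) : wedgeInn s e (fun u v => T u (L v)) η = wedgeInn s e (fun u v => T (L u) v) η := by
  have := wedgeInn_swap (s := s) (e := e) (fun u v => T (L u) v) η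
  rw [← neg_eq_iff_eq_neg, ← wedgeInn_neg] at this
  rw [← this]
  exact wedgeInn_congr fun u v => by rw [hT.anti]

/-- The quadratic part of the identity vanishes. -/
lemma QuatHerm.proj0_quadratic (q : QuatHerm s I J K) (h : IsONB s e) {T : V →L[ℝ] V →L[ℝ] V}
    (hT : IsSkewTorsion s T) (hJ : TorsionIntegrable T J) (hK : TorsionIntegrable T K)
    {η : Ext V} (hη : StarZero I η) :
    proj0 I (wedgeInn s e (fun u v => T (J u) v) η
      + Complex.I • wedgeInn s e (fun u v => T (K u) v) η
      + wedgeInn s e (fun u v => J (T (J u) (J v))) η) = 0 := by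
  -- In the notation below, integrability of `J` and `K` reduces the expression to `½ (c + d)`,
  -- whose bilinear map this is. It satisfies the sign condition because right multiplication by `I`
  -- exchanges `J` and `K` up to sign.
  let B : V →ₗ[ℝ] V →ₗ[ℝ] V := LinearMap.mk₂ ℝ (fun u v => J (T (J u) (J v)) + J (T (K u) (K v)))
    (by intros; simp; abel) (by intros; simp) (by intros; simp; abel) (by intros; simp)
  have hB : ∀ u v, B u v = J (T (J u) (J v)) + J (T (K u) (K v)) := fun u v => rfl
  have h0 := h.proj0_wedgeInn_eq_zero q.I_sq hη B (fun u v => by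
    simp only [hB, q.J_I, q.K_I, map_neg, _root_.neg_apply]; abel)
  simp only [hB, wedgeInn_add] at h0
  have h1 : (2 : ℂ) • wedgeInn s e (fun u v => T (J u) v) η
      = wedgeInn s e (fun u v => J (T u v)) η - wedgeInn s e (fun u v => J (T (J u) (J v))) η := by
    rw [ext_two_smul]
    nth_rw 2 [← wedgeInn_swap_torsion hT]
    rw [← wedgeInn_add, sub_eq_add_neg, ← wedgeInn_neg, ← wedgeInn_add]
    refine wedgeInn_congr fun u v => ?_
    congr 2
    rw [hJ u v]
    simp only [map_sub, q.J_sq]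
    abel
  have h2 : (2 : ℂ) • wedgeInn s e (fun u v => T (K u) v) η
      = Complex.I • (wedgeInn s e (fun u v => J (T u v)) η
        - wedgeInn s e (fun u v => J (T (K u) (K v))) η) := by
    rw [smul_sub, ← hη.wedgeInn_I h q.I_sq, ← hη.wedgeInn_I h q.I_sq]
    rw [ext_two_smul]
    nth_rw 2 [← wedgeInn_swap_torsion hT]
    rw [← wedgeInn_add, sub_eq_add_neg, ← wedgeInn_neg, ← wedgeInn_add]
    refine wedgeInn_congr fun u v => ?_
    congr 2
    simp only [q.I_J]
    rw [hK u v]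
    simp only [map_sub, q.K_sq]
    abel
  set a := wedgeInn s e (fun u v => T (J u) v) η
  set b := wedgeInn s e (fun u v => T (K u) v) η
  set c := wedgeInn s e (fun u v => J (T (J u) (J v))) η
  set d := wedgeInn s e (fun u v => J (T (K u) (K v))) η
  set f := wedgeInn s e (fun u v => J (T u v)) η
  -- Substitute `2a = f - c` and `2b = i (f - d)`: as `i · i = -1`, the terms `f` cancel.
  have h3 : a + Complex.I • b + c = (1 / 2 : ℂ) • (c + d) := by
    refine ext_ext fun k v => ?_
    have h1' := ext_congr h1 k v
    have h2' := ext_congr h2 k v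
    simp at h1' h2' ⊢
    linear_combination (1 / 2 : ℂ) * h1' + Complex.I / 2 * h2' +
      (1 / 2 : ℂ) * (f k v - d k v) * Complex.I_mul_I
  rw [h3, map_smul, h0]
  exact smul_zero_ext _

/-- The vector dual to `v ↦ ½ ∑ s(T(v, e_a), L e_a)`. -/
def leeVec (e : Fin N → V) (T : V →L[ℝ] V →L[ℝ] V) (L : V →L[ℝ] V) : V :=
  (1 / 2 : ℝ) • ∑ a, T (e a) (L (e a))

lemma cov_leeVec {T : V →L[ℝ] V →L[ℝ] V} (hT : IsSkewTorsion s T) (L : V →L[ℝ] V) (v : V) :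
    s (leeVec e T L) v = (1 / 2 : ℝ) * ∑ a, s (T v (e a)) (L (e a)) := by
  rw [leeVec, map_smul, _root_.smul_apply, map_sum, _root_.sum_apply, smul_eq_mul]
  congr 1
  refine Finset.sum_congr rfl fun a _ => ?_
  rw [hT.cyc v]

/-- With `b = a` the terms `s(a, T(a, ·))` vanish by skewness; what survives are the sums defining
the Lee vectors of `J` and `K`. -/
lemma QuatHerm.sum_innDerOmega_self (q : QuatHerm s I J K) {T : V →L[ℝ] V →L[ℝ] V}
    (hT : IsSkewTorsion s T) : ∑ a, innDerOmega s J K (T (e a)) (e a)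
      = cov s (leeVec e T J) + Complex.I • cov s (leeVec e T K) := by
  ext v
  rw [_root_.sum_apply, _root_.add_apply, _root_.smul_apply, cov_apply, cov_apply, cov_leeVec hT,
    cov_leeVec hT]
  have h1 : ∀ a w, s a (T a w) = 0 := by
    intro a w
    rw [q.symm, hT.skew]
    have h1 := hT.skew a a w
    have h2 : s (T a a) w = -s (T a a) w := by
      conv_lhs => rw [hT.anti]
      simp
    have h3 : s (T a a) w = 0 := by linarith
    rw [h3, neg_zero]
  have h2 : ∀ a (L : V →L[ℝ] V) , s a (T (L a) v) = s (T v a) (L a) := by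
    intro a L
    rw [hT.cyc v, hT.cyc a, q.symm]
  simp only [q.innDerOmega_torsion hT, h1, h2]
  push_cast
  simp only [Finset.mul_sum, smul_eq_mul, ← Finset.sum_add_distrib]
  refine Finset.sum_congr rfl fun a _ => ?_
  ring

/-- The image of an orthonormal basis under the orthogonal map `L` is orthonormal, and the trace of
a bilinear form does not depend on the basis. -/
lemma IsONB.sum_bilin_comp (h : IsONB s e) {L : V →L[ℝ] V} (hL : ∀ v, L (L v) = -v)
    (hs : ∀ u v, s (L u) v = -s u (L v)) (B : V →ₗ[ℝ] V →ₗ[ℝ] ℝ) :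
    ∑ a, B (L (e a)) (L (e a)) = ∑ a, B (e a) (e a) := by
  have h1 : ∀ a, B (L (e a)) (L (e a)) = ∑ c, s (e c) (L (e a)) * B (e c) (L (e a)) := by
    intro a
    have := h.sum_apply (B.flip (L (e a))) (L (e a))
    simp only [LinearMap.flip_apply, smul_eq_mul] at this
    exact this.symm
  simp only [h1]
  rw [Finset.sum_comm]
  refine Finset.sum_congr rfl fun c _ => ?_
  have h2 := h.sum_apply (B (e c) ∘ₗ (L : V →ₗ[ℝ] V)) (L (e c))
  simp only [LinearMap.comp_apply, ContinuousLinearMap.coe_coe, hL, map_neg, smul_eq_mul] at h2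
  rw [← neg_eq_iff_eq_neg] at h2
  rw [← h2, ← Finset.sum_neg_distrib]
  refine Finset.sum_congr rfl fun a _ => ?_
  rw [← neg_mul, h.symm (e a), hs, neg_neg]

/-- Pair the integrability of `I` at `(x, e_a)` with `J e_a` and sum. By invariance of traces under
`I`, the three terms on the right are two copies of the right-hand sum and minus the left-hand sum,
so twice one sum equals twice the other. -/
lemma QuatHerm.leeVec_J (q : QuatHerm s I J K) (h : IsONB s e) {T : V →L[ℝ] V →L[ℝ] V}
    (hT : IsSkewTorsion s T) (hI : TorsionIntegrable T I) (x : V) :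
    s (leeVec e T J) x = s (leeVec e T K) (I x) := by
  rw [cov_leeVec hT, cov_leeVec hT]
  congr 1
  let B (y : V) (L : V →L[ℝ] V) : V →ₗ[ℝ] V →ₗ[ℝ] ℝ := LinearMap.mk₂ ℝ (fun u v => s (T y u) (L v))
    (by intros; simp) (by intros; simp) (by intros; simp) (by intros; simp)
  have hB : ∀ y L u v, B y L u v = s (T y u) (L v) := fun _ _ _ _ => rfl
  have h1 := h.sum_bilin_comp q.I_sq q.skew_I (B (I x) K)
  have h2 := h.sum_bilin_comp q.I_sq q.skew_I (B x J)
  simp only [hB, q.K_I, q.J_I, map_neg, Finset.sum_neg_distrib] at h1 h2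
  have h3 : ∀ a, s (T x a) (J a) = s (T (I x) (I a)) (J a) + s (T (I x) a) (K a)
      + s (T x (I a)) (K a) := by
    intro a
    rw [hI x a]
    simp only [map_sub, _root_.sub_apply, q.skew_I, q.I_J]
    ring
  have h4 := Finset.sum_congr rfl fun a (_ : a ∈ Finset.univ) => h3 (e a)
  simp only [Finset.sum_add_distrib] at h4
  linarith

lemma QuatHerm.leeVec_K (q : QuatHerm s I J K) (h : IsONB s e) {T : V →L[ℝ] V →L[ℝ] V}
    (hT : IsSkewTorsion s T) (hJ : TorsionIntegrable T J) (x : V) :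
    s (leeVec e T K) x = s (leeVec e T I) (J x) := by
  rw [cov_leeVec hT, cov_leeVec hT]
  congr 1
  let B (y : V) (L : V →L[ℝ] V) : V →ₗ[ℝ] V →ₗ[ℝ] ℝ := LinearMap.mk₂ ℝ (fun u v => s (T y u) (L v))
    (by intros; simp) (by intros; simp) (by intros; simp) (by intros; simp)
  have hB : ∀ y L u v, B y L u v = s (T y u) (L v) := fun _ _ _ _ => rfl
  have h1 := h.sum_bilin_comp q.J_sq q.skew_J (B (J x) I)
  have h2 := h.sum_bilin_comp q.J_sq q.skew_J (B x K)
  simp only [hB, q.I_J, q.K_J, map_neg, Finset.sum_neg_distrib] at h1 h2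
  have h3 : ∀ a, s (T x a) (K a) = s (T (J x) (J a)) (K a) + s (T (J x) a) (I a)
      + s (T x (J a)) (I a) := by
    intro a
    rw [hJ x a]
    simp only [map_sub, _root_.sub_apply, q.skew_J, q.J_K]
    ring
  have h4 := Finset.sum_congr rfl fun a (_ : a ∈ Finset.univ) => h3 (e a)
  simp only [Finset.sum_add_distrib] at h4
  linarith

end Identity

end HKT

namespace HKT

/-! ### The pointwise form of the theorem -/

section Identity

variable {V : Type*} [NormedAddCommGroup V] [NormedSpace ℝ V]
  {N : ℕ} {s : V →L[ℝ] V →L[ℝ] ℝ} {e : Fin N → V} {I J K : V →L[ℝ] V}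

/-- The symbols of `∂_J` and of `[Ω ∧, ∂^*]` agree up to sign because of this relation. -/
lemma QuatHerm.part10_comp_J (q : QuatHerm s I J K) (v : V) :
    part10 I ((cov s v).comp (-J)) = -innOmega s J K v := by
  ext w
  rw [part10_apply, _root_.neg_apply, innOmega_apply]
  simp [q.J_I]
  ring

lemma QuatHerm.part10_innOmega (q : QuatHerm s I J K) (v : V) :
    part10 I (innOmega s J K v) = innOmega s J K v := by
  ext w
  rw [part10_apply, innOmega_apply, innOmega_apply, q.J_I, q.K_I]
  simp
  linear_combination (-(1 / 2 : ℂ) * s v (J w)) * Complex.I_mul_I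

lemma QuatHerm.innOmega_I (q : QuatHerm s I J K) (v : V) :
    innOmega s J K (I v) = Complex.I • innOmega s J K v := by
  ext w
  rw [_root_.smul_apply, innOmega_apply, innOmega_apply, q.skew_I, q.skew_I, q.I_J, q.I_K]
  simp
  linear_combination (-(1 / 2 : ℂ) * s v (K w)) * Complex.I_mul_I

/-- `Ω` is of type `(2,0)`: its contractions are `(1,0)`-covectors depending complex linearly on the
vector, so replacing `e^b` by its `(1,0)`-part does not change the sum. -/
lemma QuatHerm.proj0_mulOmega (q : QuatHerm s I J K) (h : IsONB s e) (η : Ext V) :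
    proj0 I (mulOmega s e J K η) = mulOmega s e J K (proj0 I η) := by
  rw [mulOmega_apply, mulOmega_apply, map_smul, map_sum]
  simp only [proj0_eps h q.I_sq, q.part10_innOmega]
  have h1 := h.sum_comp I ((((eps : _ →ₗ[ℂ] Module.End ℂ (Ext V)).flip
    (proj0 I η)).restrictScalars ℝ) ∘ₗ innOmega s J K)
  simp only [LinearMap.comp_apply, LinearMap.restrictScalars_apply, LinearMap.flip_apply,
    q.innOmega_I, map_smul, ← Finset.smul_sum] at h1
  simp only [part10_eq, map_sub, map_smul, LinearMap.sub_apply, LinearMap.smul_apply,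
    Finset.sum_sub_distrib, ← Finset.smul_sum, h1]
  generalize ∑ b, eps (cov s (e b)) (eps (innOmega s J K (e b)) (proj0 I η)) = A
  refine ext_ext fun k v => ?_
  simp
  linear_combination (-(1 / 2) : ℂ) * A k v * Complex.I_mul_I

/-- The `(1,0)`-form of the identity for `δ_J^* - ∂_J`. -/
def thetaJ (s : V →L[ℝ] V →L[ℝ] ℝ) (e : Fin N → V) (T : V →L[ℝ] V →L[ℝ] V) (I J K : V →L[ℝ] V) :
    V →L[ℝ] ℂ :=
  part10 I (-(1 / 2 : ℂ) • (cov s (leeVec e T J) + Complex.I • cov s (leeVec e T K)))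

/-- The `(0,1)`-form with `∂̄(Ω^n) = θ̄ ∧ Ω^n`. -/
def thetaBar (s : V →L[ℝ] V →L[ℝ] ℝ) (e : Fin N → V) (T : V →L[ℝ] V →L[ℝ] V) (I : V →L[ℝ] V) :
    V →L[ℝ] ℂ := part01 I (Complex.I • cov s (leeVec e T I))

/-- Through `leeVec_J` and `leeVec_K` all three Lee covectors are expressed by that of `I`; the two
formulas then agree by quaternion arithmetic. -/
lemma QuatHerm.thetaJ_eq (q : QuatHerm s I J K) (h : IsONB s e) {T : V →L[ℝ] V →L[ℝ] V}
    (hT : IsSkewTorsion s T) (hI : TorsionIntegrable T I) (hJ : TorsionIntegrable T J) :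
    thetaJ s e T I J K = (thetaBar s e T I).comp (-J) := by
  ext w
  have hK' := q.leeVec_K h hT hJ
  have hJ' := q.leeVec_J h hT hI
  simp only [thetaJ, thetaBar, part10_apply, part01_apply, ContinuousLinearMap.comp_apply,
    _root_.smul_apply, _root_.add_apply, cov_apply, hJ', hK', q.J_I, q.I_J, q.I_sq, _root_.neg_apply,
    map_neg, smul_eq_mul]
  push_cast
  linear_combination (1 / 4 : ℂ) * s (leeVec e T I) (K w) * Complex.I_mul_I

/-- Here `ψ a` stands for the covariant derivative along `e_a`. It may be arbitrary because the
terms containing it cancel identically; only torsion terms contribute to the right-hand side. -/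
theorem QuatHerm.identity (q : QuatHerm s I J K) (h : IsONB s e) {T : V →L[ℝ] V →L[ℝ] V}
    (hT : IsSkewTorsion s T) (hJ : TorsionIntegrable T J) (hK : TorsionIntegrable T K)
    {η : Ext V} (hη : StarZero I η) (ψ : Fin N → Ext V) :
    mulOmega s e J K (proj0 I (∑ a, inn (e a) (ψ a + (1 / 2 : ℂ) • der (T (e a)) η)))
      - proj0 I (∑ a, inn (e a) (mulOmega s e J K (ψ a)
        + (1 / 2 : ℂ) • der (T (e a)) (mulOmega s e J K η)))
      - proj0 I (∑ a, eps ((cov s (e a)).comp (-J)) (ψ a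
        + (1 / 2 : ℂ) • der (J.comp ((T (e a)).comp (-J))) η))
      = eps (thetaJ s e T I J K) η := by
  set m := mulOmega s e J K with hm
  -- All torsion terms other than the linear one are brought to the form `wedgeInn`, to match
  -- `proj0_quadratic`.
  have hW1 : ∑ a, eps (innOmega s J K (e a)) (der (T (e a)) η)
      = (1 / 2 : ℂ) • (wedgeInn s e (fun u v => T (J u) v) η
        + Complex.I • wedgeInn s e (fun u v => T (K u) v) η) := by
    have h1 := h.sum_eps_comp_der J T η
    have h2 := h.sum_eps_comp_der K T η
    simp only [ContinuousLinearMap.coe_coe] at h1 h2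
    rw [← h1, ← h2, Finset.smul_sum, ← Finset.sum_add_distrib, Finset.smul_sum]
    refine Finset.sum_congr rfl fun a _ => ?_
    rw [← LinearMap.smul_apply, ← map_smul, ← LinearMap.add_apply, ← map_add, ← LinearMap.smul_apply,
      ← map_smul]
    rfl
  have hW2 : ∑ a, eps ((cov s (e a)).comp (-J)) (der (J.comp ((T (e a)).comp (-J))) η)
      = wedgeInn s e (fun u v => J (T (J u) (J v))) η := by
    let T' : V →ₗ[ℝ] V →L[ℝ] V :=
      { toFun := fun u => J.comp ((T u).comp (-J))
        map_add' := fun u v => by ext w; simp [add_comm]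
        map_smul' := fun c u => by ext w; simp }
    have h1 := h.sum_eps_comp_der (-J) T' η
    refine h1.trans (wedgeInn_congr fun u v => ?_)
    simp [T']
  have hS : ∑ a, inn (e a) (der (T (e a)) (m η)) = ∑ a, m (inn (e a) (der (T (e a)) η))
      + ∑ a, eps (innOmega s J K (e a)) (der (T (e a)) η)
      + ∑ a, inn (e a) ((1 / 2 : ℂ) • ∑ b, eps (cov s (e b))
        (eps (innDerOmega s J K (T (e a)) (e b)) η)) := by
    rw [← Finset.sum_add_distrib, ← Finset.sum_add_distrib]
    refine Finset.sum_congr rfl fun a _ => ?_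
    rw [hm, h.der_mulOmega, map_add, q.inn_mulOmega h]
    abel
  rw [hW1, h.sum_inn_eps_eps q, h.sum_innDerOmega q hT] at hS
  -- The commutator of `Ω ∧` with `ι_a` leaves `-ι_a Ω ∧ ψ a`, which is exactly the projected `J e^a
  -- ∧ ψ a`.
  have hψ : proj0 I (∑ a, m (inn (e a) (ψ a)) - ∑ a, inn (e a) (m (ψ a))
      - ∑ a, eps ((cov s (e a)).comp (-J)) (ψ a)) = 0 := by
    rw [← Finset.sum_sub_distrib, ← Finset.sum_sub_distrib, map_sum]
    refine Finset.sum_eq_zero fun a _ => ?_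
    rw [hm, q.inn_mulOmega h, map_sub, map_sub, map_add, proj0_eps h q.I_sq, proj0_eps h q.I_sq,
      q.part10_comp_J, q.part10_innOmega, map_neg, LinearMap.neg_apply]
    abel
  have hq := q.proj0_quadratic h hT hJ hK hη
  have hlin : proj0 I (∑ a, eps (innDerOmega s J K (T (e a)) (e a)) η)
      = eps (part10 I (cov s (leeVec e T J) + Complex.I • cov s (leeVec e T K))) η := by
    rw [← LinearMap.sum_apply, ← map_sum, q.sum_innDerOmega_self hT, proj0_eps h q.I_sq, hη.proj0]
  rw [← q.proj0_mulOmega h, ← hm]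
  simp only [map_add, map_sum, map_smul, Finset.sum_add_distrib, ← Finset.smul_sum]
  simp only [← map_sum]
  rw [hS, hW2]
  rw [thetaJ, map_smul, map_smul, LinearMap.smul_apply, ← hlin]
  simp only [map_sub, map_add, map_smul, map_sum] at hψ hq ⊢
  generalize ∑ x, proj0 I (m (inn (e x) (ψ x))) = A at hψ ⊢
  generalize ∑ x, proj0 I (inn (e x) (m (ψ x))) = B at hψ ⊢
  generalize ∑ x, proj0 I (eps ((cov s (e x)).comp (-J)) (ψ x)) = C at hψ ⊢
  generalize ∑ x, proj0 I (m (inn (e x) (der (T (e x)) η))) = D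
  generalize ∑ x, proj0 I (eps (innDerOmega s J K (T (e x)) (e x)) η) = E
  generalize proj0 I (wedgeInn s e (fun u v => T (J u) v) η) = P at hq ⊢
  generalize proj0 I (wedgeInn s e (fun u v => T (K u) v) η) = Q at hq ⊢
  generalize proj0 I (wedgeInn s e (fun u v => J (T (J u) (J v))) η) = R at hq ⊢
  refine ext_ext fun k v => ?_
  have h1 := ext_congr hψ k v
  have h2 := ext_congr hq k v
  simp at h1 h2 ⊢
  linear_combination h1 - (1 / 2 : ℂ) * h2

end Identity

end HKT

namespace HKT

/-! ### Powers of `Ω`, and `∂̄ Ω^n` at a point -/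

section OmegaPow

variable {V : Type*} [NormedAddCommGroup V] [NormedSpace ℝ V]
  {N : ℕ} {s : V →L[ℝ] V →L[ℝ] ℝ} {e : Fin N → V} {I J K : V →L[ℝ] V}

lemma IsONB.wedgePow_omega (h : IsONB s e) {ϖ : V [⋀^Fin 2]→L[ℝ] ℂ}
    (hϖ : ∀ v, ϖ v = (1 / 2 : ℂ) * (s (v 0) (J (v 1)) + Complex.I * s (v 0) (K (v 1)))) (m : ℕ) :
    wedgePow (ofDegree ϖ) m = (mulOmega s e J K ^ m) one := by
  induction m with
  | zero => rfl
  | succ m ih => rw [wedgePow, ih, h.wedge_omega hϖ, pow_succ', Module.End.mul_apply]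

lemma QuatHerm.starZero_mulOmega (q : QuatHerm s I J K) (h : IsONB s e) {η : Ext V}
    (hη : StarZero I η) : StarZero I (mulOmega s e J K η) := by
  have := StarZero.of_proj0 h q.I_sq (mulOmega s e J K η)
  rwa [q.proj0_mulOmega h, hη.proj0] at this

lemma QuatHerm.starZero_omegaPow (q : QuatHerm s I J K) (h : IsONB s e) (m : ℕ) :
    StarZero I ((mulOmega s e J K ^ m) one) := by
  induction m with
  | zero => exact StarZero.one
  | succ m ih => rw [pow_succ', Module.End.mul_apply]; exact q.starZero_mulOmega h ih

lemma mulOmega_deg (η : Ext V) {k : ℕ} (hη : η k = 0) : mulOmega s e J K η (k + 2) = 0 := by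
  rw [mulOmega_apply, Pi.smul_apply, Finset.sum_apply, Finset.sum_eq_zero, smul_zero_form]
  intro b _
  have h1 : eps (innOmega s J K (e b)) η (k + 1) = 0 := by
    rw [eps_congr (ζ := 0) (by rw [hη]; rfl), map_zero]; rfl
  rw [eps_congr (ζ := 0) (by rw [h1]; rfl), map_zero]; rfl

lemma omegaPow_deg (m : ℕ) {k : ℕ} (hk : k ≠ 2 * m) : (mulOmega s e J K ^ m) one k = 0 := by
  induction m generalizing k with
  | zero =>
    obtain ⟨k, rfl⟩ := Nat.exists_eq_succ_of_ne_zero (by simpa using hk)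
    rfl
  | succ m ih =>
    rw [pow_succ', Module.End.mul_apply]
    match k with
    | 0 => rw [mulOmega_apply, Pi.smul_apply, Finset.sum_apply]; simp
    | 1 =>
      rw [mulOmega_apply, Pi.smul_apply, Finset.sum_apply, Finset.sum_eq_zero, smul_zero_form]
      intro b _
      rw [eps_congr (ζ := 0) (by rfl), map_zero]; rfl
    | k + 2 => exact mulOmega_deg _ (ih (by omega))

lemma eps_mulOmega (α : V →L[ℝ] ℂ) (η : Ext V) :
    eps α (mulOmega s e J K η) = mulOmega s e J K (eps α η) := by
  rw [mulOmega_apply, mulOmega_apply, map_smul, map_sum]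
  congr 1
  refine Finset.sum_congr rfl fun b _ => ?_
  rw [eps_eps α, eps_eps α, map_neg, neg_neg]

lemma QuatHerm.inn_omegaPow (q : QuatHerm s I J K) (h : IsONB s e) (v : V) (m : ℕ) :
    inn v ((mulOmega s e J K ^ (m + 1)) one)
      = ((m : ℂ) + 1) • eps (innOmega s J K v) ((mulOmega s e J K ^ m) one) := by
  induction m with
  | zero =>
    rw [zero_add, pow_one, q.inn_mulOmega h, inn_one, map_zero]
    refine ext_ext fun k v => ?_
    simp
  | succ m ih =>
    rw [pow_succ', Module.End.mul_apply, q.inn_mulOmega h, ih, map_smul, ← eps_mulOmega,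
      ← Module.End.mul_apply (mulOmega s e J K), ← pow_succ']
    refine ext_ext fun k v => ?_
    simp
    ring

/-- Nondegeneracy of `Ω`: the `(1,0)`-part of every `s(u, ·)` is a contraction of `Ω`. -/
lemma QuatHerm.exists_innOmega (q : QuatHerm s I J K) (u : V) :
    part10 I (cov s u) = innOmega s J K (J u) := by
  have := q.part10_comp_J (J u)
  rw [← neg_eq_iff_eq_neg.mpr this]
  have h2 : (cov s (J u)).comp (-J) = -cov s u := by
    ext w
    simp [q.skew_J, q.J_sq]
  rw [h2, map_neg, neg_neg]

/-- If `Ω^(m+1)` vanished, so would its contractions `(m + 1) ι_u Ω ∧ Ω^m`. As these exhaust the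
`(1,0)`-covectors, `Ω^m` would be killed by all of them; below the top degree, `m < n`, it would
then be zero. -/
lemma QuatHerm.omegaPow_ne_zero (q : QuatHerm s I J K) (h : IsONB s e) {n : ℕ} (hN : N = 4 * n)
    {m : ℕ} (hm : m ≤ n) : (mulOmega s e J K ^ m) one (2 * m) ≠ 0 := by
  induction m with
  | zero =>
    intro h0
    have := congrArg (fun φ : V [⋀^Fin 0]→L[ℝ] ℂ => φ ![]) h0
    simp [one] at this
  | succ m ih =>
    intro h0
    refine ih (by omega) ((q.starZero_omegaPow h m).eq_zero_of_eps h q.I_sq q.self_I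
      (by omega) fun α => ?_)
    have h1 : (mulOmega s e J K ^ (m + 1)) one = 0 := by
      funext k
      by_cases hk : k = 2 * (m + 1)
      · subst hk; exact h0
      · exact omegaPow_deg _ hk
    have h2 : ∀ u, eps (innOmega s J K u) ((mulOmega s e J K ^ m) one) = 0 := by
      intro u
      have := q.inn_omegaPow h u m
      rw [h1, map_zero] at this
      refine ext_ext fun k v => ?_
      have h3 := ext_congr this k v
      simp at h3
      refine (h3.resolve_left ?_)
      exact_mod_cast Nat.succ_ne_zero m
    rw [← h.covector_expand α]
    simp only [map_sum, map_smul, q.exists_innOmega, LinearMap.sum_apply, LinearMap.smul_apply, h2,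
      smul_zero_ext, Finset.sum_const_zero]
    rfl

/-- A `(0,1)`-form is determined by its product with a nonzero `(p,0)`-form. -/
lemma StarZero.eq_of_eps_part01 (h : IsONB s e) (hI : ∀ v, I (I v) = -v) {φ : Ext V}
    (hφ : StarZero I φ) {k : ℕ} (hk : φ k ≠ 0) {α : V →L[ℝ] ℂ}
    (hα : ∀ v, α (I v) = -(Complex.I * α v)) (h0 : eps α φ = 0) : α = 0 := by
  ext v
  have h1 := inn_eps v α φ
  have h2 := inn_eps (I v) α φ
  rw [h0, map_zero] at h1 h2
  rw [hφ.inn_I h hI, hα, map_smul] at h2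
  by_contra hne
  apply hk
  ext w
  have h3 := ext_congr h1 k w
  have h4 := ext_congr h2 k w
  simp at h3 h4
  -- Contractions with `v` and with `I v` act on `φ` by the factors `1` and `i`, on `α` by `1` and
  -- `-i`. The combination chosen eliminates the term `α ∧ ι_v φ`.
  have h5 : (2 * α v) * φ k w = 0 := by
    linear_combination -h3 - Complex.I * h4 + (eps α (HKT.inn v φ) k w + α v * φ k w )* Complex.I_mul_I
  exact (mul_eq_zero.mp h5).resolve_left (mul_ne_zero two_ne_zero hne)

lemma part01_I (hI : ∀ v, I (I v) = -v) (α : V →L[ℝ] ℂ) (v : V) :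
    part01 I α (I v) = -(Complex.I * part01 I α v) := by
  rw [part01_apply, part01_apply, hI, map_neg]
  linear_combination (1 / 2 : ℂ) * α (I v) * Complex.I_mul_I

/-- The `(2n,1)`-part of the derivative of a parallel `(2n,0)`-form. -/
lemma QuatHerm.typeComp_top (q : QuatHerm s I J K) (h : IsONB s e) {n : ℕ} (hN : N = 4 * n)
    {T : V →L[ℝ] V →L[ℝ] V} (hT : IsSkewTorsion s T) {φ : Ext V} (hφ : StarZero I φ)
    (hdeg : ∀ k, k ≠ 2 * n → φ k = 0) :
    typeComp I (2 * n) 1 ((∑ a, eps (cov s (e a)) ((1 / 2 : ℂ) • der (T (e a)) φ)) (2 * n + 1))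
      = eps (thetaBar s e T I) φ (2 * n + 1) := by
  -- `φ` has degree `2 n`, the complex dimension, so any further `(1,0)`-factor gives zero.
  -- Contracting this relation yields `hinn`, which turns a `(1,0)`-factor times a contraction of
  -- `φ` into a scalar.
  have hkill : ∀ α, eps (part10 I α) φ = 0 := by
    intro α
    funext k
    cases k with
    | zero => rfl
    | succ k =>
      by_cases hk : k = 2 * n
      · exact (hφ.eps10 q.I_sq α).deg_eq_zero h q.I_sq q.self_I (by omega)
      · rw [eps_congr (ζ := 0) (by rw [hdeg k hk]; rfl), map_zero]
  have hinn : ∀ α v, eps (part10 I α) (inn v φ) = part10 I α v • φ := by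
    intro α v
    have := inn_eps v (part10 I α) φ
    rw [hkill, map_zero] at this
    exact (sub_eq_zero.mp this.symm).symm
  set y : Fin N → Fin N → V →L[ℝ] ℂ := fun a b => (part10 I (cov s (e b))).comp (T (e a)) with hy
  have hder : ∀ a, der (T (e a)) φ = ∑ b, eps (y a b) (inn (e b) φ) := by
    intro a
    rw [h.der_expand, hφ.sum_eps_inn h q.I_sq]
  -- Both covectors are split into types: `(1,0) ∧ (1,0)` gives zero, the two mixed products
  -- collapse to scalars, and the `(0,1) ∧ (0,1)` product has the wrong type and is discarded in
  -- `hZ`.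
  have hterm : ∀ a b, eps (cov s (e a)) (eps (y a b) (inn (e b) φ))
      = eps (part10 I (y a b) (e b) • part01 I (cov s (e a))) φ
        - eps (part01 I (part10 I (cov s (e a)) (e b) • y a b)) φ
        + eps (part01 I (cov s (e a))) (eps (part01 I (y a b)) (inn (e b) φ)) := by
    intro a b
    conv_lhs => rw [← part10_add_part01 I (cov s (e a)), ← part10_add_part01 I (y a b)]
    simp only [map_add, LinearMap.add_apply]
    rw [hinn, map_smul, map_smul, hkill, eps_eps (part10 I _) (part01 I _), hinn]
    simp only [map_smul, LinearMap.smul_apply]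
    refine ext_ext fun k v => ?_
    simp
    ring
  -- The trace over `b` of the `(1,0)`-part of `T(e_a)`; skewness removes all but the pairing of
  -- `T(e_a, e_b)` with `I e_b`.
  have htrI : ∀ a, ∑ b, part10 I (y a b) (e b) = Complex.I * s (leeVec e T I) (e a) := by
    intro a
    rw [cov_leeVec hT]
    push_cast
    simp only [Finset.mul_sum]
    refine Finset.sum_congr rfl fun b _ => ?_
    have hz : ∀ u v, s (T u v) v = 0 := fun u v => by
      have := hT.skew u v v; linarith
    have e1 : s (e b) (T (e a) (e b)) = 0 := by rw [q.symm, hz]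
    have e2 : s (e b) (I (T (e a) (e b))) = -s (T (e a) (e b)) (I (e b)) := by
      rw [q.symm, q.skew_I]
    have e3 : s (e b) (T (e a) (I (e b))) = -s (T (e a) (e b)) (I (e b)) := by
      rw [q.symm, hT.skew]
    have e4 : s (e b) (I (T (e a) (I (e b)))) = 0 := by
      rw [q.symm, q.skew_I, hz, neg_zero]
    simp only [hy, part10_apply, ContinuousLinearMap.comp_apply, cov_apply, e1, e2, e3, e4]
    push_cast
    ring
  -- The other trace, over both slots of `T`, gives the same Lee covector with opposite sign. The
  -- two mixed terms therefore add up and cancel the factor `1 / 2`.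
  have htrV : ∑ a, ∑ b, part10 I (cov s (e a)) (e b) • y a b
      = -(Complex.I • cov s (leeVec e T I)) := by
    ext v
    rw [Finset.sum_comm]
    have h1 : ∀ b, (∑ a, part10 I (cov s (e a)) (e b) • y a b) v
        = -(Complex.I / 2) * s (T v (e b)) (I (e b)) := by
      intro b
      let F : V →ₗ[ℝ] ℂ := ((part10 I (cov s (e b))).restrictScalars ℝ : V →ₗ[ℝ] ℂ) ∘ₗ
        ((T.flip v : V →L[ℝ] V) : V →ₗ[ℝ] V)
      have hF : ∀ w, F w = part10 I (cov s (e b)) (T w v) := fun w => rfl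
      have h2 := h.sum_apply' F (e b)
      have h3 := h.sum_apply' F (I (e b))
      have h4 : (∑ a, part10 I (cov s (e a)) (e b) • y a b) v
          = (1 / 2 : ℂ) * (F (e b) - Complex.I * F (I (e b))) := by
        rw [← h2, ← h3, Finset.mul_sum, ← Finset.sum_sub_distrib, Finset.mul_sum,
          _root_.sum_apply]
        refine Finset.sum_congr rfl fun a _ => ?_
        simp only [hF, _root_.smul_apply, hy, ContinuousLinearMap.comp_apply, part10_apply I (cov s (e a)),
          cov_apply, smul_eq_mul]
        ring
      have hz : ∀ u v, s (T u v) u = 0 := fun u v => by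
        have := hT.skew v u u
        rw [hT.anti u v, map_neg, _root_.neg_apply]
        linarith
      have e1 : s (e b) (T (e b) v) = 0 := by rw [q.symm, hz]
      have e2 : s (e b) (I (T (e b) v)) = s (T v (e b)) (I (e b)) := by
        rw [q.symm, q.skew_I, hT.anti (e b)]; simp
      have e3 : s (e b) (T (I (e b)) v) = s (T v (e b)) (I (e b)) := by
        rw [q.symm, hT.cyc]
      have e4 : s (e b) (I (T (I (e b)) v)) = 0 := by
        rw [q.symm, q.skew_I, hz, neg_zero]
      rw [h4, hF, hF, part10_apply, part10_apply]
      simp only [cov_apply, e1, e2, e3, e4]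
      push_cast
      ring
    rw [_root_.sum_apply, Finset.sum_congr rfl fun b _ => h1 b]
    simp only [_root_.neg_apply, _root_.smul_apply, cov_apply, cov_leeVec hT, smul_eq_mul]
    push_cast
    simp only [Finset.mul_sum, ← Finset.sum_neg_distrib]
    refine Finset.sum_congr rfl fun b _ => ?_
    ring
  have hsum : ∑ a, eps (cov s (e a)) ((1 / 2 : ℂ) • der (T (e a)) φ)
      = eps (thetaBar s e T I) φ + (1 / 2 : ℂ) • ∑ a, ∑ b,
        eps (part01 I (cov s (e a))) (eps (part01 I (y a b)) (inn (e b) φ)) := by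
    have h1 : ∑ a, ∑ b, part10 I (y a b) (e b) • part01 I (cov s (e a)) = thetaBar s e T I := by
      have := h.covector_expand (Complex.I • cov s (leeVec e T I))
      rw [thetaBar, ← this]
      simp only [map_sum, map_smul, ← Finset.sum_smul, htrI]
      rfl
    have h2 : ∑ a, ∑ b, part01 I (part10 I (cov s (e a)) (e b) • y a b) = -thetaBar s e T I := by
      simp only [← map_sum]
      rw [htrV, map_neg]; rfl
    have h3 := congrArg (fun α => eps α φ) h1
    have h4 := congrArg (fun α => eps α φ) h2
    simp only [map_sum, LinearMap.sum_apply, map_neg, LinearMap.neg_apply] at h3 h4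
    have h5 : ∀ a, eps (cov s (e a)) ((1 / 2 : ℂ) • der (T (e a)) φ) = (1 / 2 : ℂ) •
        (∑ b, eps (part10 I (y a b) (e b) • part01 I (cov s (e a))) φ
        - ∑ b, eps (part01 I (part10 I (cov s (e a)) (e b) • y a b)) φ
        + ∑ b, eps (part01 I (cov s (e a))) (eps (part01 I (y a b)) (inn (e b) φ))) := by
      intro a
      rw [map_smul, hder, map_sum, ← Finset.sum_sub_distrib, ← Finset.sum_add_distrib,
        Finset.sum_congr rfl fun b _ => hterm a b]
    rw [Finset.sum_congr rfl fun a _ => h5 a, ← Finset.smul_sum, Finset.sum_add_distrib,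
      Finset.sum_sub_distrib, h3, h4]
    generalize (∑ a, ∑ b, eps (part01 I (cov s (e a))) (eps (part01 I (y a b)) (inn (e b) φ))) = Z
    refine ext_ext fun k v => ?_
    simp
    ring
  -- The remaining terms are of type `(2n - 1, 2)`. For `n = 0` this type does not exist, but then
  -- the frame is empty.
  have hZ : typeComp I (2 * n) 1 ((∑ a, ∑ b, eps (part01 I (cov s (e a)))
      (eps (part01 I (y a b)) (inn (e b) φ))) (2 * n + 1)) = 0 := by
    rcases Nat.eq_zero_or_pos n with h0 | h0
    · have : IsEmpty (Fin N) := by rw [hN, h0]; exact (inferInstance : IsEmpty (Fin 0))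
      rw [Finset.univ_eq_empty, Finset.sum_empty]
      exact typeComp_zero _ _ _ _
    · obtain ⟨k, hk⟩ := Nat.exists_eq_add_of_lt h0
      have h1 : 2 * n = 2 * k + 1 + 1 := by omega
      rw [Finset.sum_apply, ← typeCompL_apply, _root_.map_sum]
      refine Finset.sum_eq_zero fun a _ => ?_
      rw [Finset.sum_apply, _root_.map_sum]
      refine Finset.sum_eq_zero fun b _ => ?_
      rw [typeCompL_apply, h1]
      rw [typeComp_of_isOfType I (by omega) ((((hφ.inn h q.I_sq (e b)) (2 * k + 1)).eps01 q.I_sq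
        (y a b)).eps01 q.I_sq (cov s (e a))), if_neg (by omega)]
  rw [hsum, Pi.add_apply, typeComp_add, Pi.smul_apply, typeComp_smul, hZ, thetaBar,
    typeComp_of_isOfType I (by omega) ((hφ (2 * n)).eps01 q.I_sq _), if_pos rfl]
  refine (congrArg₂ _ rfl (smul_zero_form _)).trans (add_zero _)

end OmegaPow

end HKT

namespace HKT

/-! ### Smooth square roots near the identity -/

section SquareRoot

open Filter Topology

variable {V W : Type*} [NormedRing V] [NormedAlgebra ℝ V] [FiniteDimensional ℝ V]
  [NormedAddCommGroup W] [NormedSpace ℝ W]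

/-- A smooth family of elements of a finite-dimensional algebra with value `1` at a point has, near it, a smooth square root
lying in any given subspace that is closed under squares and contains the
family. -/
lemma exists_sqrt (S : Submodule ℝ V) (h1 : 1 ∈ S)
    (hS : ∀ a ∈ S, a * a ∈ S) {B : W → V} {y₀ : W} (hB : ContDiffAt ℝ ∞ B y₀)
    (hB1 : B y₀ = 1) (hBS : ∀ᶠ y in 𝓝 y₀, B y ∈ S) :
    ∃ R : W → V, ContDiffAt ℝ ∞ R y₀ ∧ R y₀ = 1 ∧
      ∀ᶠ y in 𝓝 y₀, R y ∈ S ∧ R y * R y = B y := by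
  obtain ⟨S', hS'⟩ := S.exists_isCompl
  let P : V →L[ℝ] S := LinearMap.toContinuousLinearMap (S.projectionOnto S' hS')
  have hP : ∀ a (ha : a ∈ S), P a = ⟨a, ha⟩ := fun a ha =>
    Submodule.projectionOnto_apply_left hS' ⟨a, ha⟩
  -- The projection only serves to make squaring a map of `S` to itself on the nose; by `hS` it does
  -- not change the value.
  let sq : S → S := fun a => P ((a : V) * a)
  let u : S := ⟨1, h1⟩
  have hsq : ContDiff ℝ ∞ sq := by
    have h2 : ContDiff ℝ ∞ (fun a : S => S.subtypeL a * S.subtypeL a) :=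
      S.subtypeL.contDiff.mul S.subtypeL.contDiff
    exact P.contDiff.comp h2
  -- The derivative of squaring at `1` is multiplication by `2`, so the inverse function theorem
  -- applies.
  have hd : HasFDerivAt sq (((ContinuousLinearEquiv.smulLeft (Units.mk0 (2 : ℝ) two_ne_zero) :
      S ≃L[ℝ] S)) : S →L[ℝ] S) u := by
    have h2 := P.hasFDerivAt.comp u (S.subtypeL.hasFDerivAt (x := u) |>.mul' S.subtypeL.hasFDerivAt)
    refine h2.congr_fderiv ?_
    ext1 a
    have h3 : S.subtypeL u = 1 := rfl
    simp only [h3, ContinuousLinearMap.comp_apply, one_smul, add_apply,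
      MulOpposite.op_one, map_add]
    have h4 : P (S.subtypeL a) = a := hP a.1 a.2
    rw [h4]
    exact (two_smul ℝ a).symm
  have hsu : sq u = u := by
    simp only [sq, u, mul_one, hP 1 h1]
  have hca := hsq.contDiffAt (x := u)
  have hn : (∞ : WithTop ℕ∞) ≠ 0 := by simp
  have hPB : P (B y₀) = sq u := by rw [hB1, hP 1 h1, hsu]
  have h3 := hca.to_localInverse hd hn
  have hBc : ContDiffAt ℝ ∞ (fun y => P (B y)) y₀ := P.contDiff.contDiffAt.comp y₀ hB
  refine ⟨fun y => (hca.localInverse hd hn (P (B y)) : S), ?_, ?_, ?_⟩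
  · rw [← hPB] at h3
    exact S.subtypeL.contDiff.contDiffAt.comp y₀ (h3.comp y₀ hBc)
  · change ((hca.localInverse hd hn (P (B y₀)) : S) : V) = 1
    rw [hPB, hca.localInverse_apply_image hd hn]
  · have h5 : ∀ᶠ z in 𝓝 (P (B y₀)), sq (hca.localInverse hd hn z) = z := by
      rw [hPB]
      exact (hca.hasStrictFDerivAt' hd hn).eventually_right_inverse
    filter_upwards [hBc.continuousAt.eventually h5, hBS] with y hy hyS
    refine ⟨Subtype.coe_prop _, ?_⟩
    rw [hP _ hyS] at hy ⊢
    simp only [sq] at hy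
    rw [hP _ (hS _ (Subtype.coe_prop _))] at hy
    exact congrArg Subtype.val hy

end SquareRoot

/-! ### Local constancy of quaternionic Hermitian structures -/

section Intertwiner

open Filter Topology

variable {V W : Type*} [NormedAddCommGroup V] [NormedSpace ℝ V] [FiniteDimensional ℝ V]
  [NormedAddCommGroup W] [NormedSpace ℝ W]

lemma ContDiffAt.eventually_inverse {h : W → V →L[ℝ] V} {y₀ : W} (hh : ContDiffAt ℝ ∞ h y₀)
    (h1 : h y₀ = 1) : ContDiffAt ℝ ∞ (fun y => Ring.inverse (h y)) y₀ ∧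
      Ring.inverse (h y₀) = 1 ∧
      ∀ᶠ y in 𝓝 y₀, h y * Ring.inverse (h y) = 1 ∧ Ring.inverse (h y) * h y = 1 := by
  have : CompleteSpace V := FiniteDimensional.complete ℝ V
  refine ⟨?_, by rw [h1, Ring.inverse_one], ?_⟩
  · have := contDiffAt_ringInverse ℝ (n := ∞) (1 : (V →L[ℝ] V)ˣ)
    rw [Units.val_one, ← h1] at this
    exact this.comp y₀ hh
  · have h2 : ∀ᶠ a in 𝓝 (h y₀), IsUnit a := by
      rw [h1]; exact Units.nhds (1 : (V →L[ℝ] V)ˣ)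
    filter_upwards [hh.continuousAt.eventually h2] with y hy
    exact ⟨Ring.mul_inverse_cancel _ hy, Ring.inverse_mul_cancel _ hy⟩

/-- The endomorphisms that commute with `I`, `J`, `K` and are symmetric for `s`. -/
def symmCommutant (s : V →L[ℝ] V →L[ℝ] ℝ) (I J K : V →L[ℝ] V) : Submodule ℝ (V →L[ℝ] V) where
  carrier := {a | (∀ v, a (I v) = I (a v)) ∧ (∀ v, a (J v) = J (a v)) ∧ (∀ v, a (K v) = K (a v)) ∧
    ∀ u v, s (a u) v = s u (a v)}
  add_mem' := by
    rintro a b ⟨h1, h2, h3, h4⟩ ⟨k1, k2, k3, k4⟩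
    exact ⟨by simp [h1, k1], by simp [h2, k2], by simp [h3, k3], by simp [h4, k4]⟩
  zero_mem' := by simp
  smul_mem' := by
    rintro c a ⟨h1, h2, h3, h4⟩
    exact ⟨by simp [h1], by simp [h2], by simp [h3], by simp [h4]⟩

omit [FiniteDimensional ℝ V] in
lemma mem_symmCommutant {s : V →L[ℝ] V →L[ℝ] ℝ} {I J K a : V →L[ℝ] V} :
    a ∈ symmCommutant s I J K ↔ (∀ v, a (I v) = I (a v)) ∧ (∀ v, a (J v) = J (a v)) ∧
      (∀ v, a (K v) = K (a v)) ∧ ∀ u v, s (a u) v = s u (a v) := Iff.rfl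

/-- A smooth family of quaternionic Hermitian structures is locally constant up to a smooth change
of frame. -/
lemma exists_intertwiner {N : ℕ} {s : W → V →L[ℝ] V →L[ℝ] ℝ} {I J K : W → V →L[ℝ] V} {y₀ : W}
    {e : Fin N → V} (he : IsONB (s y₀) e) (hs : ContDiffAt ℝ ∞ s y₀) (hI : ContDiffAt ℝ ∞ I y₀)
    (hJ : ContDiffAt ℝ ∞ J y₀) (hK : ContDiffAt ℝ ∞ K y₀)
    (hq : ∀ᶠ y in 𝓝 y₀, QuatHerm (s y) (I y) (J y) (K y)) :
    ∃ g : W → V →L[ℝ] V, ContDiffAt ℝ ∞ g y₀ ∧ g y₀ = 1 ∧ ∀ᶠ y in 𝓝 y₀,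
      (∀ v, g y (I y v) = I y₀ (g y v)) ∧ (∀ v, g y (J y v) = J y₀ (g y v)) ∧
      (∀ v, g y (K y v) = K y₀ (g y v)) ∧ ∀ u v, s y₀ (g y u) (g y v) = s y u v := by
  have q0 := hq.self_of_nhds
  -- An average over the quaternion units: `h y` intertwines the quaternionic structure at `y` with
  -- that at `y₀`, and it is the identity at `y₀`, hence invertible nearby. It need not be
  -- isometric.
  let h : W → V →L[ℝ] V := fun y => (1 / 4 : ℝ) •
    (1 - (I y₀).comp (I y) - (J y₀).comp (J y) - (K y₀).comp (K y))
  have hh : ContDiffAt ℝ ∞ h y₀ := by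
    refine ContDiffAt.const_smul _ (((contDiffAt_const.sub ?_).sub ?_).sub ?_)
    · exact contDiffAt_const.clm_comp hI
    · exact contDiffAt_const.clm_comp hJ
    · exact contDiffAt_const.clm_comp hK
  have hv : ∀ y v, h y v = (1 / 4 : ℝ) • (v - I y₀ (I y v) - J y₀ (J y v) - K y₀ (K y v)) :=
    fun y v => by simp [h]
  have h1 : h y₀ = 1 := by
    ext v
    rw [hv, q0.I_sq, q0.J_sq, q0.K_sq]
    simp only [one_apply_eq_self]
    module
  obtain ⟨hk, hk1, hinv⟩ := ContDiffAt.eventually_inverse hh h1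
  set k : W → V →L[ℝ] V := fun y => Ring.inverse (h y) with hkdef
  -- The metric at `y`, transported by `k = h⁻¹`, expressed as an endomorphism relative to the
  -- metric at `y₀`. It is symmetric and commutes with the quaternions.
  let B : W → V →L[ℝ] V := fun y => ∑ a, ((s y (k y (e a))).comp (k y)).smulRight (e a)
  have hB : ContDiffAt ℝ ∞ B y₀ := by
    refine ContDiffAt.sum fun a _ => ?_
    refine ContDiffAt.smulRight ?_ contDiffAt_const
    exact (hs.clm_apply (hk.clm_apply contDiffAt_const)).clm_comp hk
  have hBs : ∀ y u v, s y₀ (B y u) v = s y (k y v) (k y u) := by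
    intro y u v
    conv_rhs => rw [← he.expand v]
    simp only [B, map_sum, sum_apply, ContinuousLinearMap.smulRight_apply,
      ContinuousLinearMap.comp_apply, map_smul, smul_apply, smul_eq_mul]
    exact Finset.sum_congr rfl fun a _ => mul_comm _ _
  have hnd : ∀ u u', (∀ v, s y₀ u v = s y₀ u' v) → u = u' := by
    intro u u' huv
    by_contra hne
    have := q0.pos _ (sub_ne_zero.mpr hne)
    have h0 := huv (u - u')
    have h2 : s y₀ (u - u') (u - u') = 0 := by
      rw [map_sub (s y₀), sub_apply, h0, sub_self]
    exact this.ne' h2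
  have hB1 : B y₀ = 1 := by
    ext u
    refine hnd _ _ fun v => ?_
    rw [hBs]
    simp only [hkdef, hk1, one_apply_eq_self, q0.symm]
  have hev : ∀ᶠ y in 𝓝 y₀, (∀ v, k y (I y₀ v) = I y (k y v)) ∧ (∀ v, k y (J y₀ v) = J y (k y v)) ∧
      (∀ v, k y (K y₀ v) = K y (k y v)) ∧ (∀ v, k y (h y v) = v) ∧ (∀ v, h y (k y v) = v) := by
    filter_upwards [hq, hinv] with y q ⟨hy1, hy2⟩
    have e1 : ∀ v, h y (k y v) = v := fun v => congrArg (· v) hy1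
    have e2 : ∀ v, k y (h y v) = v := fun v => congrArg (· v) hy2
    have key : ∀ L L₀ : V →L[ℝ] V, (∀ v, h y (L v) = L₀ (h y v)) →
        ∀ v, k y (L₀ v) = L (k y v) := by
      intro L L₀ hL v
      conv_lhs => rw [← e1 v, ← hL, e2]
    refine ⟨key _ _ fun v => ?_, key _ _ fun v => ?_, key _ _ fun v => ?_, e2, e1⟩ <;>
    · simp only [hv, map_smul, map_sub, q.I_sq, q.J_sq, q.K_sq, q.I_J, q.J_I, q.I_K, q.K_I, q.J_K,
        q.K_J, q0.I_sq, q0.J_sq, q0.K_sq, q0.I_J, q0.J_I, q0.I_K, q0.K_I, q0.J_K,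
        q0.K_J, map_neg]
      module
  have hBS : ∀ᶠ y in 𝓝 y₀, B y ∈ symmCommutant (s y₀) (I y₀) (J y₀) (K y₀) := by
    filter_upwards [hq, hev] with y q ⟨kI, kJ, kK, _, _⟩
    have key : ∀ L L₀ : V →L[ℝ] V, (∀ v, k y (L₀ v) = L (k y v)) →
        (∀ u v, s y u (L v) = - s y (L u) v) → (∀ u v, s y₀ u (L₀ v) = - s y₀ (L₀ u) v) →
        ∀ v, B y (L₀ v) = L₀ (B y v) := by
      intro L L₀ hL h2 h3 u
      refine hnd _ _ fun v => ?_
      rw [hBs, hL, h2, ← hL, ← neg_eq_iff_eq_neg.mpr (h3 (B y u) v), hBs]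
    refine mem_symmCommutant.mpr ⟨key _ _ kI
      (fun u v => neg_eq_iff_eq_neg.mp <| Eq.symm <| (q.skew_I u v)) (fun u v => neg_eq_iff_eq_neg.mp <| Eq.symm <| (q0.skew_I u v)), key _ _ kJ
      (fun u v => neg_eq_iff_eq_neg.mp <| Eq.symm <| (q.skew_J u v)) (fun u v => neg_eq_iff_eq_neg.mp <| Eq.symm <| (q0.skew_J u v)),
      key _ _ kK
      (fun u v => neg_eq_iff_eq_neg.mp <| Eq.symm <| (q.skew_K u v)) (fun u v => neg_eq_iff_eq_neg.mp <| Eq.symm <| (q0.skew_K u v)), fun u v => ?_⟩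
    rw [hBs, q0.symm, hBs, q.symm]
  -- A symmetric root `R` with `R² = B` corrects `h`: since `R` commutes with the quaternions, `R ∘
  -- h` is still an intertwiner, and it is now isometric.
  obtain ⟨R, hR, hR1, hRS⟩ := exists_sqrt (symmCommutant (s y₀) (I y₀) (J y₀) (K y₀))
    (by simp [mem_symmCommutant]) (by
      rintro a ⟨h1, h2, h3, h4⟩
      refine ⟨fun v => ?_, fun v => ?_, fun v => ?_, fun u v => ?_⟩ <;>
        simp [h1, h2, h3, h4]) hB hB1 hBS
  refine ⟨fun y => (R y).comp (h y), hR.clm_comp hh, ?_, ?_⟩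
  · change (R y₀).comp (h y₀) = 1
    rw [hR1, h1]; rfl
  filter_upwards [hRS, hev, hq] with y ⟨⟨RI, RJ, RK, Rs⟩, hRB⟩ ⟨kI, kJ, kK, kh, hk'⟩ q
  have key : ∀ L L₀ : V →L[ℝ] V, (∀ v, k y (L₀ v) = L (k y v)) → ∀ v, h y (L v) = L₀ (h y v) := by
    intro L L₀ hL v
    conv_lhs => rw [← kh v, ← hL, hk']
  refine ⟨fun v => ?_, fun v => ?_, fun v => ?_, fun u v => ?_⟩
  · simp [key _ _ kI, RI]
  · simp [key _ _ kJ, RJ]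
  · simp [key _ _ kK, RK]
  · have : R y (R y (h y v)) = B y (h y v) := congrArg (· (h y v)) hRB
    simp only [ContinuousLinearMap.comp_apply]
    rw [Rs, this, q0.symm, hBs, kh, kh]

end Intertwiner
end HKT

namespace HKT

/-! ### Vector fields and forms in a chart -/

section Charts

open Filter Topology

variable {E : Type*} [NormedAddCommGroup E] [NormedSpace ℝ E]
  {M : Type*} [TopologicalSpace M] [ChartedSpace E M]

/-- The derivative of the inverse of the chart around `x₀`. -/
def chartInv (x₀ : M) (y : E) : E →L[ℝ] E := mfderiv 𝓘(ℝ, E) 𝓘(ℝ, E) (chartAt E x₀).symm y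

/-- The derivative of the chart around `x₀`. -/
def chartDer (x₀ x : M) : E →L[ℝ] E := mfderiv 𝓘(ℝ, E) 𝓘(ℝ, E) (chartAt E x₀) x

/-- The vector field with expression `w` in the chart around `x₀`. -/
def coordField (x₀ : M) (w : E → E) : ∀ x : M, TangentSpace 𝓘(ℝ, E) x :=
  fun x => chartInv x₀ (chartAt E x₀ x) (w (chartAt E x₀ x))

variable [IsManifold 𝓘(ℝ, E) ∞ M]

lemma chartInv_chartDer {x₀ x : M} (hx : x ∈ (chartAt E x₀).source) (v : E) :
    chartInv x₀ (chartAt E x₀ x) (chartDer x₀ x v) = v := by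
  have : IsManifold 𝓘(ℝ, E) 1 M := .of_le (n := ∞) (by simp)
  exact congrArg (fun f : E →L[ℝ] E => f v)
    ((mdifferentiable_chart (I := 𝓘(ℝ, E)) x₀).symm_comp_deriv hx)

lemma chartDer_chartInv {x₀ : M} {y : E} (hy : y ∈ (chartAt E x₀).target) (v : E) :
    chartDer x₀ ((chartAt E x₀).symm y) (chartInv x₀ y v) = v := by
  have : IsManifold 𝓘(ℝ, E) 1 M := .of_le (n := ∞) (by simp)
  exact congrArg (fun f : E →L[ℝ] E => f v)
    ((mdifferentiable_chart (I := 𝓘(ℝ, E)) x₀).comp_symm_deriv hy)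

lemma chartDer_self (x : M) : chartDer x x = ContinuousLinearMap.id ℝ E := by
  have : IsManifold 𝓘(ℝ, E) 1 M := .of_le (n := ∞) (by simp)
  exact mfderiv_extChartAt_self (I := 𝓘(ℝ, E)) (x := x)

lemma chartInv_self (x : M) : chartInv x (chartAt E x x) = ContinuousLinearMap.id ℝ E := by
  ext v
  have := chartInv_chartDer (mem_chart_source E x) v
  rwa [chartDer_self] at this

lemma contMDiffAt_comp_chart_iff {F : Type*} [NormedAddCommGroup F] [NormedSpace ℝ F] {x₀ x : M}
    (hx : x ∈ (chartAt E x₀).source) {f : M → F} :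
    ContMDiffAt 𝓘(ℝ, E) 𝓘(ℝ, F) ∞ f x ↔
      ContDiffAt ℝ ∞ (fun y => f ((chartAt E x₀).symm y)) (chartAt E x₀ x) := by
  have h1 : ContMDiffAt 𝓘(ℝ, E) 𝓘(ℝ, E) ∞ (chartAt E x₀) x :=
    (contMDiffOn_chart (I := 𝓘(ℝ, E)) (n := ∞) (x := x₀)).contMDiffAt
      ((chartAt E x₀).open_source.mem_nhds hx)
  have h2 : ContMDiffAt 𝓘(ℝ, E) 𝓘(ℝ, E) ∞ (chartAt E x₀).symm (chartAt E x₀ x) :=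
    (contMDiffOn_chart_symm (I := 𝓘(ℝ, E)) (n := ∞) (x := x₀)).contMDiffAt
      ((chartAt E x₀).open_target.mem_nhds ((chartAt E x₀).map_source hx))
  rw [← contMDiffAt_iff_contDiffAt]
  constructor
  · intro h
    rw [← (chartAt E x₀).left_inv hx] at h
    exact h.comp _ h2
  · intro h
    refine (h.comp x h1).congr_of_eventuallyEq ?_
    filter_upwards [(chartAt E x₀).open_source.mem_nhds hx] with z hz
    exact congrArg f ((chartAt E x₀).left_inv hz).symm

/-- The trivialization of the tangent bundle at `x₀` is the derivative of the chart, so smoothness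
of a section is smoothness of its coordinate expression. -/
lemma contMDiffAt_field_iff {x₀ x : M} (hx : x ∈ (chartAt E x₀).source)
    {Y : ∀ x : M, TangentSpace 𝓘(ℝ, E) x} :
    CMDiffAt ∞ (T% Y) x ↔ ContDiffAt ℝ ∞ (fun y => chartDer x₀ ((chartAt E x₀).symm y)
      (Y ((chartAt E x₀).symm y))) (chartAt E x₀ x) := by
  have : IsManifold 𝓘(ℝ, E) 1 M := .of_le (n := ∞) (by simp)
  rw [(trivializationAt E (TangentSpace 𝓘(ℝ, E)) x₀).contMDiffAt_section_iff hx,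
    ← contMDiffAt_comp_chart_iff hx (f := fun z => chartDer x₀ z (Y z))]
  refine Filter.EventuallyEq.contMDiffAt_iff ?_
  filter_upwards [(chartAt E x₀).open_source.mem_nhds hx] with z hz
  have h1 := TangentBundle.continuousLinearMapAt_trivializationAt (I := 𝓘(ℝ, E)) hz
  have h2 := (trivializationAt E (TangentSpace 𝓘(ℝ, E)) x₀).continuousLinearMapAt_apply_of_mem ℝ
    (b := z) hz (Y z)
  rw [← h2, h1]
  rfl

lemma contMDiffAt_coordField {x₀ x : M} (hx : x ∈ (chartAt E x₀).source) {w : E → E}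
    (hw : ContDiffAt ℝ ∞ w (chartAt E x₀ x)) : CMDiffAt ∞ (T% (coordField x₀ w)) x := by
  rw [contMDiffAt_field_iff hx]
  refine hw.congr_of_eventuallyEq ?_
  filter_upwards [(chartAt E x₀).open_target.mem_nhds ((chartAt E x₀).map_source hx)] with y hy
  rw [coordField, (chartAt E x₀).right_inv hy, chartDer_chartInv hy]

/-- Near `x` these fields are pullbacks of constant fields under the chart, and the Lie bracket is
natural under pullback. -/
lemma mlieBracket_coordField_const [CompleteSpace E] {x₀ x : M} (hx : x ∈ (chartAt E x₀).source)
    (u v : E) : VectorField.mlieBracket 𝓘(ℝ, E) (coordField x₀ fun _ => u)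
      (coordField x₀ fun _ => v) x = 0 := by
  have htop : (2 : WithTop ℕ∞) ≤ ∞ := WithTop.coe_le_coe.mpr (le_top : (2 : ℕ∞) ≤ ⊤)
  have : IsManifold 𝓘(ℝ, E) 1 M := .of_le (n := ∞) (by simp)
  have : IsManifold 𝓘(ℝ, E) (minSmoothness ℝ 2) M := .of_le (n := ∞) (by simpa using htop)
  let C : E → ∀ y : E, TangentSpace 𝓘(ℝ, E) y := fun w _ => w
  have key : ∀ w : E, ∀ z ∈ (chartAt E x₀).source, VectorField.mpullback 𝓘(ℝ, E) 𝓘(ℝ, E)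
      (chartAt E x₀) (C w) z = coordField x₀ (fun _ => w) z := by
    intro w z hz
    have h3 : (chartDer x₀ z).inverse = chartInv x₀ (chartAt E x₀ z) := by
      refine ContinuousLinearMap.inverse_eq ?_ ?_
      · ext v
        have := chartDer_chartInv ((chartAt E x₀).map_source hz) v
        rwa [(chartAt E x₀).left_inv hz] at this
      · ext v
        exact chartInv_chartDer hz v
    exact congrArg (fun f : E →L[ℝ] E => f w) h3
  have h1 : ContMDiffAt 𝓘(ℝ, E) 𝓘(ℝ, E) ∞ (chartAt E x₀) x :=
    (contMDiffOn_chart (I := 𝓘(ℝ, E)) (n := ∞) (x := x₀)).contMDiffAt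
      ((chartAt E x₀).open_source.mem_nhds hx)
  have hC : ∀ w y, MDiffAt (T% (C w)) y := by
    intro w y
    have : CMDiffAt ∞ (T% (C w)) y := by
      rw [contMDiffAt_field_iff (mem_chart_source E y)]
      have h4 : ∀ y z : E, chartDer y z = ContinuousLinearMap.id ℝ E := fun y z =>
        mfderiv_id (I := 𝓘(ℝ, E))
      simp only [h4]
      exact contDiffAt_const
    exact this.mdifferentiableAt (by simp)
  have h2 := VectorField.mpullback_mlieBracket (I := 𝓘(ℝ, E)) (I' := 𝓘(ℝ, E)) (x₀ := x)
    (f := chartAt E x₀) (n := ∞) (hC u _) (hC v _) h1 (by simpa using htop)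
  have h5 : VectorField.mlieBracket 𝓘(ℝ, E) (C u) (C v) = 0 := by
    have h6 : VectorField.mlieBracket 𝓘(ℝ, E) (C u) (C v)
        = VectorField.lieBracket ℝ (fun _ : E => u) (fun _ : E => v) := by
      rw [← VectorField.mlieBracketWithin_univ,
        VectorField.mlieBracketWithin_eq_lieBracketWithin, VectorField.lieBracketWithin_univ]
    rw [h6]
    funext y
    have h7 : VectorField.lieBracket ℝ (fun _ : E => u) (fun _ : E => v) y = 0 := by
      simp [VectorField.lieBracket_eq]
    exact h7
  have hz := (chartAt E x₀).open_source.mem_nhds hx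
  rw [← Filter.EventuallyEq.mlieBracket_vectorField_eq (x := x)
    (Filter.mem_of_superset hz (key u)) (Filter.mem_of_superset hz (key v)), ← h2, h5,
    VectorField.mpullback_zero]
  rfl

end Charts
end HKT

namespace HKT

lemma QuatHerm.conj {V : Type*} [NormedAddCommGroup V] [NormedSpace ℝ V]
    {s : V →L[ℝ] V →L[ℝ] ℝ} {I J K A A' : V →L[ℝ] V} (q : QuatHerm s I J K)
    (h1 : ∀ v, A (A' v) = v) (h2 : ∀ v, A' (A v) = v) :
    QuatHerm (s.bilinearComp A A) (A'.comp (I.comp A)) (A'.comp (J.comp A))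
      (A'.comp (K.comp A)) where
  I_sq v := by simp [h1, h2, q.I_sq]
  J_sq v := by simp [h1, h2, q.J_sq]
  I_J v := by simp [h1, q.I_J]
  J_I v := by simp [h1, q.J_I]
  symm u v := by simpa using q.symm _ _
  pos v hv := by
    have : A v ≠ 0 := fun h => hv (by rw [← h2 v, h, map_zero])
    simpa using q.pos _ this
  herm_I u v := by simp [h1, q.herm_I]
  herm_J u v := by simp [h1, q.herm_J]

/-! ### The hypercomplex Hermitian structure in a chart -/

section Structure

open Filter Topology

variable {E : Type*} [NormedAddCommGroup E] [NormedSpace ℝ E]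
  {M : Type*} [TopologicalSpace M] [ChartedSpace E M] [IsManifold 𝓘(ℝ, E) ∞ M]

/-- The value at `x` of an endomorphism field, on the model space. -/
def endAt (L : ∀ x : M, TangentSpace 𝓘(ℝ, E) x →L[ℝ] TangentSpace 𝓘(ℝ, E) x) (x : M) :
    E →L[ℝ] E := L x

/-- The expression of an endomorphism field in the chart around `x₀`. -/
def endChart (x₀ : M) (L : ∀ x : M, TangentSpace 𝓘(ℝ, E) x →L[ℝ] TangentSpace 𝓘(ℝ, E) x)
    (y : E) : E →L[ℝ] E :=
  (chartDer x₀ ((chartAt E x₀).symm y)).comp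
    ((endAt L ((chartAt E x₀).symm y)).comp (chartInv x₀ y))

variable [FiniteDimensional ℝ E]

lemma contDiffAt_clm_of_apply {F G : Type*} [NormedAddCommGroup F] [NormedSpace ℝ F]
    [FiniteDimensional ℝ F]
    [NormedAddCommGroup G] [NormedSpace ℝ G] {W : Type*} [NormedAddCommGroup W] [NormedSpace ℝ W]
    {f : W → F →L[ℝ] G} {y : W}
    (h : ∀ v, ContDiffAt ℝ ∞ (fun y => f y v) y) : ContDiffAt ℝ ∞ f y := by
  let b := Module.finBasis ℝ F
  let φ : ∀ i, F →L[ℝ] ℝ := fun i => LinearMap.toContinuousLinearMap (b.coord i)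
  have hf : f = fun y => ∑ i, (φ i).smulRight (f y (b i)) := by
    funext y
    ext v
    conv_lhs => rw [← b.sum_repr v, map_sum]
    simp [φ, sum_apply]
  rw [hf]
  exact ContDiffAt.sum fun i _ => contDiffAt_const.smulRight (h _)

lemma contDiffAt_endChart {L : ∀ x : M, TangentSpace 𝓘(ℝ, E) x →L[ℝ] TangentSpace 𝓘(ℝ, E) x}
    (hL : IsSmoothEnd L) {x₀ : M} {y : E} (hy : y ∈ (chartAt E x₀).target) :
    ContDiffAt ℝ ∞ (endChart x₀ L) y := by
  refine contDiffAt_clm_of_apply fun v => ?_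
  have hx := (chartAt E x₀).map_target hy
  have h1 := contMDiffAt_coordField hx (w := fun _ => v) contDiffAt_const
  have h2 := (contMDiffAt_field_iff hx).mp (ContMDiffAt.clm_bundle_apply (hL _) h1)
  rw [(chartAt E x₀).right_inv hy] at h2
  refine h2.congr_of_eventuallyEq ?_
  filter_upwards [(chartAt E x₀).open_target.mem_nhds hy] with z hz
  rw [coordField, (chartAt E x₀).right_inv hz]
  rfl

namespace HypercomplexHermitian

variable (X : HypercomplexHermitian E M)

/-- The metric at `x`, as a bilinear form on the model space. -/
def metricAt (x : M) : E →L[ℝ] E →L[ℝ] ℝ := X.metric.inner x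

/-- The expression of the metric in the chart around `x₀`. -/
def metricChart (x₀ : M) (y : E) : E →L[ℝ] E →L[ℝ] ℝ :=
  (X.metricAt ((chartAt E x₀).symm y)).bilinearComp (chartInv x₀ y) (chartInv x₀ y)

omit [FiniteDimensional ℝ E] in
lemma contMDiffAt_metric {x : M} {Y Z : ∀ x : M, TangentSpace 𝓘(ℝ, E) x}
    (hY : CMDiffAt ∞ (T% Y) x) (hZ : CMDiffAt ∞ (T% Z) x) :
    ContMDiffAt 𝓘(ℝ, E) 𝓘(ℝ, ℝ) ∞ (fun z => X.metric.inner z (Y z) (Z z)) x := by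
  have h2 : ContMDiffAt 𝓘(ℝ, E) (𝓘(ℝ, E).prod 𝓘(ℝ, ℝ)) ∞ (fun z => Bundle.TotalSpace.mk' ℝ
      (E := Bundle.Trivial M ℝ) z (X.metric.inner z (Y z) (Z z))) x :=
    ContMDiffAt.clm_bundle_apply₂ (X.metric.contMDiff _) hY hZ
  exact (Bundle.contMDiffAt_totalSpace.mp h2).2

lemma contDiffAt_metricChart {x₀ : M} {y : E} (hy : y ∈ (chartAt E x₀).target) :
    ContDiffAt ℝ ∞ (X.metricChart x₀) y := by
  refine contDiffAt_clm_of_apply fun u => contDiffAt_clm_of_apply fun v => ?_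
  have hx := (chartAt E x₀).map_target hy
  have h1 := fun w : E => contMDiffAt_coordField hx (w := fun _ => w) contDiffAt_const
  have h3 := (contMDiffAt_comp_chart_iff hx).mp (X.contMDiffAt_metric (h1 u) (h1 v))
  rw [(chartAt E x₀).right_inv hy] at h3
  refine h3.congr_of_eventuallyEq ?_
  filter_upwards [(chartAt E x₀).open_target.mem_nhds hy] with z hz
  simp only [coordField, (chartAt E x₀).right_inv hz]
  rfl

omit [FiniteDimensional ℝ E] in
lemma quatHerm (x : M) : QuatHerm (V := E) (X.metricAt x) (endAt X.I x) (endAt X.J x)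
    (endAt X.K x) where
  I_sq := X.I_sq x
  J_sq := X.J_sq x
  I_J := X.I_J x
  J_I := X.J_I x
  symm := X.metric.symm x
  pos := X.metric.pos x
  herm_I v w := by
    have h := X.hermitian 1 0 0 (by norm_num) x v w
    simp only [one_smul, zero_smul, add_zero] at h
    exact h
  herm_J := X.hermitian_J x

omit [FiniteDimensional ℝ E] in
lemma quatHerm_chart {x₀ : M} {y : E} (hy : y ∈ (chartAt E x₀).target) :
    QuatHerm (X.metricChart x₀ y) (endChart x₀ X.I y) (endChart x₀ X.J y) (endChart x₀ X.K y) :=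
  (X.quatHerm ((chartAt E x₀).symm y)).conj (fun v => by
    have := chartInv_chartDer ((chartAt E x₀).map_target hy) v
    rwa [(chartAt E x₀).right_inv hy] at this) (chartDer_chartInv hy)

end HypercomplexHermitian

end Structure
end HKT

namespace HKT

/-! ### The connection and its torsion in a chart -/

section Connection

open Filter Topology

variable {E : Type*} [NormedAddCommGroup E] [NormedSpace ℝ E]
  {M : Type*} [TopologicalSpace M] [ChartedSpace E M] [IsManifold 𝓘(ℝ, E) ∞ M]

lemma hasMFDerivAt_of_chart {F : Type*} [NormedAddCommGroup F] [NormedSpace ℝ F] {x₀ x : M}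
    (hx : x ∈ (chartAt E x₀).source) {f : M → F} {f' : E →L[ℝ] F}
    (hf : HasFDerivAt (fun y => f ((chartAt E x₀).symm y)) f' (chartAt E x₀ x)) :
    HasMFDerivAt 𝓘(ℝ, E) 𝓘(ℝ, F) f x (f'.comp (chartDer x₀ x) :) := by
  have h1 : IsManifold 𝓘(ℝ, E) 1 M := .of_le (n := ∞) (by simp)
  have h2 := ((mdifferentiable_chart (I := 𝓘(ℝ, E)) x₀).mdifferentiableAt hx).hasMFDerivAt
  refine (HasMFDerivAt.comp x hf.hasMFDerivAt h2).congr_of_eventuallyEq ?_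
  filter_upwards [(chartAt E x₀).open_source.mem_nhds hx] with z hz
  exact congrArg f ((chartAt E x₀).left_inv hz).symm

lemma mdifferentiableAt_field {x : M} {Y : ∀ x : M, TangentSpace 𝓘(ℝ, E) x}
    (hY : CMDiffAt ∞ (T% Y) x) : MDiffAt (T% Y) x := hY.mdifferentiableAt (by simp)

variable [FiniteDimensional ℝ E]
  (D : CovariantDerivative 𝓘(ℝ, E) E (fun x : M => TangentSpace 𝓘(ℝ, E) x))

/-- The covariant derivative at `x` of a vector field, on the model space. -/
def covAt (Y : ∀ x : M, TangentSpace 𝓘(ℝ, E) x) (x : M) : E →L[ℝ] E := D Y x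

/-- The covariant derivatives at `x` of the coordinate vector fields of the chart around `x₀`. -/
def connForm (x₀ x : M) : E →L[ℝ] E →L[ℝ] E :=
  ∑ i, (ContinuousLinearMap.smulRightL ℝ E E
    (LinearMap.toContinuousLinearMap ((Module.finBasis ℝ E).coord i))).comp
      (covAt D (coordField x₀ fun _ => Module.finBasis ℝ E i) x)

omit [FiniteDimensional ℝ E] in
lemma covAt_add {x : M} {Y Z : ∀ x : M, TangentSpace 𝓘(ℝ, E) x} (hY : CMDiffAt ∞ (T% Y) x)
    (hZ : CMDiffAt ∞ (T% Z) x) : covAt D (Y + Z) x = covAt D Y x + covAt D Z x :=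
  D.isCovariantDerivativeOn.add (mdifferentiableAt_field hY) (mdifferentiableAt_field hZ)
    (Set.mem_univ x)

omit [FiniteDimensional ℝ E] in
lemma covAt_congr {x : M} {Y Z : ∀ x : M, TangentSpace 𝓘(ℝ, E) x} (hY : CMDiffAt ∞ (T% Y) x)
    (h : ∀ᶠ z in 𝓝 x, Z z = Y z) : covAt D Z x = covAt D Y x := by
  have hZ : CMDiffAt ∞ (T% Z) x := hY.congr_of_eventuallyEq (by
    filter_upwards [h] with z hz using by rw [hz])
  exact D.isCovariantDerivativeOn.congr_of_eventuallyEq (mdifferentiableAt_field hZ)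
    (mdifferentiableAt_field hY) univ_mem h

omit [FiniteDimensional ℝ E] in
lemma covAt_smul {x : M} {f : M → ℝ} {f' : E →L[ℝ] ℝ} {Y : ∀ x : M, TangentSpace 𝓘(ℝ, E) x}
    (hY : CMDiffAt ∞ (T% Y) x) (hf : HasMFDerivAt 𝓘(ℝ, E) 𝓘(ℝ, ℝ) f x f') (a : E) :
    covAt D (f • Y) x a = f x • covAt D Y x a + f' a • (show E from Y x) := by
  have h := D.isCovariantDerivativeOn.leibniz (mdifferentiableAt_field hY) hf.mdifferentiableAt
    (Set.mem_univ x)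
  have h2 : mvfderiv 𝓘(ℝ, E) f x = f' := by
    rw [mvfderiv, hf.mfderiv]; rfl
  rw [h2] at h
  exact congrArg (fun T : E →L[ℝ] E => T a) h

omit [FiniteDimensional ℝ E] in
lemma covAt_sum {ι : Type*} (t : Finset ι) {x : M}
    {Y : ι → ∀ x : M, TangentSpace 𝓘(ℝ, E) x} (hY : ∀ i, CMDiffAt ∞ (T% (Y i)) x) :
    CMDiffAt ∞ (T% (∑ i ∈ t, Y i)) x ∧ covAt D (∑ i ∈ t, Y i) x = ∑ i ∈ t, covAt D (Y i) x := by
  classical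
  induction t using Finset.induction_on with
  | empty =>
    simp only [Finset.sum_empty]
    refine ⟨?_, D.isCovariantDerivativeOn.zero (Set.mem_univ x)⟩
    exact (Bundle.contMDiff_zeroSection ℝ (TangentSpace 𝓘(ℝ, E) : M → Type _)) x
  | insert i t hi ih =>
    simp only [Finset.sum_insert hi]
    exact ⟨(hY i).add_section ih.1, by rw [covAt_add D (hY i) ih.1, ih.2]⟩

/-- Expand `w` in a fixed basis and apply the Leibniz rule. Only the value of the connection at the
single point `x` enters, so no regularity of `connForm` in `x` is involved. -/
lemma covAt_coordField {x₀ x : M} (hx : x ∈ (chartAt E x₀).source) {w : E → E}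
    (hw : ContDiffAt ℝ ∞ w (chartAt E x₀ x)) (a : E) :
    covAt D (coordField x₀ w) x a = chartInv x₀ (chartAt E x₀ x)
      (fderiv ℝ w (chartAt E x₀ x) (chartDer x₀ x a)) + connForm D x₀ x a (w (chartAt E x₀ x)) := by
  let b := Module.finBasis ℝ E
  let φ : ∀ i, E →L[ℝ] ℝ := fun i => LinearMap.toContinuousLinearMap (b.coord i)
  have hφ : ∀ v, ∑ i, φ i v • b i = v := b.sum_repr
  let f : Fin (Module.finrank ℝ E) → M → ℝ := fun i z => φ i (w (chartAt E x₀ z))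
  have hW := fun v : E => contMDiffAt_coordField hx (w := fun _ => v) contDiffAt_const
  have hf : ∀ i, ContDiffAt ℝ ∞ (fun y => φ i (w y)) (chartAt E x₀ x) := fun i =>
    (φ i).contDiff.contDiffAt.comp _ hw
  have hf' : ∀ i, HasMFDerivAt 𝓘(ℝ, E) 𝓘(ℝ, ℝ) (f i) x
      (((φ i).comp (fderiv ℝ w (chartAt E x₀ x))).comp (chartDer x₀ x) :) := by
    intro i
    refine hasMFDerivAt_of_chart hx ?_
    refine ((φ i).hasFDerivAt.comp _ (hw.differentiableAt (by simp)).hasFDerivAt).congr_of_eventuallyEq ?_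
    filter_upwards [(chartAt E x₀).open_target.mem_nhds ((chartAt E x₀).map_source hx)] with z hz
    simp [f, (chartAt E x₀).right_inv hz]
  have hfs : ∀ i, CMDiffAt ∞ (T% (coordField x₀ fun y => φ i (w y) • b i)) x := fun i =>
    contMDiffAt_coordField hx ((hf i).smul contDiffAt_const)
  have h1 : coordField x₀ w = ∑ i, coordField x₀ (fun y => φ i (w y) • b i) := by
    funext z
    rw [Finset.sum_apply]
    have : (chartInv x₀ (chartAt E x₀ z)) (w (chartAt E x₀ z)) =
        ∑ i, chartInv x₀ (chartAt E x₀ z) (φ i (w (chartAt E x₀ z)) • b i) := by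
      rw [← map_sum, hφ]
    exact this
  have h2 : ∀ i, coordField x₀ (fun y => φ i (w y) • b i) = f i • coordField x₀ (fun _ => b i) :=
    fun i => funext fun z => map_smul (chartInv x₀ (chartAt E x₀ z)) _ _
  have h3 : ∀ i, covAt D (coordField x₀ fun y => φ i (w y) • b i) x a
      = φ i (w (chartAt E x₀ x)) • covAt D (coordField x₀ fun _ => b i) x a
      + φ i (fderiv ℝ w (chartAt E x₀ x) (chartDer x₀ x a)) • chartInv x₀ (chartAt E x₀ x) (b i) := by
    intro i
    rw [h2, covAt_smul D (hW (b i)) (hf' i)]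
    rfl
  rw [h1, (covAt_sum D _ hfs).2, sum_apply, Finset.sum_congr rfl fun i _ => h3 i,
    Finset.sum_add_distrib, add_comm]
  congr 1
  · conv_rhs => rw [← hφ (fderiv ℝ w (chartAt E x₀ x) (chartDer x₀ x a)), map_sum]
    simp only [map_smul]
  · simp only [connForm, sum_apply]
    rfl

lemma covAt_coordField_const {x₀ x : M} (hx : x ∈ (chartAt E x₀).source) (v a : E) :
    covAt D (coordField x₀ fun _ => v) x a = connForm D x₀ x a v := by
  rw [covAt_coordField D hx contDiffAt_const]
  simp

/-- The Lie bracket at `x`, on the model space. -/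
def bracketAt (Y Z : ∀ x : M, TangentSpace 𝓘(ℝ, E) x) (x : M) : E :=
  VectorField.mlieBracket 𝓘(ℝ, E) Y Z x

/-- The torsion at `x`, on the model space. -/
def torsionAt (x : M) : E →L[ℝ] E →L[ℝ] E :=
  have : CompleteSpace E := FiniteDimensional.complete ℝ E
  have : IsManifold 𝓘(ℝ, E) 2 M := .of_le (n := ∞) (WithTop.coe_le_coe.mpr (le_top : (2 : ℕ∞) ≤ ⊤))
  D.torsion x

lemma torsionAt_apply {x : M} {Y Z : ∀ x : M, TangentSpace 𝓘(ℝ, E) x} (hY : CMDiffAt ∞ (T% Y) x)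
    (hZ : CMDiffAt ∞ (T% Z) x) {u v : E} (hu : Y x = u) (hv : Z x = v) : torsionAt D x u v =
      covAt D Z x u - covAt D Y x v - bracketAt Y Z x := by
  have : CompleteSpace E := FiniteDimensional.complete ℝ E
  have : IsManifold 𝓘(ℝ, E) 2 M := .of_le (n := ∞) (WithTop.coe_le_coe.mpr (le_top : (2 : ℕ∞) ≤ ⊤))
  subst hu hv
  exact D.torsion_apply (mdifferentiableAt_field hY) (mdifferentiableAt_field hZ)

lemma torsionAt_antisymm (x : M) (u v : E) : torsionAt D x u v = -torsionAt D x v u := by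
  have : CompleteSpace E := FiniteDimensional.complete ℝ E
  have : IsManifold 𝓘(ℝ, E) 2 M := .of_le (n := ∞) (WithTop.coe_le_coe.mpr (le_top : (2 : ℕ∞) ≤ ⊤))
  exact D.torsion_antisymm u v

/-- Coordinate fields commute, so the torsion is the antisymmetrization of the connection
coefficients. -/
lemma torsionAt_chartInv {x₀ x : M} (hx : x ∈ (chartAt E x₀).source) (u v : E) :
    torsionAt D x (chartInv x₀ (chartAt E x₀ x) u) (chartInv x₀ (chartAt E x₀ x) v) =
      connForm D x₀ x (chartInv x₀ (chartAt E x₀ x) u) v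
        - connForm D x₀ x (chartInv x₀ (chartAt E x₀ x) v) u := by
  have : CompleteSpace E := FiniteDimensional.complete ℝ E
  have hW := fun v : E => contMDiffAt_coordField hx (w := fun _ => v) contDiffAt_const
  have h0 : bracketAt (coordField x₀ fun _ => u) (coordField x₀ fun _ => v) x = 0 :=
    mlieBracket_coordField_const hx u v
  rw [torsionAt_apply D (hW u) (hW v) (u := chartInv x₀ (chartAt E x₀ x) u)
    (v := chartInv x₀ (chartAt E x₀ x) v) rfl rfl, h0, covAt_coordField_const D hx,
    covAt_coordField_const D hx, sub_zero]

end Connection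
end HKT

namespace HKT

/-! ### Frames adapted to the quaternionic Hermitian structure -/

section Adapted

open Filter Topology

variable {n : ℕ} {M : Type*} [TopologicalSpace M] [ChartedSpace (Model n) M]
  [IsManifold 𝓘(ℝ, Model n) ∞ M] (X : HypercomplexHermitian (Model n) M)

namespace HypercomplexHermitian

/-- The frame defining the Hodge star at `x`. -/
def stdFrame (x : M) : Fin (4 * n) → Model n := quatFrame (endAt X.I x) (endAt X.J x)
    (endAt X.K x) (X.frame x)

lemma isQuatOrthonormal_frame (x : M) :
    IsQuatOrthonormal (V := Model n) (X.metricAt x) (endAt X.I x) (endAt X.J x)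
    (endAt X.K x) (X.frame x) :=
  Classical.epsilon_spec ((X.quatHerm x).exists_isQuatOrthonormal (n := n) (by simp))

lemma isONB_stdFrame (x : M) : IsONB (X.metricAt x) (X.stdFrame x) :=
  (X.quatHerm x).isONB_quatFrame (by simp) (X.isQuatOrthonormal_frame x)

/-- A smooth frame near `x` adapted to the quaternionic Hermitian structure, compared with the
coordinate frame of the chart around `x`; `Z` is the covariant derivative of the frame at `x`. -/
structure AdaptedFrame (x : M) (D : CovariantDerivative 𝓘(ℝ, Model n) (Model n)
    (fun x : M => TangentSpace 𝓘(ℝ, Model n) x)) where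
  g : Model n → Model n →L[ℝ] Model n
  k : Model n → Model n →L[ℝ] Model n
  smooth_g : ContDiffAt ℝ ∞ g (chartAt (Model n) x x)
  smooth_k : ContDiffAt ℝ ∞ k (chartAt (Model n) x x)
  g_self : g (chartAt (Model n) x x) = 1
  k_self : k (chartAt (Model n) x x) = 1
  g_k : ∀ᶠ y in 𝓝 (chartAt (Model n) x x), ∀ v, g y (k y v) = v
  k_g : ∀ᶠ y in 𝓝 (chartAt (Model n) x x), ∀ v, k y (g y v) = v
  I_k : ∀ᶠ y in 𝓝 (chartAt (Model n) x x), ∀ v, endChart x X.I y (k y v) = k y (endAt X.I x v)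
  J_k : ∀ᶠ y in 𝓝 (chartAt (Model n) x x), ∀ v, endChart x X.J y (k y v) = k y (endAt X.J x v)
  K_k : ∀ᶠ y in 𝓝 (chartAt (Model n) x x), ∀ v, endChart x X.K y (k y v) = k y (endAt X.K x v)
  metric_k : ∀ᶠ y in 𝓝 (chartAt (Model n) x x), ∀ u v,
    X.metricChart x y (k y u) (k y v) = X.metricAt x u v
  Z : Model n →L[ℝ] Model n →L[ℝ] Model n
  Z_eq : ∀ a, Z a = fderiv ℝ k (chartAt (Model n) x x) a + connForm D x x a

omit [IsManifold 𝓘(ℝ, Model n) ∞ M] in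
lemma endChart_self (x : M) [IsManifold 𝓘(ℝ, Model n) ∞ M]
    (L : ∀ x : M, TangentSpace 𝓘(ℝ, Model n) x →L[ℝ] TangentSpace 𝓘(ℝ, Model n) x) :
    endChart x L (chartAt (Model n) x x) = endAt L x := by
  have h : ∀ z, z = x → (chartDer x z).comp
      ((endAt L z).comp (chartInv x (chartAt (Model n) x x))) = endAt L x := by
    rintro z rfl
    rw [chartDer_self, chartInv_self]
    rfl
  exact h _ ((chartAt (Model n) x).left_inv (mem_chart_source _ x))

lemma metricChart_self (x : M) : X.metricChart x (chartAt (Model n) x x) = X.metricAt x := by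
  rw [metricChart, (chartAt (Model n) x).left_inv (mem_chart_source _ x), chartInv_self]
  rfl

/-- The frame is the inverse `k` of the intertwiner `g`: it carries the constant structure of `T_x
M` to the varying one. -/
lemma nonempty_adaptedFrame (x : M) (D : CovariantDerivative 𝓘(ℝ, Model n) (Model n)
    (fun x : M => TangentSpace 𝓘(ℝ, Model n) x)) : Nonempty (X.AdaptedFrame x D) := by
  have hy := mem_chart_target (Model n) x
  have he := X.isONB_stdFrame x
  rw [← X.metricChart_self] at he
  obtain ⟨g, hg, hg1, hgev⟩ := exists_intertwiner he (X.contDiffAt_metricChart hy)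
    (contDiffAt_endChart X.smooth_I hy) (contDiffAt_endChart X.smooth_J hy)
    (contDiffAt_endChart X.smooth_K hy)
    (Filter.mem_of_superset ((chartAt (Model n) x).open_target.mem_nhds hy)
      fun y hy => X.quatHerm_chart hy)
  obtain ⟨hk, hk1, hinv⟩ := ContDiffAt.eventually_inverse hg hg1
  rw [metricChart_self, endChart_self, endChart_self, endChart_self] at hgev
  have hgk : ∀ᶠ y in 𝓝 (chartAt (Model n) x x), ∀ v, g y (Ring.inverse (g y) v) = v :=
    hinv.mono fun y h v => congrArg (fun f : Model n →L[ℝ] Model n => f v) h.1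
  have hkg : ∀ᶠ y in 𝓝 (chartAt (Model n) x x), ∀ v, Ring.inverse (g y) (g y v) = v :=
    hinv.mono fun y h v => congrArg (fun f : Model n →L[ℝ] Model n => f v) h.2
  refine ⟨⟨g, fun y => Ring.inverse (g y), hg, hk, hg1, hk1, hgk, hkg, ?_, ?_, ?_, ?_,
    fderiv ℝ (fun y => Ring.inverse (g y)) (chartAt (Model n) x x) + connForm D x x, fun a => rfl⟩⟩
  · filter_upwards [hgev, hgk, hkg] with y h h1 h2 v
    rw [← h1 v, ← h.1, h2, h2]
  · filter_upwards [hgev, hgk, hkg] with y h h1 h2 v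
    rw [← h1 v, ← h.2.1, h2, h2]
  · filter_upwards [hgev, hgk, hkg] with y h h1 h2 v
    rw [← h1 v, ← h.2.2.1, h2, h2]
  · filter_upwards [hgev, hgk] with y h h1 u v
    rw [← h.2.2.2, h1, h1]

end HypercomplexHermitian

end Adapted
end HKT

namespace HKT
namespace HypercomplexHermitian

/-! ### The Bismut connection in an adapted frame -/

section AdaptedFrame

open Filter Topology

variable {n : ℕ} {M : Type*} [TopologicalSpace M] [ChartedSpace (Model n) M]
  [IsManifold 𝓘(ℝ, Model n) ∞ M] {X : HypercomplexHermitian (Model n) M} {x : M}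
  {D : CovariantDerivative 𝓘(ℝ, Model n) (Model n) (fun x : M => TangentSpace 𝓘(ℝ, Model n) x)}

namespace AdaptedFrame

variable (f : X.AdaptedFrame x D)

/-- The vector fields of the frame. -/
def field (b : Model n) : ∀ z : M, TangentSpace 𝓘(ℝ, Model n) z := coordField x fun y => f.k y b

lemma smooth_kb (b : Model n) :
    ContDiffAt ℝ ∞ (fun y => f.k y b) (chartAt (Model n) x x) :=
  f.smooth_k.clm_apply contDiffAt_const

lemma smooth_field (b : Model n) : ContMDiffAt 𝓘(ℝ, Model n) 𝓘(ℝ, Model n).tangent ∞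
    (fun z => (⟨z, f.field b z⟩ : TangentBundle 𝓘(ℝ, Model n) M)) x :=
  contMDiffAt_coordField (mem_chart_source _ x) (f.smooth_kb b)

lemma field_self (b : Model n) : f.field b x = b := by
  have : chartInv x (chartAt (Model n) x x) (f.k (chartAt (Model n) x x) b) = b := by
    rw [chartInv_self, f.k_self]; rfl
  exact this

lemma covAt_field (a b : Model n) : covAt D (f.field b) x a = f.Z a b := by
  rw [field, covAt_coordField D (mem_chart_source _ x) (f.smooth_kb b), chartInv_self, chartDer_self,
    f.k_self, f.Z_eq]
  rw [((f.smooth_k.differentiableAt (by simp)).hasFDerivAt.clm_apply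
    (hasFDerivAt_const b _)).fderiv]
  simp

lemma eventually_end_field {L : ∀ x : M, TangentSpace 𝓘(ℝ, Model n) x →L[ℝ] TangentSpace 𝓘(ℝ, Model n) x}
    (hL : ∀ᶠ y in 𝓝 (chartAt (Model n) x x), ∀ v, endChart x L y (f.k y v) = f.k y (endAt L x v))
    (b : Model n) : ∀ᶠ z in 𝓝 x, L z (f.field b z) = f.field (endAt L x b) z := by
  have hc : ContinuousAt (chartAt (Model n) x) x :=
    (chartAt (Model n) x).continuousAt (mem_chart_source _ x)
  filter_upwards [hc.eventually hL, (chartAt (Model n) x).open_source.mem_nhds (mem_chart_source _ x)]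
    with z hz hzs
  have h1 := congrArg (chartInv x (chartAt (Model n) x z)) (hz b)
  rw [endChart, (chartAt (Model n) x).left_inv hzs] at h1
  exact (chartInv_chartDer hzs _).symm.trans h1

/-- `L` maps frame fields to frame fields with constant coefficients near `x`; applying `D`, which
preserves `L`, gives the commutation. -/
lemma Z_comm {L : ∀ x : M, TangentSpace 𝓘(ℝ, Model n) x →L[ℝ] TangentSpace 𝓘(ℝ, Model n) x}
    (hL : ∀ᶠ y in 𝓝 (chartAt (Model n) x x), ∀ v, endChart x L y (f.k y v) = f.k y (endAt L x v))
    (hD : X.IsBismut L D) (a b : Model n) : f.Z a (endAt L x b) = endAt L x (f.Z a b) := by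
  rw [← f.covAt_field, ← covAt_congr D (f.smooth_field _) (f.eventually_end_field hL b),
    ← f.covAt_field]
  exact hD.complex _ x (mdifferentiableAt_field (f.smooth_field b)) a

/-- The inner products of the frame fields are constant near `x`, so the derivative in the metric
compatibility of `D` is zero. -/
lemma Z_skew {L : ∀ x : M, TangentSpace 𝓘(ℝ, Model n) x →L[ℝ] TangentSpace 𝓘(ℝ, Model n) x}
    (hD : X.IsBismut L D) (a b c : Model n) :
    X.metricAt x (f.Z a b) c = -X.metricAt x b (f.Z a c) := by
  have h := hD.metric _ _ x (mdifferentiableAt_field (f.smooth_field b))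
    (mdifferentiableAt_field (f.smooth_field c)) a
  have hc : ContinuousAt (chartAt (Model n) x) x :=
    (chartAt (Model n) x).continuousAt (mem_chart_source _ x)
  have h2 : ∀ᶠ z in 𝓝 x, X.metric.inner z (f.field b z) (f.field c z) = X.metricAt x b c := by
    filter_upwards [hc.eventually f.metric_k,
      (chartAt (Model n) x).open_source.mem_nhds (mem_chart_source _ x)] with z hz hzs
    have h1 := hz b c
    rw [metricChart, (chartAt (Model n) x).left_inv hzs] at h1
    exact h1
  have h3 : mfderiv 𝓘(ℝ, Model n) 𝓘(ℝ, ℝ)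
      (fun y => X.metric.inner y (f.field b y) (f.field c y)) x = 0 :=
    (Filter.EventuallyEq.mfderiv_eq h2).trans mfderiv_const
  rw [h3] at h
  have h4 : (0 : ℝ) = X.metricAt x (covAt D (f.field b) x a) (f.field c x)
      + X.metricAt x (f.field b x) (covAt D (f.field c) x a) := h
  rw [f.covAt_field, f.covAt_field, f.field_self, f.field_self] at h4
  linarith

lemma torsionAt_eq (u v : Model n) : torsionAt D x u v =
    f.Z u v - f.Z v u - bracketAt (f.field u) (f.field v) x := by
  rw [torsionAt_apply D (f.smooth_field u) (f.smooth_field v) (f.field_self u) (f.field_self v),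
    f.covAt_field, f.covAt_field]

/-- In the vanishing Nijenhuis tensor each bracket is replaced by `Z` terms minus torsion. As `Z`
commutes with `L`, its contributions cancel and a condition on the torsion alone is left. -/
lemma torsionIntegrable {L : ∀ x : M, TangentSpace 𝓘(ℝ, Model n) x →L[ℝ] TangentSpace 𝓘(ℝ, Model n) x}
    (hL : ∀ᶠ y in 𝓝 (chartAt (Model n) x x), ∀ v, endChart x L y (f.k y v) = f.k y (endAt L x v))
    (hD : X.IsBismut L D) (hint : IsIntegrable L) (hsq : ∀ v, endAt L x (endAt L x v) = -v) :
    TorsionIntegrable (torsionAt D x) (endAt L x) := by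
  intro u v
  have h := hint (f.field u) (f.field v) x (f.smooth_field u) (f.smooth_field v)
  have e := f.eventually_end_field hL
  have e1 : VectorField.mlieBracket 𝓘(ℝ, Model n) (fun y => L y (f.field u y)) (f.field v) x
      = VectorField.mlieBracket 𝓘(ℝ, Model n) (f.field (endAt L x u)) (f.field v) x :=
    Filter.EventuallyEq.mlieBracket_vectorField_eq (e u) (Filter.EventuallyEq.refl _ _)
  have e2 : VectorField.mlieBracket 𝓘(ℝ, Model n) (f.field u) (fun y => L y (f.field v y)) x
      = VectorField.mlieBracket 𝓘(ℝ, Model n) (f.field u) (f.field (endAt L x v)) x :=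
    Filter.EventuallyEq.mlieBracket_vectorField_eq (Filter.EventuallyEq.refl _ _) (e v)
  rw [Filter.EventuallyEq.mlieBracket_vectorField_eq (e u) (e v), e1, e2] at h
  have h2 : bracketAt (f.field (endAt L x u)) (f.field (endAt L x v)) x
      - endAt L x (bracketAt (f.field (endAt L x u)) (f.field v) x)
      - endAt L x (bracketAt (f.field u) (f.field (endAt L x v)) x)
      - bracketAt (f.field u) (f.field v) x = 0 := h
  have key : ∀ u v, bracketAt (f.field u) (f.field v) x = f.Z u v - f.Z v u - torsionAt D x u v :=
    fun u v => by rw [f.torsionAt_eq]; abel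
  simp only [key, f.Z_comm hL hD, map_sub, hsq] at h2
  rw [← sub_eq_zero, ← h2]
  abel

end AdaptedFrame

end AdaptedFrame

end HypercomplexHermitian
end HKT

namespace HKT

/-! ### First-order jets of families of forms -/

section Jets

open Filter Topology ContinuousAlternatingMap

variable {V : Type*} [NormedAddCommGroup V] [NormedSpace ℝ V]

/-- The family `φ` of forms is differentiable at `y₀`, with derivative `ψ a` in the direction
`a`. -/
def HasJet (φ ψ : V → Ext V) (y₀ : V) : Prop :=
  ∀ k, ∃ L : V →L[ℝ] (V [⋀^Fin k]→L[ℝ] ℂ), HasFDerivAt (fun y => φ y k) L y₀ ∧ ∀ a, L a = ψ a k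

lemma HasJet.congr {φ φ' ψ : V → Ext V} {y₀ : V} (h : HasJet φ ψ y₀)
    (hφ : ∀ᶠ y in 𝓝 y₀, φ' y = φ y) : HasJet φ' ψ y₀ := by
  intro k
  obtain ⟨L, hL, h2⟩ := h k
  exact ⟨L, hL.congr_of_eventuallyEq (hφ.mono fun y hy => congrFun hy k), h2⟩

lemma HasJet.congr_jet {φ ψ ψ' : V → Ext V} {y₀ : V} (h : HasJet φ ψ y₀)
    (hψ : ∀ a, ψ' a = ψ a) : HasJet φ ψ' y₀ := by
  rwa [show ψ' = ψ from funext hψ]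

lemma HasJet.const (η : Ext V) (y₀ : V) : HasJet (fun _ => η) (fun _ => 0) y₀ :=
  fun _ => ⟨0, hasFDerivAt_const _ _, fun _ => rfl⟩

instance finiteDimensional_form [FiniteDimensional ℝ V] {k : ℕ} : FiniteDimensional ℝ (V [⋀^Fin k]→L[ℝ] ℂ) := by
  let f : (V [⋀^Fin k]→L[ℝ] ℂ) →ₗ[ℝ] MultilinearMap ℝ (fun _ : Fin k => V) ℂ :=
    { toFun := fun φ => φ.toMultilinearMap
      map_add' := fun _ _ => rfl
      map_smul' := fun _ _ => rfl }
  refine FiniteDimensional.of_injective f fun φ φ' h => ?_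
  ext v
  exact congrArg (fun m : MultilinearMap ℝ (fun _ : Fin k => V) ℂ => m v) h

/-- By `hloc` each output degree depends on a single input degree, so `Op` is there a linear map
between finite-dimensional spaces. Only real linearity is required, because the star operator is
conjugate-linear. -/
lemma HasJet.map [FiniteDimensional ℝ V] {φ ψ : V → Ext V} {y₀ : V} (h : HasJet φ ψ y₀)
    {Op : Ext V → Ext V} (hadd : ∀ η ζ, Op (η + ζ) = Op η + Op ζ)
    (hsmul : ∀ (c : ℝ) η, Op ((c : ℂ) • η) = (c : ℂ) • Op η)
    (hloc : ∀ l, ∃ k, ∀ η, η k = 0 → Op η l = 0) :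
    HasJet (fun y => Op (φ y)) (fun a => Op (ψ a)) y₀ := by
  intro l
  obtain ⟨k, hk⟩ := hloc l
  obtain ⟨L, hL, h2⟩ := h k
  have hcongr : ∀ η ζ : Ext V, η k = ζ k → Op η l = Op ζ l := by
    intro η ζ h
    have h3 : Op ζ l + Op (η - ζ) l = Op η l := by
      rw [← Pi.add_apply, ← hadd, add_sub_cancel]
    rw [← h3, hk (η - ζ) (by rw [Pi.sub_apply, h, sub_self]), add_zero]
  let C : (V [⋀^Fin k]→L[ℝ] ℂ) →L[ℝ] (V [⋀^Fin l]→L[ℝ] ℂ) := LinearMap.toContinuousLinearMap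
    { toFun := fun α => Op (ofDegree α) l
      map_add' := fun α β => by
        rw [← Pi.add_apply, ← hadd]
        refine hcongr _ _ ?_
        simp [ofDegree_self]
      map_smul' := fun c α => by
        have h4 : (RingHom.id ℝ c) • Op (ofDegree α) l = ((c : ℂ) • Op (ofDegree α)) l := by
          ext v; simp
        rw [h4, ← hsmul]
        refine hcongr _ _ ?_
        ext v
        simp [ofDegree_self] }
  have hC : ∀ η : Ext V, C (η k) = Op η l := fun η => hcongr _ _ (by rw [ofDegree_self])
  refine ⟨C.comp L, ?_, fun a => ?_⟩
  · simp only [← hC]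
    exact C.hasFDerivAt.comp y₀ hL
  · rw [ContinuousLinearMap.comp_apply, h2, hC]

/-- At the identity the derivative of `A ↦ pull A` is the derivation `der`. -/
lemma HasJet.pull {φ ψ : V → Ext V} {y₀ : V} (h : HasJet φ ψ y₀) {g : V → V →L[ℝ] V}
    {g' : V →L[ℝ] V →L[ℝ] V} (hg : HasFDerivAt g g' y₀) (hg1 : g y₀ = 1) :
    HasJet (fun y => HKT.pull (g y) (φ y)) (fun a => ψ a + der (g' a) (φ y₀)) y₀ := by
  intro k
  obtain ⟨L, hL, h2⟩ := h k
  have h3 := hL.continuousAlternatingMapCompContinuousLinearMap hg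
  rw [hg1] at h3
  refine ⟨_, h3, fun a => ?_⟩
  change compContinuousLinearMapCLM (1 : V →L[ℝ] V) (L a)
    + (φ y₀ k).fderivCompContinuousLinearMap (.id ℝ V) (g' a) = _
  rw [h2]
  rfl

lemma HasJet.extDeriv {N : ℕ} {s : V →L[ℝ] V →L[ℝ] ℝ} {e : Fin N → V} (he : IsONB s e)
    {φ ψ : V → Ext V} {y₀ : V} (h : HasJet φ ψ y₀) (k : ℕ) :
    _root_.extDeriv (fun y => φ y k) y₀ = (∑ a, eps (cov s (e a)) (ψ (e a))) (k + 1) := by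
  obtain ⟨L, hL, h2⟩ := h k
  have h3 : L = ∑ a, (cov s (e a)).smulRight (ψ (e a) k) := by
    ext1 v
    conv_lhs => rw [← he.expand v, _root_.map_sum]
    simp only [← h2, _root_.sum_apply]
    refine Finset.sum_congr rfl fun a _ => ?_
    ext w
    simp [cov]
  rw [_root_.extDeriv, hL.fderiv, h3, Finset.sum_apply]
  simp only [eps_succ]
  exact _root_.map_sum (alternatizeUncurryFinCLM ℝ V ℂ) _ _

end Jets
end HKT

namespace HKT

/-! ### Covariant derivatives of forms and the exterior derivative -/

section CovJet

/-- Under `∑ e^a ∧ e^c ∧` only the antisymmetric part `½ T` of `Γ` survives. -/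
lemma IsONB.sum_eps_der {V : Type*} [NormedAddCommGroup V] [NormedSpace ℝ V] {N : ℕ}
    {s : V →L[ℝ] V →L[ℝ] ℝ} {e : Fin N → V} (h : IsONB s e) {Γ T : V →L[ℝ] V →L[ℝ] V}
    (hT : ∀ u v, T u v = Γ u v - Γ v u) (η : Ext V) :
    ∑ a, (1 / 2 : ℂ) • eps (cov s (e a)) (der (T (e a)) η) =
      ∑ a, eps (cov s (e a)) (der (Γ (e a)) η) := by
  have key : ∀ Γ : V →L[ℝ] V →L[ℝ] V, ∑ a, eps (cov s (e a)) (der (Γ (e a)) η)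
      = wedgeInn s e (fun u v => Γ u v) η := by
    intro Γ
    refine Finset.sum_congr rfl fun a _ => ?_
    rw [h.der_expand, ← map_sum (eps (cov s (e a)))]
    exact congrArg _ (h.sum_comp (Γ (e a))
      (((LinearMap.applyₗ (R := ℂ) η).restrictScalars ℝ) ∘ₗ inn))
  rw [← Finset.smul_sum, key, key]
  have h1 : (fun u v => T u v) = fun u v => Γ u v + -Γ v u := by
    funext u v; rw [hT, sub_eq_add_neg]
  rw [h1, wedgeInn_add, wedgeInn_neg, wedgeInn_swap (fun u v => Γ u v), neg_neg, ← ext_two_smul,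
    smul_smul]
  norm_num

open Filter Topology

variable {n : ℕ} {M : Type*} [TopologicalSpace M] [ChartedSpace (Model n) M]

/-- The value at `x` of a form, on the model space. -/
def formAt (φ : Form (Model n) M) (x : M) : Ext (Model n) := φ x

variable [IsManifold 𝓘(ℝ, Model n) ∞ M] {X : HypercomplexHermitian (Model n) M} {x : M}
  {D : CovariantDerivative 𝓘(ℝ, Model n) (Model n) (fun x : M => TangentSpace 𝓘(ℝ, Model n) x)}

namespace HypercomplexHermitian.AdaptedFrame

variable (f : X.AdaptedFrame x D)

/-- The frame at the point with coordinate `y`. -/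
def frameMap (y : Model n) : Model n →L[ℝ] Model n := (chartInv x y).comp (f.k y)

/-- The expression of a form in the frame. -/
def rep (φ : Form (Model n) M) (y : Model n) : Ext (Model n) :=
  pull (f.frameMap y) (formAt φ ((chartAt (Model n) x).symm y))

lemma rep_self (φ : Form (Model n) M) : f.rep φ (chartAt (Model n) x x) = formAt φ x := by
  rw [rep, frameMap, f.k_self, chartInv_self, (chartAt (Model n) x).left_inv (mem_chart_source _ x)]
  rfl

lemma eventually_end_frameMap
    {L : ∀ x : M, TangentSpace 𝓘(ℝ, Model n) x →L[ℝ] TangentSpace 𝓘(ℝ, Model n) x}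
    (hL : ∀ᶠ y in 𝓝 (chartAt (Model n) x x), ∀ v, endChart x L y (f.k y v) = f.k y (endAt L x v)) :
    ∀ᶠ y in 𝓝 (chartAt (Model n) x x), ∀ v,
      endAt L ((chartAt (Model n) x).symm y) (f.frameMap y v) = f.frameMap y (endAt L x v) := by
  filter_upwards [hL, (chartAt (Model n) x).open_target.mem_nhds (mem_chart_target _ x)] with y h hy v
  have h1 := congrArg (chartInv x y) (h v)
  have h2 := chartInv_chartDer ((chartAt (Model n) x).map_target hy)
    (endAt L ((chartAt (Model n) x).symm y) (f.frameMap y v))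
  rw [(chartAt (Model n) x).right_inv hy] at h2
  exact h2.symm.trans h1

lemma eventually_rep_actJInv (φ : Form (Model n) M) : ∀ᶠ y in 𝓝 (chartAt (Model n) x x),
    f.rep (X.actJInv φ) y = pull (endAt X.J x) (f.rep φ y) := by
  filter_upwards [f.eventually_end_frameMap f.J_k] with y h
  refine ext_ext fun k v => congrArg (formAt φ ((chartAt (Model n) x).symm y) k) ?_
  funext i
  exact h (v i)

/-- The frame carries the standard quaternionic basis at `x` to an orthonormal quaternionic basis at
the nearby point. The star there was defined by a possibly different, non-smoothly chosen basis, but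
does not depend on it. -/
lemma eventually_rep_star (φ : Form (Model n) M) : ∀ᶠ y in 𝓝 (chartAt (Model n) x x),
    f.rep (X.star φ) y = hodge (X.metricAt x) (X.stdFrame x) (f.rep φ y) := by
  filter_upwards [f.eventually_end_frameMap f.I_k, f.eventually_end_frameMap f.J_k,
    f.eventually_end_frameMap f.K_k, f.metric_k] with y hI hJ hK hs
  set z := (chartAt (Model n) x).symm y
  have hs' : ∀ u v, X.metricAt z (f.frameMap y u) (f.frameMap y v) = X.metricAt x u v := hs
  have hframe : f.frameMap y ∘ X.stdFrame x = quatFrame (endAt X.I z) (endAt X.J z) (endAt X.K z)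
      (fun i => f.frameMap y (X.frame x i)) := by
    funext j
    simp only [Function.comp_apply, stdFrame, quatFrame]
    generalize (finProdFinEquiv.symm j).2 = i
    generalize (finProdFinEquiv.symm j).1 = p
    fin_cases p
    · rfl
    · exact (hI _).symm
    · exact (hJ _).symm
    · exact (hK _).symm
  have q := X.quatHerm z
  have hu : IsONB (X.metricAt z) (quatFrame (endAt X.I z) (endAt X.J z) (endAt X.K z)
      (fun i => f.frameMap y (X.frame x i))) := by
    refine q.isONB_quatFrame (by simp) fun a b => ?_
    rw [← hframe]
    exact (hs' _ _).trans (X.isQuatOrthonormal_frame x a b)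
  have h1 : formAt (X.star φ) z = hodge (X.metricAt z) (f.frameMap y ∘ X.stdFrame x) (formAt φ z) := by
    rw [hframe]
    exact hodge_quatFrame q.I_sq q.I_J (X.isONB_stdFrame z) hu _
  rw [rep, h1, pull_hodge hs']
  rfl

lemma formAt_Omega (z : M) : ∃ ϖ : Model n [⋀^Fin 2]→L[ℝ] ℂ, formAt X.Omega z = ofDegree ϖ ∧
    ∀ v, ϖ v = (1 / 2 : ℂ) * (X.metricAt z (v 0) (endAt X.J z (v 1))
      + Complex.I * X.metricAt z (v 0) (endAt X.K z (v 1))) :=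
  ⟨_, rfl, fun _ => rfl⟩

lemma eventually_rep_LOmega (φ : Form (Model n) M) : ∀ᶠ y in 𝓝 (chartAt (Model n) x x),
    f.rep (X.LOmega φ) y =
      mulOmega (X.metricAt x) (X.stdFrame x) (endAt X.J x) (endAt X.K x) (f.rep φ y) := by
  filter_upwards [f.eventually_end_frameMap f.J_k,
    f.eventually_end_frameMap f.K_k, f.metric_k] with y hJ hK hs
  set z := (chartAt (Model n) x).symm y
  have hs' : ∀ u v, X.metricAt z (f.frameMap y u) (f.frameMap y v) = X.metricAt x u v := hs
  obtain ⟨ϖ, h1, h2⟩ := formAt_Omega (X := X) z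
  have h3 : formAt (X.LOmega φ) z = wedge (formAt X.Omega z) (formAt φ z) := rfl
  rw [rep, h3, h1, pull_wedge, pull_ofDegree, (X.isONB_stdFrame x).wedge_omega (J := endAt X.J x)
    (K := endAt X.K x)]
  · rfl
  · intro v
    rw [ContinuousAlternatingMap.compContinuousLinearMap_apply, h2]
    simp only [Function.comp_apply, hJ, hK, hs']

lemma pull_wedgePow {V : Type*} [NormedAddCommGroup V] [NormedSpace ℝ V] (A : V →L[ℝ] V)
    (α : Ext V) (m : ℕ) : pull A (wedgePow α m) = wedgePow (pull A α) m := by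
  induction m with
  | zero => exact pull_one A
  | succ m ih => rw [wedgePow, wedgePow, pull_wedge, ih]

omit [IsManifold 𝓘(ℝ, Model n) ∞ M] in
lemma formAt_wedgePow (φ : Form (Model n) M) (m : ℕ) (z : M) :
    formAt (fun x => wedgePow (φ x) m) z = wedgePow (formAt φ z) m := by
  induction m with
  | zero => rfl
  | succ m ih => exact congrArg (wedge (formAt φ z)) ih

lemma formAt_omegaPow (m : ℕ) (z : M) : formAt (fun x => wedgePow (X.Omega x) m) z =
    (mulOmega (X.metricAt z) (X.stdFrame z) (endAt X.J z) (endAt X.K z) ^ m) one := by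
  obtain ⟨ϖ, h1, h2⟩ := formAt_Omega (X := X) z
  rw [formAt_wedgePow, h1, (X.isONB_stdFrame z).wedgePow_omega h2]

lemma eventually_rep_omegaPow (m : ℕ) : ∀ᶠ y in 𝓝 (chartAt (Model n) x x),
    f.rep (fun x => wedgePow (X.Omega x) m) y =
      (mulOmega (X.metricAt x) (X.stdFrame x) (endAt X.J x) (endAt X.K x) ^ m) one := by
  filter_upwards [f.eventually_end_frameMap f.J_k,
    f.eventually_end_frameMap f.K_k, f.metric_k] with y hJ hK hs
  set z := (chartAt (Model n) x).symm y
  have hs' : ∀ u v, X.metricAt z (f.frameMap y u) (f.frameMap y v) = X.metricAt x u v := hs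
  obtain ⟨ϖ, h1, h2⟩ := formAt_Omega (X := X) z
  rw [rep, formAt_wedgePow, h1, pull_wedgePow, pull_ofDegree, (X.isONB_stdFrame x).wedgePow_omega]
  intro v
  rw [ContinuousAlternatingMap.compContinuousLinearMap_apply, h2]
  simp only [Function.comp_apply, hJ, hK, hs']

/-- `ψ a` is the covariant derivative of the form `φ` at `x` in the direction `a`. -/
def HasCovJet (φ : Form (Model n) M) (ψ : Model n → Ext (Model n)) : Prop :=
  HasJet (f.rep φ) (fun a => ψ a + der (f.Z a) (formAt φ x)) (chartAt (Model n) x x)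

variable {f} in
-- An operator with constant coefficients in the adapted frame that commutes with the connection
-- matrices is parallel, so it may be applied to the covariant derivative.
lemma HasCovJet.map {φ Φ : Form (Model n) M} {ψ : Model n → Ext (Model n)} (h : f.HasCovJet φ ψ)
    {Op : Ext (Model n) → Ext (Model n)} (hadd : ∀ η ζ, Op (η + ζ) = Op η + Op ζ)
    (hsmul : ∀ (c : ℝ) η, Op ((c : ℂ) • η) = (c : ℂ) • Op η)
    (hloc : ∀ l, ∃ k, ∀ η, η k = 0 → Op η l = 0)
    (hrep : ∀ᶠ y in 𝓝 (chartAt (Model n) x x), f.rep Φ y = Op (f.rep φ y))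
    (hZ : ∀ a η, Op (der (f.Z a) η) = der (f.Z a) (Op η)) :
    f.HasCovJet Φ fun a => Op (ψ a) := by
  have h1 := ((HasJet.map h hadd hsmul hloc).congr hrep)
  have h2 := hrep.self_of_nhds
  rw [f.rep_self, f.rep_self] at h2
  refine h1.congr_jet fun a => ?_
  rw [hadd, hZ, h2]

/-- `Z a` is skew and commutes with `J` and `K`, so its derivation annihilates `Ω`. -/
lemma der_Z_mulOmega (hJ : X.IsBismut X.J D) (hK : X.IsBismut X.K D) (a : Model n)
    (η : Ext (Model n)) :
    der (f.Z a) (mulOmega (X.metricAt x) (X.stdFrame x) (endAt X.J x) (endAt X.K x) η) =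
      mulOmega (X.metricAt x) (X.stdFrame x) (endAt X.J x) (endAt X.K x) (der (f.Z a) η) := by
  have h : ∀ b, innDerOmega (X.metricAt x) (endAt X.J x) (endAt X.K x) (f.Z a) b = 0 := by
    intro b
    ext v
    simp only [innDerOmega, _root_.add_apply, ContinuousLinearMap.comp_apply, innOmega_apply,
      ← f.Z_comm f.J_k hJ, ← f.Z_comm f.K_k hK, f.Z_skew hJ a b]
    simp
    ring
  rw [(X.isONB_stdFrame x).der_mulOmega]
  simp only [h, map_zero, LinearMap.zero_apply, Finset.sum_const_zero]
  rw [smul_zero_ext, add_zero]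

lemma hasCovJet_omegaPow (hJ : X.IsBismut X.J D) (hK : X.IsBismut X.K D) (m : ℕ) :
    f.HasCovJet (fun x => wedgePow (X.Omega x) m) fun _ => 0 := by
  refine ((HasJet.const _ _).congr (f.eventually_rep_omegaPow m)).congr_jet fun a => ?_
  rw [formAt_omegaPow, zero_add]
  induction m with
  | zero => exact der_one _
  | succ m ih => rw [pow_succ', Module.End.mul_apply, f.der_Z_mulOmega hJ hK, ih, map_zero]

/-- The expression of an inhomogeneous form in the chart around `x₀`. -/
def extChart (x₀ : M) (φ : Form (Model n) M) (y : Model n) : Ext (Model n) :=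
  pull (chartInv x₀ y) (formAt φ ((chartAt (Model n) x₀).symm y))

lemma exists_hasCovJet {φ : Form (Model n) M} (hφ : IsSmooth φ) : ∃ ψ, f.HasCovJet φ ψ := by
  have h1 : ∀ k, DifferentiableAt ℝ (fun y => extChart x φ y k) (chartAt (Model n) x x) := fun k =>
    ((hφ k x).contDiffAt ((chartAt (Model n) x).open_target.mem_nhds
      (mem_chart_target _ x))).differentiableAt (by simp)
  have h2 : HasJet (extChart x φ)
      (fun a k => fderiv ℝ (fun y => extChart x φ y k) (chartAt (Model n) x x) a)
      (chartAt (Model n) x x) := fun k => ⟨_, (h1 k).hasFDerivAt, fun a => rfl⟩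
  have h3 := h2.pull (f.smooth_k.differentiableAt (by simp)).hasFDerivAt f.k_self
  exact ⟨_, h3.congr_jet (ψ' := fun a => (_ - der (f.Z a) (formAt φ x)) + der (f.Z a) (formAt φ x))
    fun a => sub_add_cancel _ _⟩

variable {f} in
-- Back from the frame to the chart. Since `g` and `k` are inverse and equal to `1` at the base
-- point, their derivatives there are opposite; this removes the derivative of `k` from `Z` and
-- leaves `connForm`.
lemma HasCovJet.hasJet {φ : Form (Model n) M} {ψ : Model n → Ext (Model n)} (h : f.HasCovJet φ ψ) :
    HasJet (extChart x φ) (fun a => ψ a + der (connForm D x x a) (formAt φ x))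
      (chartAt (Model n) x x) := by
  have hk := (f.smooth_k.differentiableAt (by simp)).hasFDerivAt
  have hg := (f.smooth_g.differentiableAt (by simp)).hasFDerivAt
  have h1 := HasJet.pull h hg f.g_self
  have h2 : ∀ a, fderiv ℝ f.g (chartAt (Model n) x x) a = -fderiv ℝ f.k (chartAt (Model n) x x) a := by
    intro a
    have h3 := hg.clm_comp hk
    have h4 : HasFDerivAt (fun y => (f.g y).comp (f.k y)) (0 : _ →L[ℝ] _) (chartAt (Model n) x x) := by
      refine (hasFDerivAt_const (1 : Model n →L[ℝ] Model n) _).congr_of_eventuallyEq ?_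
      filter_upwards [f.g_k] with y hy
      ext1 v
      exact hy v
    have h5 := congrArg (fun T => T a) (h3.unique h4)
    rw [f.g_self, f.k_self] at h5
    rw [← add_eq_zero_iff_eq_neg, add_comm]
    exact h5
  refine (h1.congr ?_).congr_jet fun a => ?_
  · filter_upwards [f.k_g] with y hy
    refine ext_ext fun k v => congrArg (formAt φ ((chartAt (Model n) x).symm y) k) ?_
    funext i
    exact congrArg (chartInv x y) (hy (v i)).symm
  · rw [f.rep_self, h2, f.Z_eq, map_neg, map_add]
    simp only [LinearMap.add_apply, LinearMap.neg_apply]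
    abel

variable {f} in
-- Antisymmetrization of the coordinate derivatives gives `∑ e^a ∧ (ψ a + der (connForm a))`, and
-- only the torsion half of `connForm` survives. The chart is centred at `x`, so its derivative
-- there is the identity.
lemma HasCovJet.extD_eq {φ : Form (Model n) M} {ψ : Model n → Ext (Model n)} (h : f.HasCovJet φ ψ)
    (k : ℕ) : extD (fun z => φ z k) x = (∑ a, eps (cov (X.metricAt x) (X.stdFrame x a))
      (ψ (X.stdFrame x a) + (1 / 2 : ℂ) • der (torsionAt D x (X.stdFrame x a)) (formAt φ x)))
        (k + 1) := by
  have he := X.isONB_stdFrame x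
  have h1 := h.hasJet.extDeriv he k
  have h2 : extD (fun z => φ z k) x
      = (extDeriv (fun y => extChart x φ y k) (chartAt (Model n) x x)).compContinuousLinearMap
        (chartDer x x) := rfl
  have h3 : ∀ u v, torsionAt D x u v = connForm D x x u v - connForm D x x v u := by
    intro u v
    have := torsionAt_chartInv D (mem_chart_source (Model n) x) u v
    rwa [chartInv_self] at this
  rw [h2, h1, chartDer_self]
  simp only [map_add, Finset.sum_add_distrib, map_smul]
  rw [← he.sum_eps_der h3]
  rfl

end HypercomplexHermitian.AdaptedFrame

end CovJet
end HKT

namespace HKT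

/-! ### Endomorphisms anticommuting with `I` -/

section AntiInvariant

variable {V : Type*} [NormedAddCommGroup V] [NormedSpace ℝ V]
  {N : ℕ} {s : V →L[ℝ] V →L[ℝ] ℝ} {e : Fin N → V} {I : V →L[ℝ] V}

lemma rot_anticomm {R : V →L[ℝ] V} (hR : ∀ v, R (I v) = -I (R v)) (t : ℝ) :
    R.comp (rot I t) = (rot I (-t)).comp R := by
  ext v
  simp [rot, hR]

lemma HasWeight.comp_anti {R : V →L[ℝ] V} (hR : ∀ v, R (I v) = -I (R v)) {k : ℕ} {w : ℤ}
    {φ : V [⋀^Fin k]→L[ℝ] ℂ} (hφ : HasWeight I w φ) :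
    HasWeight I (-w) (φ.compContinuousLinearMap R) := by
  intro t
  have h1 : (φ.compContinuousLinearMap R).compContinuousLinearMap (rot I t)
      = φ.compContinuousLinearMap (R.comp (rot I t)) := rfl
  have h2 : φ.compContinuousLinearMap ((rot I (-t)).comp R)
      = (φ.compContinuousLinearMap (rot I (-t))).compContinuousLinearMap R := rfl
  rw [h1, rot_anticomm hR, h2, hφ]
  ext v
  simp

/-- An endomorphism anticommuting with `I` exchanges the types `(p, q)` and `(q, p)`. -/
lemma IsONB.typeComp_comp_anti (h : IsONB s e) (hI : ∀ v, I (I v) = -v) {R : V →L[ℝ] V}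
    (hR : ∀ v, R (I v) = -I (R v)) {k p q : ℕ} (hk : k = p + q) (φ : V [⋀^Fin k]→L[ℝ] ℂ) :
    (typeComp I p q φ).compContinuousLinearMap R =
      typeComp I q p (φ.compContinuousLinearMap R) := by
  have h2 : ∀ pq ∈ Finset.HasAntidiagonal.antidiagonal k, HasWeight I (-((pq.1 : ℤ) - pq.2))
      ((typeComp I pq.1 pq.2 φ).compContinuousLinearMap R) := fun pq hpq =>
    (isOfType_typeComp h hI (Finset.HasAntidiagonal.mem_antidiagonal.mp hpq).symm
      _).hasWeight.comp_anti hR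
  have h1 : φ.compContinuousLinearMap R = ∑ pq ∈ Finset.HasAntidiagonal.antidiagonal k,
      (typeComp I pq.1 pq.2 φ).compContinuousLinearMap R := by
    conv_lhs => rw [← sum_typeComp h hI φ]
    exact _root_.map_sum (ContinuousAlternatingMap.compContinuousLinearMapₗ (N := ℂ) (ι := Fin k) R)
      (fun pq : ℕ × ℕ => typeComp I pq.1 pq.2 φ) _
  rw [h1, ← typeCompL_apply I q p, _root_.map_sum]
  simp only [typeCompL_apply]
  have hm : (p, q) ∈ Finset.HasAntidiagonal.antidiagonal k :=
    Finset.HasAntidiagonal.mem_antidiagonal.mpr hk.symm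
  rw [Finset.sum_eq_single_of_mem (p, q) hm]
  · rw [(h2 _ hm).typeComp h hI (by omega), if_pos (by simp only; omega)]
  · rintro ⟨p1, q1⟩ hp hne
    rw [(h2 _ hp).typeComp h hI (by omega), if_neg]
    rw [Finset.HasAntidiagonal.mem_antidiagonal] at hp
    intro h3
    apply hne
    simp only at h3 hp
    rw [Prod.mk.injEq]; omega

lemma HasWeight.isOfType {k p q : ℕ} {w : ℤ} {φ : V [⋀^Fin k]→L[ℝ] ℂ} (hφ : HasWeight I w φ)
    (hk : k = p + q) (hw : w = p - q) : IsOfType I p q φ :=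
  ⟨hk, fun t => by rw [hφ t, hw]; push_cast; rfl⟩

end AntiInvariant

/-! ### Dolbeault operators on forms of pure type -/

section Dolbeault

variable {E : Type*} [NormedAddCommGroup E] [NormedSpace ℝ E]
  {M : Type*} [TopologicalSpace M] [ChartedSpace E M]

lemma extD_congr {k : ℕ} {φ φ' : ∀ x : M, TangentSpace 𝓘(ℝ, E) x [⋀^Fin k]→L[ℝ] ℂ}
    (h : ∀ x, φ x = φ' x) (x : M) : extD φ x = extD φ' x := by
  rw [show φ = φ' from funext h]

lemma extD_zero {k : ℕ} (x : M) :
    extD (fun x => (0 : TangentSpace 𝓘(ℝ, E) x [⋀^Fin k]→L[ℝ] ℂ)) x = 0 := by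
  have h1 : inChart x (fun x : M => (0 : TangentSpace 𝓘(ℝ, E) x [⋀^Fin k]→L[ℝ] ℂ))
      = fun _ => 0 := rfl
  rw [extD, h1]
  have h2 : extDeriv (fun _ : E => (0 : E [⋀^Fin k]→L[ℝ] ℂ)) (chartAt E x x) = 0 := by
    rw [extDeriv, fderiv_const_apply]
    exact map_zero (ContinuousAlternatingMap.alternatizeUncurryFinCLM ℝ E ℂ)
  rw [h2]
  rfl

variable {L : ∀ x : M, TangentSpace 𝓘(ℝ, E) x →L[ℝ] TangentSpace 𝓘(ℝ, E) x} {φ : Form E M}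

/-- The form has pure type everywhere, so only one summand is nonzero. The map `F` is left free in
order to serve both `del` and `delbar`. -/
lemma sum_typeComp_extD {k p q : ℕ}
    (h : ∀ x, IsOfType (L x) p q (φ x k)) (x : M)
    (F : ℕ → ℕ → TangentSpace 𝓘(ℝ, E) x [⋀^Fin (k + 1)]→L[ℝ] ℂ →
      TangentSpace 𝓘(ℝ, E) x [⋀^Fin (k + 1)]→L[ℝ] ℂ)
    (hF : ∀ p q, F p q 0 = 0) :
    ∑ pq ∈ Finset.HasAntidiagonal.antidiagonal k,
      F pq.1 pq.2 (extD (fun y => typeComp (L y) pq.1 pq.2 (φ y k)) x)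
      = F p q (extD (fun y => φ y k) x) := by
  have hk := (h x).1
  rw [Finset.sum_eq_single_of_mem (p, q) (Finset.HasAntidiagonal.mem_antidiagonal.mpr hk.symm)]
  · have h1 : ∀ y, typeComp (L y) p q (φ y k) = φ y k := fun y => by
      rw [typeComp_of_isOfType _ hk (h y), if_pos rfl]
    exact congrArg (F p q) (extD_congr h1 x)
  · rintro ⟨p', q'⟩ hpq hne
    rw [Finset.HasAntidiagonal.mem_antidiagonal] at hpq
    have h1 : ∀ y, typeComp (L y) p' q' (φ y k) = 0 := fun y => by
      rw [typeComp_of_isOfType _ hpq.symm (h y), if_neg]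
      rintro rfl
      apply hne
      simp only at hpq
      rw [Prod.mk.injEq]; omega
    exact (congrArg (F p' q') ((extD_congr h1 x).trans (extD_zero x))).trans (hF _ _)

lemma del_of_isOfType {k p q : ℕ} (h : ∀ x, IsOfType (L x) p q (φ x k)) (x : M) :
    del L φ x (k + 1) = typeComp (L x) (p + 1) q (extD (fun y => φ y k) x) :=
  sum_typeComp_extD h x (fun p' q' α => typeComp (L x) (p' + 1) q' α) fun _ _ =>
    typeComp_zero (V := E) (L x) _ _ _

lemma delbar_of_isOfType {k p q : ℕ} (h : ∀ x, IsOfType (L x) p q (φ x k)) (x : M) :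
    delbar L φ x (k + 1) = typeComp (L x) p (q + 1) (extD (fun y => φ y k) x) :=
  sum_typeComp_extD h x (fun p' q' α => typeComp (L x) p' (q' + 1) α) fun _ _ =>
    typeComp_zero (V := E) (L x) _ _ _

end Dolbeault
end HKT

namespace HKT

/-! ### `∂^*` through the Bismut connection -/

section Operators

open Filter Topology

lemma mulOmega_of_lt {V : Type*} [NormedAddCommGroup V] [NormedSpace ℝ V] {N : ℕ}
    {s : V →L[ℝ] V →L[ℝ] ℝ} {e : Fin N → V} {J K : V →L[ℝ] V} (η : Ext V) {k : ℕ} (hk : k < 2) :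
    mulOmega s e J K η k = 0 := by
  rw [mulOmega_apply, Pi.smul_apply, Finset.sum_apply]
  refine (congrArg _ (Finset.sum_eq_zero fun b _ => ?_)).trans (smul_zero_form _)
  interval_cases k
  · rfl
  · refine (eps_congr (k := 0) (ζ := 0) rfl _).trans ?_
    rw [map_zero]
    rfl

variable {n : ℕ} {M : Type*} [TopologicalSpace M] [ChartedSpace (Model n) M]
  [IsManifold 𝓘(ℝ, Model n) ∞ M] {X : HypercomplexHermitian (Model n) M} {x : M}
  {D : CovariantDerivative 𝓘(ℝ, Model n) (Model n) (fun x : M => TangentSpace 𝓘(ℝ, Model n) x)}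

namespace HypercomplexHermitian.AdaptedFrame

variable {f : X.AdaptedFrame x D}

lemma HasCovJet.star {φ : Form (Model n) M} {ψ : Model n → Ext (Model n)}
    (h : f.HasCovJet φ ψ) (hJ : X.IsBismut X.J D) :
    f.HasCovJet (X.star φ) fun a => hodge (X.metricAt x) (X.stdFrame x) (ψ a) := by
  have he := X.isONB_stdFrame x
  refine h.map hodge_add (fun c η => by rw [hodge_smul, Complex.conj_ofReal]) (fun l => ?_)
    (f.eventually_rep_star φ) fun a η => he.hodge_der ⟨2 * n, by ring⟩ (f.Z_skew hJ a) η
  rcases le_or_gt l (4 * n) with hl | hl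
  · refine ⟨4 * n - l, fun η hη => ?_⟩
    have h1 := hodge_deg_congr (s := X.metricAt x) (e := X.stdFrame x) (Nat.sub_add_cancel hl)
      (β := η) (γ := 0) hη
    rw [h1, hodge_zero]
    rfl
  · exact ⟨0, fun η _ => hodge_of_lt hl η⟩

lemma HasCovJet.actJInv {φ : Form (Model n) M} {ψ : Model n → Ext (Model n)}
    (h : f.HasCovJet φ ψ) (hJ : X.IsBismut X.J D) :
    f.HasCovJet (X.actJInv φ) fun a => pull (endAt X.J x) (ψ a) := by
  refine h.map (pull_add _) (fun c η => pull_smul _ _ _) (fun l => ⟨l, fun η hη => ?_⟩)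
    (f.eventually_rep_actJInv φ) fun a η => pull_der_comm ?_ η
  · have h1 : pull (endAt X.J x) η l = (η l).compContinuousLinearMap (endAt X.J x) := rfl
    rw [h1, hη]
    rfl
  · ext1 v
    exact (f.Z_comm f.J_k hJ a v).symm

lemma HasCovJet.LOmega {φ : Form (Model n) M} {ψ : Model n → Ext (Model n)}
    (h : f.HasCovJet φ ψ) (hJ : X.IsBismut X.J D) (hK : X.IsBismut X.K D) :
    f.HasCovJet (X.LOmega φ) fun a =>
      mulOmega (X.metricAt x) (X.stdFrame x) (endAt X.J x) (endAt X.K x) (ψ a) := by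
  refine h.map (map_add _) (fun c η => map_smul _ _ _) (fun l => ?_)
    (f.eventually_rep_LOmega φ) fun a η => (f.der_Z_mulOmega hJ hK a η).symm
  rcases l with _ | _ | l
  · exact ⟨0, fun η _ => mulOmega_of_lt η (by omega)⟩
  · exact ⟨0, fun η _ => mulOmega_of_lt η (by omega)⟩
  · exact ⟨l, fun η hη => mulOmega_deg η hη⟩

lemma isSkewTorsion {L : ∀ x : M, TangentSpace 𝓘(ℝ, Model n) x →L[ℝ] TangentSpace 𝓘(ℝ, Model n) x}
    (hD : X.IsBismut L D) : IsSkewTorsion (X.metricAt x) (torsionAt D x) where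
  anti := torsionAt_antisymm D x
  skew := hD.torsion x

/-- The star is parallel and commutes with the derivations of the skew endomorphisms `T(e_a)`, so it
can be pulled out; in doing so it turns `e^a ∧` into `ι_a`, up to the degree involution. -/
lemma HasCovJet.extD_star {φ : Form (Model n) M} {ψ : Model n → Ext (Model n)}
    (h : f.HasCovJet φ ψ) (hJ : X.IsBismut X.J D) (k : ℕ) :
    extD (fun z => X.star φ z k) x = hodge (X.metricAt x) (X.stdFrame x)
      (sgn (∑ a, inn (X.stdFrame x a) (ψ (X.stdFrame x a)
        + (1 / 2 : ℂ) • der (torsionAt D x (X.stdFrame x a)) (formAt φ x)))) (k + 1) := by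
  have he := X.isONB_stdFrame x
  have hT : IsSkewTorsion (X.metricAt x) (torsionAt D x) := isSkewTorsion hJ
  rw [(h.star hJ).extD_eq]
  have h1 : formAt (X.star φ) x = hodge (X.metricAt x) (X.stdFrame x) (formAt φ x) := rfl
  refine congrFun ?_ (k + 1)
  rw [h1, map_sum, hodge_sum]
  refine Finset.sum_congr rfl fun a _ => ?_
  have hs : ∀ u v, X.metricAt x (torsionAt D x (X.stdFrame x a) u) v
      = -X.metricAt x u (torsionAt D x (X.stdFrame x a) v) := fun u v => by
    rw [hT.skew, he.symm u]
  have hE : Even (4 * n) := ⟨2 * n, by ring⟩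
  rw [← he.hodge_der hE hs, sgn_inn, hodge_neg, ← he.eps_hodge hE, hodge_add, hodge_smul]
  have h2 : (starRingEnd ℂ) (1 / 2) = 1 / 2 := by
    have := Complex.conj_ofReal (1 / 2)
    push_cast at this
    exact this
  rw [h2]

/-- The component comes from degree `m` with `k + 2n + m = 4n`. Its weight `-m = k - 2n`, together
with its degree, determines the type. -/
lemma isOfType_star {φ : Form (Model n) M} (hφ : ∀ z, StarZero (endAt X.I z) (formAt φ z)) {k : ℕ}
    (hk : k + 2 * n ≤ 4 * n) (z : M) :
    IsOfType (V := Model n) (endAt X.I z) k (2 * n) (formAt (X.star φ) z (k + 2 * n)) := by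
  have q := X.quatHerm z
  have he := X.isONB_stdFrame z
  obtain ⟨m, hm⟩ := Nat.exists_eq_add_of_le hk
  have h1 := ((hφ z m).hasWeight.hodge he q.I_sq q.herm_I (k + 2 * n)).isOfType (p := k)
    (q := 2 * n) rfl (by push_cast; omega)
  rwa [hodge_deg_congr (γ := formAt φ z) (by omega) (ofDegree_self _)] at h1

lemma star_eq_zero {φ : Form (Model n) M} (hφ : ∀ z, StarZero (endAt X.I z) (formAt φ z)) {l : ℕ}
    (hl : l < 2 * n) (z : M) : formAt (X.star φ) z l = 0 := by
  have q := X.quatHerm z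
  have he := X.isONB_stdFrame z
  have h1 : formAt (X.star φ) z l = hodge (X.metricAt z) (X.stdFrame z) (formAt φ z) l := rfl
  rw [h1, hodge_deg_congr (k := 4 * n - l) (γ := 0) (by omega), hodge_zero]
  · rfl
  · exact (hφ z).deg_eq_zero he q.I_sq q.self_I (by omega)

/-- The adjoint of `∂` in terms of the Bismut connection. -/
lemma HasCovJet.delStar_eq {φ : Form (Model n) M} {ψ : Model n → Ext (Model n)}
    (h : f.HasCovJet φ ψ) (hJ : X.IsBismut X.J D)
    (hφ : ∀ z, StarZero (endAt X.I z) (formAt φ z)) :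
    formAt (X.delStar φ) x = -proj0 (endAt X.I x) (∑ a, inn (X.stdFrame x a) (ψ (X.stdFrame x a)
        + (1 / 2 : ℂ) • der (torsionAt D x (X.stdFrame x a)) (formAt φ x))) := by
  have q := X.quatHerm x
  have he := X.isONB_stdFrame x
  have hE : Even (4 * n) := ⟨2 * n, by ring⟩
  have hd := h.extD_star hJ
  set S := ∑ a, inn (X.stdFrame x a) (ψ (X.stdFrame x a)
        + (1 / 2 : ℂ) • der (torsionAt D x (X.stdFrame x a)) (formAt φ x)) with hS
  have h1 : formAt (X.delStar φ) x = -hodge (X.metricAt x) (X.stdFrame x)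
    (formAt (del X.I (X.star φ)) x) := rfl
  rw [h1]
  congr 1
  funext m
  have hz : ∀ m, 4 * n < 2 * m → proj0 (endAt X.I x) S m = 0 := fun m hm =>
    (StarZero.of_proj0 he q.I_sq S).deg_eq_zero he q.I_sq q.self_I hm
  rcases lt_or_ge (4 * n) m with hm | hm
  · rw [hodge_of_lt hm, hz m (by omega)]
  obtain ⟨k, hk⟩ := Nat.exists_eq_add_of_le hm
  -- In top degree `m = 4n` the star reads the degree `0` component of `∂`, which is zero by
  -- definition. The right-hand side vanishes as well, since `4n` exceeds `2n` unless the frame is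
  -- empty.
  rcases k with _ | l
  · rw [hodge_deg_congr (β := formAt (del X.I (X.star φ)) x) (γ := 0) (k := 0) (by omega) rfl,
      hodge_zero]
    rcases Nat.eq_zero_or_pos n with h0 | h0
    · have : IsEmpty (Fin (4 * n)) := by rw [h0]; exact (inferInstance : IsEmpty (Fin 0))
      rw [hS, Finset.univ_eq_empty, Finset.sum_empty, map_zero]
    · rw [hz m (by omega)]
      rfl
  have hSS : hodge (X.metricAt x) (X.stdFrame x) (hodge (X.metricAt x) (X.stdFrame x) (sgn S)) = S := by
    rw [he.hodge_hodge hE, sgn_sgn]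
  -- Below degree `2n` the form `* φ` vanishes, being the image of degrees above `2n` in `Λ^{*,0}`.
  rcases lt_or_ge l (2 * n) with hl | hl
  · have h2 : extD (fun z => X.star φ z l) x = 0 :=
      (extD_congr (star_eq_zero hφ hl) x).trans (extD_zero x)
    have h3 : formAt (del X.I (X.star φ)) x (l + 1) = 0 := by
      refine (del_of_isOfType (p := l) (q := 0) (fun z => ?_) x).trans
        ((congrArg (typeComp (endAt X.I x) (l + 1) 0) h2).trans (typeComp_zero _ _ _ _))
      have h3 : IsOfType (V := Model n) (endAt X.I z) l 0 (formAt (X.star φ) z l) := by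
        rw [star_eq_zero hφ hl]
        exact IsOfType.zero rfl
      exact h3
    have h4 : S m = 0 := by
      rw [← hSS, hodge_deg_congr (k := l + 1) (γ := 0) (by omega) ((hd l).symm.trans h2), hodge_zero]
      rfl
    rw [hodge_deg_congr (k := l + 1) (γ := 0) (by omega) h3, hodge_zero, proj0_apply, h4,
      typeComp_zero]
    rfl
  -- Here `* φ` is of type `(p, 2n)`, and `∂` selects the type `(p + 1, 2n)` of `d * φ`. The outer
  -- star turns this selection into the projection to type `(m, 0)`, and the double star cancels
  -- `sgn`.
  · obtain ⟨p, rfl⟩ := Nat.exists_eq_add_of_le' hl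
    have h3 : formAt (del X.I (X.star φ)) x (p + 2 * n + 1) = typeComp (endAt X.I x) (p + 1) (2 * n)
        (hodge (X.metricAt x) (X.stdFrame x) (sgn S) (p + 2 * n + 1)) := by
      rw [← hd]
      exact del_of_isOfType (isOfType_star hφ (by omega)) x
    have h4 : p + 1 + 2 * n = p + 2 * n + 1 := by omega
    rw [he.typeComp_hodge (I := endAt X.I x) q.I_sq q.herm_I (p := p + 1) (q := 2 * n) (p' := m) (l := m)
      (q' := 0) rfl (by omega) (by push_cast; omega) (by rw [h4]; exact h3), hSS]
    rfl

end HypercomplexHermitian.AdaptedFrame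

end Operators
end HKT

namespace HKT

/-! ### `∂_J` and `∂̄ Ω^n` through the Bismut connection -/

section Operators

variable {n : ℕ} {M : Type*} [TopologicalSpace M] [ChartedSpace (Model n) M]
  [IsManifold 𝓘(ℝ, Model n) ∞ M] {X : HypercomplexHermitian (Model n) M} {x : M}
  {D : CovariantDerivative 𝓘(ℝ, Model n) (Model n) (fun x : M => TangentSpace 𝓘(ℝ, Model n) x)}

namespace HypercomplexHermitian.AdaptedFrame

variable {f : X.AdaptedFrame x D}

lemma isOfType_actJInv {φ : Form (Model n) M} (hφ : ∀ z, StarZero (endAt X.I z) (formAt φ z))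
    (k : ℕ) (z : M) :
    IsOfType (V := Model n) (endAt X.I z) 0 k (formAt (X.actJInv φ) z k) := by
  have q := X.quatHerm z
  refine ((hφ z k).hasWeight.comp_anti (R := endAt X.J z) (fun v => ?_)).isOfType (by simp) (by simp)
  rw [q.J_I, q.I_J]

/-- `∂_J` in terms of the Bismut connection. -/
lemma HasCovJet.delJ_eq {φ : Form (Model n) M} {ψ : Model n → Ext (Model n)}
    (h : f.HasCovJet φ ψ) (hJ : X.IsBismut X.J D)
    (hφ : ∀ z, StarZero (endAt X.I z) (formAt φ z)) :
    formAt (X.delJ φ) x = proj0 (endAt X.I x) (∑ a,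
      eps ((cov (X.metricAt x) (X.stdFrame x a)).comp (-endAt X.J x)) (ψ (X.stdFrame x a)
        + (1 / 2 : ℂ) • der ((endAt X.J x).comp ((torsionAt D x (X.stdFrame x a)).comp
          (-endAt X.J x))) (formAt φ x))) := by
  have q := X.quatHerm x
  have he := X.isONB_stdFrame x
  have hJJ : (endAt X.J x).comp (-endAt X.J x) = .id ℝ (Model n) := by
    ext1 v
    simp [q.J_sq]
  set S := ∑ a, eps (cov (X.metricAt x) (X.stdFrame x a))
      (pull (endAt X.J x) (ψ (X.stdFrame x a))
        + (1 / 2 : ℂ) • der (torsionAt D x (X.stdFrame x a)) (formAt (X.actJInv φ) x)) with hS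
  have h1 : pull (-endAt X.J x) S = ∑ a,
      eps ((cov (X.metricAt x) (X.stdFrame x a)).comp (-endAt X.J x)) (ψ (X.stdFrame x a)
        + (1 / 2 : ℂ) • der ((endAt X.J x).comp ((torsionAt D x (X.stdFrame x a)).comp
          (-endAt X.J x))) (formAt φ x)) := by
    rw [hS, ← pullL_apply, map_sum]
    refine Finset.sum_congr rfl fun a _ => ?_
    have h2 : formAt (X.actJInv φ) x = pull (endAt X.J x) (formAt φ x) := rfl
    rw [pullL_apply, pull_eps, pull_add, pull_smul, h2, pull_der _ _ _ hJJ, pull_pull, hJJ]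
    rfl
  rw [← h1]
  funext k
  rcases k with _ | k
  · have h3 : S 0 = 0 := by
      rw [hS, Finset.sum_apply]
      exact Finset.sum_eq_zero fun a _ => rfl
    have h4 : pull (-endAt X.J x) S 0 = 0 := by
      rw [← comp_eq_pull, h3]
      rfl
    rw [proj0_apply, h4, typeComp_zero]
    rfl
  · have h3 : formAt (delbar X.I (X.actJInv φ)) x (k + 1)
        = typeComp (endAt X.I x) 0 (k + 1) (S (k + 1)) :=
      (delbar_of_isOfType (isOfType_actJInv hφ k) x).trans
        (congrArg (typeComp (endAt X.I x) 0 (k + 1)) ((h.actJInv hJ).extD_eq k))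
    have h4 : formAt (X.delJ φ) x (k + 1) =
      (formAt (delbar X.I (X.actJInv φ)) x (k + 1)).compContinuousLinearMap (-endAt X.J x) := rfl
    rw [h4, h3, he.typeComp_comp_anti q.I_sq _ (by omega)]
    · rfl
    · intro v
      simp [q.J_I, q.I_J]

lemma starZero_omegaPow (m : ℕ) (z : M) :
    StarZero (endAt X.I z) (formAt (fun x => wedgePow (X.Omega x) m) z) := by
  rw [formAt_omegaPow]
  exact (X.quatHerm z).starZero_omegaPow (X.isONB_stdFrame z) m

lemma formAt_omegaPow_deg (m : ℕ) (z : M) {k : ℕ} (hk : k ≠ 2 * m) :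
    formAt (fun x => wedgePow (X.Omega x) m) z k = 0 := by
  rw [formAt_omegaPow]
  exact omegaPow_deg m hk

/-- `Ω^n` has zero covariant derivative, so only the torsion term is left in degree `2n`; in other
degrees both sides vanish. -/
lemma delbar_omegaPow (f : X.AdaptedFrame x D) (hJ : X.IsBismut X.J D) (hK : X.IsBismut X.K D) :
    formAt (delbar X.I fun x => wedgePow (X.Omega x) n) x =
      eps (thetaBar (X.metricAt x) (X.stdFrame x) (torsionAt D x) (endAt X.I x))
        (formAt (fun x => wedgePow (X.Omega x) n) x) := by
  have q := X.quatHerm x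
  have he := X.isONB_stdFrame x
  funext k
  rcases k with _ | k
  · rfl
  have h1 : formAt (delbar X.I fun x => wedgePow (X.Omega x) n) x (k + 1)
      = typeComp (endAt X.I x) k 1 (extD (fun y => wedgePow (X.Omega y) n k) x) :=
    delbar_of_isOfType (fun z => starZero_omegaPow n z k) x
  rw [h1]
  by_cases hk : k = 2 * n
  · subst hk
    rw [(f.hasCovJet_omegaPow hJ hK n).extD_eq, ← q.typeComp_top he rfl (isSkewTorsion hJ)
      (starZero_omegaPow n x) (fun k hk => formAt_omegaPow_deg n x hk)]
    simp only [zero_add]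
  · have h2 : extD (fun y => wedgePow (X.Omega y) n k) x = 0 :=
      (extD_congr (fun z => formAt_omegaPow_deg n z hk) x).trans (extD_zero x)
    rw [eps_congr (ζ := 0) (formAt_omegaPow_deg n x hk), map_zero]
    exact (congrArg (typeComp (endAt X.I x) k 1) h2).trans (typeComp_zero _ _ _ _)

end HypercomplexHermitian.AdaptedFrame

end Operators
end HKT

namespace HKT

/-! ### Formulas for the torsion and the Lee covector without frames -/

section Algebra

variable {V : Type*} [NormedAddCommGroup V] [NormedSpace ℝ V]
  {s : V →L[ℝ] V →L[ℝ] ℝ} {I J K : V →L[ℝ] V}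

/-- Pair the integrability condition at `(I a, I b)` with `I c` and use cyclicity. The cyclic sum is
what the derivative of `ω_I` produces, so `T` becomes determined by `dω_I`. -/
lemma QuatHerm.torsion_I (q : QuatHerm s I J K) {T : V →L[ℝ] V →L[ℝ] V} (hT : IsSkewTorsion s T)
    (hI : TorsionIntegrable T I) (a b c : V) :
    s (T (I a) (I b)) (I c) = s (T a b) (I c) + s (T b c) (I a) + s (T c a) (I b) := by
  have h1 := congrArg (fun w => s w (I c)) (hI (I a) (I b))
  simp only [q.I_sq, map_neg, _root_.neg_apply, neg_neg, sub_neg_eq_add, map_add,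
    _root_.add_apply, q.herm_I] at h1
  have h2 := hT.cyc (I a) b c
  have h3 := hT.cyc a (I b) c
  have h4 := hT.cyc (I b) c a
  linarith

lemma IsONB.trace_eq {N : ℕ} {e : Fin N → V} (h : IsONB s e) (F : V →ₗ[ℝ] V) :
    LinearMap.trace ℝ V F = ∑ a, s (e a) (F (e a)) := by
  rw [LinearMap.trace_eq_matrix_trace ℝ h.basis, Matrix.trace]
  refine Finset.sum_congr rfl fun a _ => ?_
  rw [Matrix.diag_apply, LinearMap.toMatrix_apply, h.basis_repr, h.basis_apply]

/-- A trace does not see the frame; this matters because the frames defining the star are chosen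
pointwise without any continuity. -/
lemma QuatHerm.leeVec_apply (q : QuatHerm s I J K) {N : ℕ} {e : Fin N → V} (h : IsONB s e)
    {T : V →L[ℝ] V →L[ℝ] V} (hT : IsSkewTorsion s T) (v : V) :
    s (leeVec e T I) v = -(1 / 2) * LinearMap.trace ℝ V (I.comp (T v) : V →L[ℝ] V) := by
  rw [cov_leeVec hT, h.trace_eq, neg_mul, ← mul_neg, ← Finset.sum_neg_distrib]
  congr 1
  refine Finset.sum_congr rfl fun a _ => ?_
  rw [q.symm (e a), ContinuousLinearMap.coe_coe, ContinuousLinearMap.comp_apply, q.skew_I, neg_neg]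

end Algebra

/-! ### Smoothness of the torsion -/

section Smooth

open Filter Topology

variable {E : Type*} [NormedAddCommGroup E] [NormedSpace ℝ E] [FiniteDimensional ℝ E]

/-- The Gram operator `h` of the metric against a fixed basis is the identity at `y`, hence has a
smooth inverse nearby, and this recovers `w` from its inner products. -/
lemma contDiffAt_of_inner {N : ℕ} {s : E → E →L[ℝ] E →L[ℝ] ℝ} {y : E} (hs : ContDiffAt ℝ ∞ s y)
    {e : Fin N → E} (he : IsONB (s y) e) {w : E → E}
    (hw : ∀ c, ContDiffAt ℝ ∞ (fun z => s z (w z) c) y) : ContDiffAt ℝ ∞ w y := by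
  have : CompleteSpace E := FiniteDimensional.complete ℝ E
  let h : E → E →L[ℝ] E := fun z => ∑ a, ((s z).flip (e a)).smulRight (e a)
  have hh : ContDiffAt ℝ ∞ h y := by
    refine contDiffAt_clm_of_apply fun v => ?_
    simp only [h, sum_apply]
    exact ContDiffAt.sum fun a _ =>
      ((hs.clm_apply contDiffAt_const).clm_apply contDiffAt_const).smul contDiffAt_const
  have h1 : h y = 1 := by
    ext1 v
    simp only [h, sum_apply]
    conv_rhs => rw [one_apply_eq_self, ← he.expand v]
    exact Finset.sum_congr rfl fun a _ => by simp [he.symm v]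
  obtain ⟨h2, -, h3⟩ := ContDiffAt.eventually_inverse hh h1
  have h4 : ContDiffAt ℝ ∞ (fun z => Ring.inverse (h z) (∑ a, s z (w z) (e a) • e a)) y :=
    h2.clm_apply (ContDiffAt.sum fun a _ => (hw (e a)).smul contDiffAt_const)
  refine h4.congr_of_eventuallyEq ?_
  filter_upwards [h3] with z hz
  have h5 : ∑ a, s z (w z) (e a) • e a = h z (w z) := by simp [h, sum_apply]
  rw [h5, ← mul_apply_eq_comp, hz.2]
  rfl

variable {M : Type*} [TopologicalSpace M] [ChartedSpace E M] [IsManifold 𝓘(ℝ, E) ∞ M]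
  (X : HypercomplexHermitian E M)
  {D : CovariantDerivative 𝓘(ℝ, E) E (fun x : M => TangentSpace 𝓘(ℝ, E) x)}

/-- The form `s(·, I ·)` in the chart around `x₀`. -/
def HypercomplexHermitian.kahlerChart (x₀ : M) (y : E) : E →L[ℝ] E →L[ℝ] ℝ :=
  (X.metricChart x₀ y).bilinearComp (.id ℝ E) (endChart x₀ X.I y)

variable {X}

lemma contDiffAt_kahlerChart {x₀ : M} {y : E} (hy : y ∈ (chartAt E x₀).target) :
    ContDiffAt ℝ ∞ (X.kahlerChart x₀) y := by
  refine contDiffAt_clm_of_apply fun u => contDiffAt_clm_of_apply fun v => ?_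
  have h1 : ContDiffAt ℝ ∞ (fun z => X.metricChart x₀ z u) y :=
    (X.contDiffAt_metricChart hy).clm_apply contDiffAt_const
  have h2 : ContDiffAt ℝ ∞ (fun z => endChart x₀ X.I z v) y :=
    (contDiffAt_endChart X.smooth_I hy).clm_apply contDiffAt_const
  exact h1.clm_apply h2

omit [FiniteDimensional ℝ E] in
lemma kahlerChart_apply {x₀ : M} {y : E} (hy : y ∈ (chartAt E x₀).target) (b c : E) :
    X.kahlerChart x₀ y b c = X.metricAt ((chartAt E x₀).symm y) (chartInv x₀ y b)
      (endAt X.I ((chartAt E x₀).symm y) (chartInv x₀ y c)) := by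
  have h1 := chartInv_chartDer ((chartAt E x₀).map_target hy)
    (endAt X.I ((chartAt E x₀).symm y) (chartInv x₀ y c))
  rw [(chartAt E x₀).right_inv hy] at h1
  exact congrArg (X.metricAt ((chartAt E x₀).symm y) (chartInv x₀ y b)) h1

/-- `D` preserves both the metric and `I`, so the coefficients of `s(·, I ·)` are differentiated by
differentiating the coordinate fields. -/
lemma fderiv_kahlerChart (hD : X.IsBismut X.I D) {x₀ : M} {y : E}
    (hy : y ∈ (chartAt E x₀).target) (a b c : E) :
    fderiv ℝ (X.kahlerChart x₀) y a b c =
      X.metricAt ((chartAt E x₀).symm y)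
        (connForm D x₀ ((chartAt E x₀).symm y) (chartInv x₀ y a) b)
        (endAt X.I ((chartAt E x₀).symm y) (chartInv x₀ y c)) +
      X.metricAt ((chartAt E x₀).symm y) (chartInv x₀ y b)
        (endAt X.I ((chartAt E x₀).symm y)
          (connForm D x₀ ((chartAt E x₀).symm y) (chartInv x₀ y a) c)) := by
  set x := (chartAt E x₀).symm y with hx
  have hxs : x ∈ (chartAt E x₀).source := (chartAt E x₀).map_target hy
  have hxy : chartAt E x₀ x = y := (chartAt E x₀).right_inv hy
  let W : E → ∀ z : M, TangentSpace 𝓘(ℝ, E) z := fun v => coordField x₀ fun _ => v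
  have hW : ∀ v, CMDiffAt ∞ (T% (W v)) x := fun v => contMDiffAt_coordField hxs contDiffAt_const
  have hIW : CMDiffAt ∞ (T% (fun z => X.I z (W c z))) x := ContMDiffAt.clm_bundle_apply (X.smooth_I _) (hW c)
  have h1 := hD.metric (W b) (fun z => X.I z (W c z)) x (mdifferentiableAt_field (hW b))
    (mdifferentiableAt_field hIW) (chartInv x₀ y a)
  have h2 : HasFDerivAt (fun z => X.kahlerChart x₀ z b c)
      (((ContinuousLinearMap.apply ℝ ℝ c).comp (ContinuousLinearMap.apply ℝ (E →L[ℝ] ℝ) b)).comp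
        (fderiv ℝ (X.kahlerChart x₀) y) : E →L[ℝ] ℝ) y := by
    have h3 := ((contDiffAt_kahlerChart (X := X) hy).differentiableAt (by simp)).hasFDerivAt
    exact (((ContinuousLinearMap.apply ℝ ℝ c).comp
      (ContinuousLinearMap.apply ℝ (E →L[ℝ] ℝ) b)).hasFDerivAt (x := X.kahlerChart x₀ y)).comp y h3
  rw [← hxy] at h2
  have h4 := hasMFDerivAt_of_chart hxs (f := fun z => X.metric.inner z (W b z) (X.I z (W c z)))
    (h2.congr_of_eventuallyEq (by
      filter_upwards [(chartAt E x₀).open_target.mem_nhds ((chartAt E x₀).map_source hxs)] with z hz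
      rw [kahlerChart_apply hz]
      simp only [W, coordField, (chartAt E x₀).right_inv hz]
      rfl))
  rw [h4.mfderiv] at h1
  have h5 : (fderiv ℝ (X.kahlerChart x₀) (chartAt E x₀ x) (chartDer x₀ x (chartInv x₀ y a))) b c =
      X.metricAt x (covAt D (W b) x (chartInv x₀ y a)) (endAt X.I x (chartInv x₀ (chartAt E x₀ x) c))
      + X.metricAt x (chartInv x₀ (chartAt E x₀ x) b)
        (covAt D (fun z => X.I z (W c z)) x (chartInv x₀ y a)) := h1
  have h6 : covAt D (fun z => X.I z (W c z)) x (chartInv x₀ y a)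
      = endAt X.I x (covAt D (W c) x (chartInv x₀ y a)) :=
    hD.complex (W c) x (mdifferentiableAt_field (hW c)) (chartInv x₀ y a)
  rw [h6, covAt_coordField_const D hxs, covAt_coordField_const D hxs, chartDer_chartInv hy, hxy] at h5
  exact h5

variable (D) in
/-- The torsion in the chart around `x₀`. -/
def torsionChart (x₀ : M) (y : E) : E →L[ℝ] E →L[ℝ] E :=
  ((ContinuousLinearMap.compL ℝ E E E (chartDer x₀ ((chartAt E x₀).symm y))).comp
    ((torsionAt D ((chartAt E x₀).symm y)).bilinearComp (chartInv x₀ y) (chartInv x₀ y)))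

/-- In `torsion_I` at `I a, I b, I c`, each torsion is the antisymmetrized connection. The six terms
regroup into three derivatives of the Kähler form, and the connection disappears from the right-hand
side. -/
lemma metricChart_torsionChart (hD : X.IsBismut X.I D) {x₀ : M} {y : E}
    (hy : y ∈ (chartAt E x₀).target)
    (hI : TorsionIntegrable (torsionAt D ((chartAt E x₀).symm y))
      (endAt X.I ((chartAt E x₀).symm y))) (a b c : E) :
    X.metricChart x₀ y (torsionChart D x₀ y a b) c =
      -(fderiv ℝ (X.kahlerChart x₀) y (endChart x₀ X.I y a) (endChart x₀ X.I y b)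
          (endChart x₀ X.I y c)
        + fderiv ℝ (X.kahlerChart x₀) y (endChart x₀ X.I y b) (endChart x₀ X.I y c)
          (endChart x₀ X.I y a)
        + fderiv ℝ (X.kahlerChart x₀) y (endChart x₀ X.I y c) (endChart x₀ X.I y a)
          (endChart x₀ X.I y b)) := by
  have hxs := (chartAt E x₀).map_target hy
  have q := X.quatHerm ((chartAt E x₀).symm y)
  have hT : IsSkewTorsion (X.metricAt ((chartAt E x₀).symm y))
      (torsionAt D ((chartAt E x₀).symm y)) :=
    ⟨torsionAt_antisymm D _, hD.torsion ((chartAt E x₀).symm y)⟩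
  have h1 : ∀ v, chartInv x₀ y (chartDer x₀ ((chartAt E x₀).symm y) v) = v := fun v => by
    have := chartInv_chartDer hxs v
    rwa [(chartAt E x₀).right_inv hy] at this
  have h2 : ∀ v, chartInv x₀ y (endChart x₀ X.I y v)
    = endAt X.I ((chartAt E x₀).symm y) (chartInv x₀ y v) := fun v => h1 _
  have h3 := fun u v => torsionAt_chartInv D hxs u v
  rw [(chartAt E x₀).right_inv hy] at h3
  have h4 : X.metricChart x₀ y (torsionChart D x₀ y a b) c =
      X.metricAt ((chartAt E x₀).symm y) (torsionAt D ((chartAt E x₀).symm y) (chartInv x₀ y a)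
        (chartInv x₀ y b)) (chartInv x₀ y c) :=
    congrArg (fun u => X.metricAt ((chartAt E x₀).symm y) u (chartInv x₀ y c)) (h1 _)
  have h5 := q.torsion_I hT hI (chartInv x₀ y (endChart x₀ X.I y a))
    (chartInv x₀ y (endChart x₀ X.I y b)) (chartInv x₀ y (endChart x₀ X.I y c))
  rw [h3, h3, h3] at h5
  simp only [h2, q.I_sq, map_neg, _root_.neg_apply, neg_neg] at h5
  rw [h4, fderiv_kahlerChart hD hy, fderiv_kahlerChart hD hy, fderiv_kahlerChart hD hy]
  simp only [h2, q.I_sq, map_neg]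
  simp only [map_sub, _root_.sub_apply] at h5
  simp only [q.herm_I, q.symm (chartInv x₀ y a), q.symm (chartInv x₀ y b),
    q.symm (chartInv x₀ y c)]
  linarith

set_option maxSynthPendingDepth 6 in
-- The inner products of the torsion are given by derivatives of smooth data, without reference to
-- the connection coefficients, whose smoothness is not available here.
lemma contDiffAt_torsionChart {N : ℕ} (hD : X.IsBismut X.I D) {x₀ : M} {y : E}
    (hy : y ∈ (chartAt E x₀).target)
    (hI : ∀ x : M, TorsionIntegrable (torsionAt D x) (endAt X.I x))
    {e : Fin N → E} (he : IsONB (X.metricChart x₀ y) e) :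
    ContDiffAt ℝ ∞ (torsionChart D x₀) y := by
  refine contDiffAt_clm_of_apply fun a => contDiffAt_clm_of_apply fun b => ?_
  refine contDiffAt_of_inner (X.contDiffAt_metricChart hy) he fun c => ?_
  have h1 : ∀ v, ContDiffAt ℝ ∞ (fun z => endChart x₀ X.I z v) y := fun v =>
    (contDiffAt_endChart X.smooth_I hy).clm_apply contDiffAt_const
  have h2 : ContDiffAt ℝ ∞ (fun z => fderiv ℝ (X.kahlerChart x₀) z) y :=
    (contDiffAt_kahlerChart (X := X) hy).fderiv_right (m := ∞) (by simp)
  have h3 : ∀ a b c, ContDiffAt ℝ ∞ (fun z => fderiv ℝ (X.kahlerChart x₀) z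
      (endChart x₀ X.I z a) (endChart x₀ X.I z b) (endChart x₀ X.I z c)) y := fun a b c =>
    ((h2.clm_apply (h1 a)).clm_apply (h1 b)).clm_apply (h1 c)
  refine (((h3 a b c).add (h3 b c a)).add (h3 c a b)).neg.congr_of_eventuallyEq ?_
  filter_upwards [(chartAt E x₀).open_target.mem_nhds hy] with z hz
  exact metricChart_torsionChart hD hz (hI _) a b c

end Smooth
end HKT

namespace HKT

/-! ### The form `θ̄` and its smoothness -/

section ThetaBar

open Filter Topology

variable {n : ℕ} {M : Type*} [TopologicalSpace M] [ChartedSpace (Model n) M]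
  [IsManifold 𝓘(ℝ, Model n) ∞ M] (X : HypercomplexHermitian (Model n) M)
  (D : CovariantDerivative 𝓘(ℝ, Model n) (Model n) (fun x : M => TangentSpace 𝓘(ℝ, Model n) x))

namespace HypercomplexHermitian

/-- The value at `x` of the form `θ̄`, computed from the torsion of the Bismut connection. -/
def thetaBarAt (x : M) : Model n →L[ℝ] ℂ :=
  thetaBar (X.metricAt x) (X.stdFrame x) (torsionAt D x) (endAt X.I x)

/-- The form `θ̄`. -/
def thetaBarForm : Form (Model n) M := fun x => eps (V := Model n) (X.thetaBarAt D x) one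

variable {X D}

lemma torsionIntegrable_I (hI : X.IsBismut X.I D) (x : M) :
    TorsionIntegrable (torsionAt D x) (endAt X.I x) := by
  obtain ⟨f⟩ := X.nonempty_adaptedFrame x D
  refine f.torsionIntegrable f.I_k hI ?_ (X.I_sq x)
  have h := X.integrable 1 0 0 (by norm_num)
  simpa using h

lemma torsionIntegrable_J (hJ : X.IsBismut X.J D) (x : M) :
    TorsionIntegrable (torsionAt D x) (endAt X.J x) := by
  obtain ⟨f⟩ := X.nonempty_adaptedFrame x D
  refine f.torsionIntegrable f.J_k hJ ?_ (X.J_sq x)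
  have h := X.integrable 0 1 0 (by norm_num)
  simpa using h

lemma torsionIntegrable_K (hK : X.IsBismut X.K D) (x : M) :
    TorsionIntegrable (torsionAt D x) (endAt X.K x) := by
  obtain ⟨f⟩ := X.nonempty_adaptedFrame x D
  refine f.torsionIntegrable f.K_k hK ?_ (X.K_sq x)
  have h := X.integrable 0 0 1 (by norm_num)
  simpa using h

variable (X D) in
/-- The Lee form of `I` in the chart around `x₀`. -/
def leeChart (x₀ : M) (y v : Model n) : ℝ :=
  -(1 / 2) * LinearMap.trace ℝ (Model n)
    ((endChart x₀ X.I y).comp (torsionChart D x₀ y v) : Model n →L[ℝ] Model n)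

/-- The trace formula is invariant under conjugation by the derivative of the chart, so the Lee
covector can be computed from the smooth torsion in coordinates. -/
lemma leeVec_chartInv (hI : X.IsBismut X.I D) {x₀ : M} {y : Model n}
    (hy : y ∈ (chartAt (Model n) x₀).target) (v : Model n) :
    X.metricAt ((chartAt (Model n) x₀).symm y)
      (leeVec (X.stdFrame ((chartAt (Model n) x₀).symm y))
        (torsionAt D ((chartAt (Model n) x₀).symm y)) (endAt X.I ((chartAt (Model n) x₀).symm y)))
      (chartInv x₀ y v) = X.leeChart D x₀ y v := by
  set x := (chartAt (Model n) x₀).symm y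
  have hT : IsSkewTorsion (X.metricAt x) (torsionAt D x) := AdaptedFrame.isSkewTorsion hI
  rw [(X.quatHerm x).leeVec_apply (X.isONB_stdFrame x) hT, leeChart]
  congr 1
  have h1 : ∀ v, chartInv x₀ y (chartDer x₀ x v) = v := fun v => by
    have := chartInv_chartDer ((chartAt (Model n) x₀).map_target hy) v
    rwa [(chartAt (Model n) x₀).right_inv hy] at this
  have h2 : (((endChart x₀ X.I y).comp (torsionChart D x₀ y v) : Model n →L[ℝ] Model n) :
      Model n →ₗ[ℝ] Model n) = ((chartDer x₀ x : Model n →L[ℝ] Model n) : Model n →ₗ[ℝ] Model n) *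
        (((endAt X.I x).comp (torsionAt D x (chartInv x₀ y v)) : Model n →L[ℝ] Model n) *
          ((chartInv x₀ y : Model n →L[ℝ] Model n) : Model n →ₗ[ℝ] Model n)) := by
    ext1 w
    exact congrArg (fun u => chartDer x₀ x (endAt X.I x u)) (h1 _)
  have h3 : (((chartInv x₀ y : Model n →L[ℝ] Model n) : Model n →ₗ[ℝ] Model n)) * ((chartDer x₀ x : Model n →L[ℝ] Model n) : Model n →ₗ[ℝ] Model n)
      = 1 := by
    ext1 w
    exact h1 w
  rw [h2, LinearMap.trace_mul_comm, mul_assoc, h3, mul_one]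

lemma contDiffAt_leeChart (hI : X.IsBismut X.I D) {x₀ : M} {y : Model n}
    (hy : y ∈ (chartAt (Model n) x₀).target) {w : Model n → Model n} (hw : ContDiffAt ℝ ∞ w y) :
    ContDiffAt ℝ ∞ (fun z => X.leeChart D x₀ z (w z)) y := by
  have q := X.quatHerm_chart hy
  obtain ⟨u, hu⟩ := q.exists_isQuatOrthonormal (n := n) (by simp)
  have h1 := contDiffAt_torsionChart hI hy (torsionIntegrable_I hI)
    (q.isONB_quatFrame (by simp) hu)
  have h2 : ContDiffAt ℝ ∞ (fun z => (endChart x₀ X.I z).comp (torsionChart D x₀ z (w z))) y :=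
    (contDiffAt_endChart X.smooth_I hy).clm_comp (h1.clm_apply hw)
  let tr : (Model n →L[ℝ] Model n) →L[ℝ] ℝ := LinearMap.toContinuousLinearMap
    ((LinearMap.trace ℝ (Model n)).comp (ContinuousLinearMap.coeLM ℝ))
  exact contDiffAt_const.mul (tr.contDiff.contDiffAt.comp y h2)

lemma isSmooth_thetaBarForm (hI : X.IsBismut X.I D) : IsSmooth (X.thetaBarForm D) := by
  intro k x₀ y hy
  refine ContDiffAt.contDiffWithinAt ?_
  by_cases hk : k = 1
  · subst hk
    let L : (Model n →L[ℝ] ℂ) →L[ℝ] (Model n [⋀^Fin 1]→L[ℝ] ℂ) := LinearMap.toContinuousLinearMap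
      { toFun := fun α => eps α one 1
        map_add' := fun α β => by rw [map_add]; rfl
        map_smul' := fun c α => by
          have : c • α = (c : ℂ) • α := by ext; simp
          rw [this, map_smul]
          ext v
          simp }
    have h1 : ∀ z, inChart x₀ (fun x => X.thetaBarForm D x 1) z =
        L ((X.thetaBarAt D ((chartAt (Model n) x₀).symm z)).comp (chartInv x₀ z)) := by
      intro z
      have h2 : inChart x₀ (fun x => X.thetaBarForm D x 1) z = pull (chartInv x₀ z)
        (eps (X.thetaBarAt D ((chartAt (Model n) x₀).symm z)) one) 1 := rfl
      rw [h2, pull_eps, pull_one]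
      rfl
    rw [show inChart x₀ (fun x => X.thetaBarForm D x 1) = _ from funext h1]
    refine L.contDiff.contDiffAt.comp y (contDiffAt_clm_of_apply fun v => ?_)
    have h3 : ContDiffAt ℝ ∞ (fun z => (1 / 2 : ℂ) * (Complex.I * (X.leeChart D x₀ z v : ℝ)
        + Complex.I * (Complex.I * (X.leeChart D x₀ z (endChart x₀ X.I z v) : ℝ)))) y := by
      have h4 := Complex.ofRealCLM.contDiff.contDiffAt.comp y
        (contDiffAt_leeChart (D := D) hI hy (w := fun _ => v) contDiffAt_const)
      have h5 := Complex.ofRealCLM.contDiff.contDiffAt.comp y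
        (contDiffAt_leeChart (D := D) hI hy ((contDiffAt_endChart X.smooth_I hy).clm_apply
          (contDiffAt_const (c := v))))
      exact contDiffAt_const.mul ((contDiffAt_const.mul h4).add
        (contDiffAt_const.mul (contDiffAt_const.mul h5)))
    refine h3.congr_of_eventuallyEq ?_
    filter_upwards [(chartAt (Model n) x₀).open_target.mem_nhds hy] with z hz
    have h6 : chartInv x₀ z (endChart x₀ X.I z v) =
        endAt X.I ((chartAt (Model n) x₀).symm z) (chartInv x₀ z v) := by
      have := chartInv_chartDer ((chartAt (Model n) x₀).map_target hz)
        (endAt X.I ((chartAt (Model n) x₀).symm z) (chartInv x₀ z v))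
      rwa [(chartAt (Model n) x₀).right_inv hz] at this
    rw [← leeVec_chartInv hI hz, ← leeVec_chartInv hI hz, h6, ContinuousLinearMap.comp_apply,
      thetaBarAt, thetaBar, part01_apply]
    rfl
  · have h1 : ∀ z, inChart x₀ (fun x => X.thetaBarForm D x k) z = 0 := by
      intro z
      have h2 : eps (X.thetaBarAt D ((chartAt (Model n) x₀).symm z)) one k = 0 := by
        rcases k with _ | _ | k
        · rfl
        · exact absurd rfl hk
        · exact (eps_congr (ζ := 0) rfl _).trans (by rw [map_zero]; rfl)
      exact (congrArg (fun α : Model n [⋀^Fin k]→L[ℝ] ℂ =>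
        α.compContinuousLinearMap (chartInv x₀ z)) h2).trans rfl
    rw [show inChart x₀ (fun x => X.thetaBarForm D x k) = _ from funext h1]
    exact contDiffAt_const

end HypercomplexHermitian

end ThetaBar
end HKT

namespace HKT

/-! ### Existence, uniqueness and the commutator formula -/

section Main

variable {n : ℕ} {M : Type*} [TopologicalSpace M] [ChartedSpace (Model n) M]
  [IsManifold 𝓘(ℝ, Model n) ∞ M] {X : HypercomplexHermitian (Model n) M}
  {D : CovariantDerivative 𝓘(ℝ, Model n) (Model n) (fun x : M => TangentSpace 𝓘(ℝ, Model n) x)}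

lemma eps_one_eq_ofDegree {V : Type*} [NormedAddCommGroup V] [NormedSpace ℝ V] (α : V →L[ℝ] ℂ) :
    eps α one = ofDegree (eps α one 1) := by
  funext k
  rcases k with _ | _ | k
  · rfl
  · rw [ofDegree_self]
  · refine Eq.trans ?_ (dif_neg (by omega)).symm
    exact (eps_congr (ζ := 0) rfl _).trans (by rw [map_zero]; rfl)

lemma isOfType_eps_one {V : Type*} [NormedAddCommGroup V] [NormedSpace ℝ V] {I : V →L[ℝ] V}
    (hI : ∀ v, I (I v) = -v) (α : V →L[ℝ] ℂ) :
    IsOfType I 0 1 (eps (part01 I α) one 1) :=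
  ((StarZero.one (I := I)) 0).eps01 hI α

/-- Rotation by the angle `π / 2` is `I` itself, and the corresponding phase is `-i`. -/
lemma IsOfType.apply_I {V : Type*} [NormedAddCommGroup V] [NormedSpace ℝ V] {I : V →L[ℝ] V}
    {α : V [⋀^Fin 1]→L[ℝ] ℂ} (hα : IsOfType I 0 1 α) (v : V) :
    toCovector α (I v) = -(Complex.I * toCovector α v) := by
  have h1 := congrArg (fun φ : V [⋀^Fin 1]→L[ℝ] ℂ => φ ![v]) (hα.2 (Real.pi / 2))
  have h2 : rot I (Real.pi / 2) ∘ ![v] = ![I v] := by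
    funext i
    simp [rot, Matrix.cons_val_fin_one]
  have h3 : Complex.exp (((0 : ℕ) - (1 : ℕ) : ℂ) * (Real.pi / 2 : ℝ) * Complex.I) = -Complex.I := by
    rw [show ((0 : ℕ) - (1 : ℕ) : ℂ) * (Real.pi / 2 : ℝ) * Complex.I
      = -(Real.pi / 2 * Complex.I) by push_cast; ring, Complex.exp_neg, Complex.exp_pi_div_two_mul_I,
      Complex.inv_I]
  rw [h3] at h1
  have h4 : α (rot I (Real.pi / 2) ∘ ![v]) = -Complex.I * α ![v] := h1
  rw [toCovector_apply, toCovector_apply, ← h2, h4, neg_mul]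

lemma wedge_eps_one {V : Type*} [NormedAddCommGroup V] [NormedSpace ℝ V] (α : V →L[ℝ] ℂ)
    (β : Ext V) : wedge (eps α one) β = eps α β := by
  rw [wedge_eps, wedge_one]

namespace HypercomplexHermitian

lemma isThetaBar_thetaBarForm (hI : X.IsBismut X.I D) (hJ : X.IsBismut X.J D)
    (hK : X.IsBismut X.K D) : X.IsThetaBar n (X.thetaBarForm D) := by
  refine ⟨isSmooth_thetaBarForm hI, fun x => ⟨_, isOfType_eps_one (V := Model n) (X.I_sq x) _,
    eps_one_eq_ofDegree (V := Model n) _⟩, ?_⟩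
  funext x
  obtain ⟨f⟩ := X.nonempty_adaptedFrame x D
  exact (f.delbar_omegaPow hJ hK).trans (wedge_eps_one (V := Model n) _ _).symm

/-- The difference of two solutions is, at each point, a `(0,1)`-covector whose product with the
nonzero form `Ω^n` vanishes. -/
lemma eq_thetaBarForm (hI : X.IsBismut X.I D) (hJ : X.IsBismut X.J D)
    (hK : X.IsBismut X.K D) {θ : Form (Model n) M} (hθ : X.IsThetaBar n θ) :
    θ = X.thetaBarForm D := by
  funext x
  have q := X.quatHerm x
  have he := X.isONB_stdFrame x
  obtain ⟨α, hα, hθα⟩ : ∃ α : Model n [⋀^Fin 1]→L[ℝ] ℂ, IsOfType (endAt X.I x) 0 1 α ∧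
    formAt θ x = ofDegree α := hθ.2.1 x
  have h1 : formAt θ x = eps (toCovector α) one := hθα.trans (ofDegree_eq_eps α)
  have h2 := (congrFun hθ.2.2 x).symm.trans
    (congrFun (isThetaBar_thetaBarForm hI hJ hK).2.2 x)
  have h3 : wedge (formAt θ x) (formAt (fun x => wedgePow (X.Omega x) n) x)
      = wedge (eps (X.thetaBarAt D x) one) (formAt (fun x => wedgePow (X.Omega x) n) x) := h2
  rw [h1, wedge_eps_one, wedge_eps_one, AdaptedFrame.formAt_omegaPow] at h3
  have h4 : toCovector α - X.thetaBarAt D x = 0 := by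
    refine StarZero.eq_of_eps_part01 he q.I_sq (q.starZero_omegaPow he n)
      (q.omegaPow_ne_zero he rfl le_rfl) (fun v => ?_) ?_
    · have h5 := hα.apply_I v
      rw [_root_.sub_apply, _root_.sub_apply, h5, thetaBarAt, thetaBar, part01_I q.I_sq]
      ring
    · rw [map_sub, LinearMap.sub_apply, h3, sub_self]
  exact h1.trans (congrArg (fun β => eps β one) (sub_eq_zero.mp h4))

lemma formAt_LOmega (φ : Form (Model n) M) (x : M) : formAt (X.LOmega φ) x =
    mulOmega (X.metricAt x) (X.stdFrame x) (endAt X.J x) (endAt X.K x) (formAt φ x) := by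
  obtain ⟨ϖ, h1, h2⟩ := AdaptedFrame.formAt_Omega (X := X) x
  have h3 : formAt (X.LOmega φ) x = wedge (formAt X.Omega x) (formAt φ x) := rfl
  rw [h3, h1, (X.isONB_stdFrame x).wedge_omega h2]

/-- Both `η` and `Ω ∧ η` lie in `Λ^{*,0}`, so `delStar_eq` applies to both, with covariant
derivatives `ψ` and `Ω ∧ ψ`; the claim is then the pointwise identity. -/
lemma deltaJStar_sub_delJ (hI : X.IsBismut X.I D) (hJ : X.IsBismut X.J D) (hK : X.IsBismut X.K D)
    {η : Form (Model n) M} (hη : X.IsSmoothStarZero η) (x : M) :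
    formAt (X.deltaJStar η) x - formAt (X.delJ η) x =
      eps ((X.thetaBarAt D x).comp (-endAt X.J x)) (formAt η x) := by
  have q := X.quatHerm x
  have he := X.isONB_stdFrame x
  have hT : IsSkewTorsion (X.metricAt x) (torsionAt D x) := AdaptedFrame.isSkewTorsion hI
  have h0 : ∀ z, StarZero (endAt X.I z) (formAt η z) := fun z => hη.2 z
  have h0' : ∀ z, StarZero (endAt X.I z) (formAt (X.LOmega η) z) := fun z => by
    rw [formAt_LOmega]
    exact (X.quatHerm z).starZero_mulOmega (X.isONB_stdFrame z) (h0 z)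
  obtain ⟨f⟩ := X.nonempty_adaptedFrame x D
  obtain ⟨ψ, hψ⟩ := f.exists_hasCovJet hη.1
  have h1 : formAt (X.deltaJStar η) x = -(formAt (X.LOmega (X.delStar η)) x
    - formAt (X.delStar (X.LOmega η)) x) := rfl
  rw [h1, formAt_LOmega, hψ.delStar_eq hJ h0, (hψ.LOmega hJ hK).delStar_eq hJ h0',
    hψ.delJ_eq hJ h0, formAt_LOmega, thetaBarAt,
    ← q.thetaJ_eq he hT (torsionIntegrable_I hI x) (torsionIntegrable_J hJ x),
    ← q.identity he hT (torsionIntegrable_J hJ x) (torsionIntegrable_K hK x) (h0 x)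
      (fun a => ψ (X.stdFrame x a)), map_neg]
  abel

end HypercomplexHermitian

end Main
end HKT

theorem mainTheorem4 (n : ℕ) (M : Type*) [TopologicalSpace M] [T2Space M]
    [SecondCountableTopology M] [ChartedSpace (HKT.Model n) M]
    [IsManifold 𝓘(ℝ, HKT.Model n) ∞ M]
    (X : HKT.HypercomplexHermitian (HKT.Model n) M) (hX : X.IsHKT) :
    (∃! θ : HKT.Form (HKT.Model n) M, X.IsThetaBar n θ) ∧
    ∀ θ : HKT.Form (HKT.Model n) M, X.IsThetaBar n θ →
      ∀ η : HKT.Form (HKT.Model n) M, X.IsSmoothStarZero η →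
        X.deltaJStar η - X.delJ η = fun x => HKT.wedge (X.actJ θ x) (η x) := by
  obtain ⟨D, hI, hJ, hK⟩ := hX
  refine ⟨⟨X.thetaBarForm D, HKT.HypercomplexHermitian.isThetaBar_thetaBarForm hI hJ hK,
    fun θ hθ => HKT.HypercomplexHermitian.eq_thetaBarForm hI hJ hK hθ⟩, fun θ hθ η hη => ?_⟩
  rw [HKT.HypercomplexHermitian.eq_thetaBarForm hI hJ hK hθ]
  funext x
  refine (HKT.HypercomplexHermitian.deltaJStar_sub_delJ hI hJ hK hη x).trans ?_
  have h1 : HKT.formAt (X.actJ (X.thetaBarForm D)) x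
      = HKT.eps ((X.thetaBarAt D x).comp (-HKT.endAt X.J x)) HKT.one := by
    have h2 : HKT.formAt (X.actJ (X.thetaBarForm D)) x
      = HKT.pull (-HKT.endAt X.J x) (HKT.eps (X.thetaBarAt D x) HKT.one) := rfl
    rw [h2, HKT.pull_eps, HKT.pull_one]
  have h3 := HKT.wedge_eps_one ((X.thetaBarAt D x).comp (-HKT.endAt X.J x)) (HKT.formAt η x)
  rw [← h1] at h3
  exact h3.symm
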